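/- Let $p>2$ be a prime, $F_0/\mathbb{Q}_p$ a finite extension with uniformizer $\varpi$, $F/F_0$ the unramified quadratic extension with ring of integers $O_F$ and nontrivial automorphism $\sigma$ over $F_0$. Let $W_0$ be a split $F/F_0$-hermitian space of dimension $n$, i.e. one admitting a basis in which the hermitian form is given by the antidiagonal unit matrix, and put $m=\lfloor n/2\rfloor$. A vertex lattice of type $t$ in $W_0$ is an $O_F$-lattice $\Lambda$ with $\Lambda\subset\Lambda^\vee\subset\varpi^{-1}\Lambda$ and $\dim_{O_F/\varpi}(\Lambda^\vee/\Lambda)=t$, where $\Lambda^\vee$ is the dual lattice. Fix a chain of vertex lattices $\Xi_0\supset\Xi_2\supset\cdots\supset\Xi_{2m}$ with $\Xi_t$ of type $t$ (so $\Xi_0$ is self-dual), let $K_t\subset \mathrm{U}(W_0)(F_0)$ be the stabilizer of $\Xi_t$, and let $K=K_0$. For even $t,t'$ with $0\le t,t'\le n$ let $\mathcal{H}(K_t,K_{t'})$ be the space of left $K_t$-invariant, right $K_{t'}$-invariant functions $\mathrm{U}(W_0)(F_0)\to\mathbb{Q}$ whose support is a finite union of cosets $gK_{t'}$. For $f$ right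 $K_t$-invariant and $g$ left $K_t$-invariant of this kind, let $(f*g)(x)=\sum_{y\in \mathrm{U}(W_0)(F_0)/K_t}f(y)g(y^{-1}x)$ (convolution for the Haar measure giving $K_t$ volume one); with this product $\mathcal{H}_K=\mathcal{H}(K,K)=\mathbb{Q}[K\backslash \mathrm{U}(W_0)(F_0)/K]$ is the spherical Hecke algebra. The atomic functions are $\varphi_t=\mathbf{1}_{K_0K_t}*\mathbf{1}_{K_tK_0}$ for even $t$ with $0\le t\le n$. Then $\mathbf{1}_{K_0K_t}\in\mathcal{H}(K_0,K_t)$ and $\mathbf{1}_{K_tK_0}\in\mathcal{H}(K_t,K_0)$, and $\mathcal{H}_K$ is the polynomial algebra $$\mathcal{H}_K=\mathbb{Q}[\varphi_2,\varphi_4,\dots,\varphi_{2m}],$$ i.e. there is an isomorphism of $\mathbb{Q}$-algebras $\mathbb{Q}[X_1,\dots,X_m]\to\mathcal{H}_K$ with $X_i\mapsto\varphi_{2i}$. More precisely, there are bases of $W_0$ that are $O_F$-bases of $\Xi_0$ and in which the form is given by the antidiagonal unit matrix, and for each such basis the functions $f^{[t]}=\mathbf{1}_{K\varpi^{(1^{t/2},0^{n-t},(-1)^{t/2})}K}$,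 $t$ even with $0\le t\le n$ (so that $f^{[0]}$ is the unit of $\mathcal{H}_K$), lie in $\mathcal{H}_K$, and there is an upper-triangular matrix $(m(t',t))$ over $\mathbb{Q}$, indexed by the even integers $0\le t',t\le n$, with all diagonal entries equal to $1$, such that for all even $t$ with $0\le t\le n$ $$\varphi_t=\sum_{0\le t'\le t,\ t'\ \mathrm{even}}m(t',t)\,f^{[t']}.$$ -/

import Mathlib

open scoped Pointwise

noncomputable section

namespace UnitaryHecke

/-! ### Hecke algebras of functions on a group -/

section Hecke

variable {G : Type*} [Group G]

/-- The space of `K`-left-invariant and `K'`-right-invariant functions `G → ℚ` whose support is a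
finite union of left cosets `g K'` (that is, compactly supported functions when `K` and `K'` are
compact open subgroups). -/
def heckeSpace (K K' : Subgroup G) : Submodule ℚ (G → ℚ) where
  carrier := {f | (∀ k ∈ K, ∀ x, f (k * x) = f x) ∧ (∀ k ∈ K', ∀ x, f (x * k) = f x) ∧
    ((fun x : G => (x : G ⧸ K')) '' Function.support f).Finite}
  zero_mem' := ⟨fun _ _ _ => rfl, fun _ _ _ => rfl, by simp⟩
  add_mem' := by
    rintro f g ⟨hf1, hf2, hf3⟩ ⟨hg1, hg2, hg3⟩
    refine ⟨fun k hk x => ?_, fun k hk x => ?_, (hf3.union hg3).subset ?_⟩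
    · simp [hf1 k hk, hg1 k hk]
    · simp [hf2 k hk, hg2 k hk]
    · rw [← Set.image_union]
      exact Set.image_mono (Function.support_add f g)
  smul_mem' := by
    rintro c f ⟨hf1, hf2, hf3⟩
    refine ⟨fun k hk x => ?_, fun k hk x => ?_, hf3.subset ?_⟩
    · simp [hf1 k hk]
    · simp [hf2 k hk]
    · exact Set.image_mono (Function.support_const_smul_subset c f)

/-- The convolution `(f * g)(x) = ∑_{y ∈ G/K} f(y) g(y⁻¹ x)` of a right `K`-invariant function `f`
and a left `K`-invariant function `g`, i.e. convolution for the Haar measure giving `K`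
volume one. -/
def conv (K : Subgroup G) (f g : G → ℚ) : G → ℚ :=
  fun x => ∑ᶠ y : G ⧸ K, f y.out * g (y.out⁻¹ * x)

theorem out_eq {K : Subgroup G} {f g : G → ℚ} (hf : ∀ k ∈ K, ∀ x, f (x * k) = f x)
    (hg : ∀ k ∈ K, ∀ x, g (k * x) = g x) (a x : G) :
    f (a : G ⧸ K).out * g ((a : G ⧸ K).out⁻¹ * x) = f a * g (a⁻¹ * x) := by
  obtain ⟨k, hk⟩ := QuotientGroup.mk_out_eq_mul K a
  rw [hk, hf _ k.2, mul_inv_rev, mul_assoc, hg _ (K.inv_mem k.2)]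

theorem finite_support {K₁ K : Subgroup G} {f : G → ℚ} (hf : f ∈ heckeSpace K₁ K) :
    (Function.support fun y : G ⧸ K => f y.out).Finite := by
  refine hf.2.2.subset fun y hy => ⟨y.out, hy, by simp⟩

theorem finite_support_mul {K₁ K : Subgroup G} {f : G → ℚ} (hf : f ∈ heckeSpace K₁ K)
    (φ : G ⧸ K → ℚ) : (Function.support fun y : G ⧸ K => f y.out * φ y).Finite :=
  (finite_support hf).subset fun _ hy => left_ne_zero_of_mul hy

/-- Translation of the summation variable in a convolution. -/
theorem conv_translate {K : Subgroup G} {f g : G → ℚ} (hf : ∀ k ∈ K, ∀ x, f (x * k) = f x)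
    (hg : ∀ k ∈ K, ∀ x, g (k * x) = g x) (z x : G) :
    ∑ᶠ y : G ⧸ K, f (z⁻¹ * y.out) * g (y.out⁻¹ * x) = conv K f g (z⁻¹ * x) := by
  unfold conv
  rw [← finsum_comp_equiv (MulAction.toPerm z : Equiv.Perm (G ⧸ K))]
  refine finsum_congr fun y => ?_
  induction y using QuotientGroup.induction_on with
  | H a =>
    have h1 := out_eq (f := fun y => f (z⁻¹ * y)) (g := g) (K := K)
      (fun k hk x => by simp [← mul_assoc, hf k hk]) hg (z * a) x
    rw [out_eq hf hg a (z⁻¹ * x)]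
    simpa [mul_assoc] using h1

theorem conv_mem {K₁ K₂ K₃ : Subgroup G} {f g : G → ℚ} (hf : f ∈ heckeSpace K₁ K₂)
    (hg : g ∈ heckeSpace K₂ K₃) : conv K₂ f g ∈ heckeSpace K₁ K₃ := by
  refine ⟨fun k hk x => ?_, fun k hk x => ?_, ?_⟩
  · have h := conv_translate hf.2.1 hg.1 k⁻¹ x
    rw [inv_inv] at h
    rw [← h]
    exact finsum_congr fun y => by rw [hf.1 k hk]
  · exact finsum_congr fun y => by rw [← mul_assoc, hg.2.1 k hk]
  · have hfin := Set.Finite.image2 (fun (y : G ⧸ K₂) (z : G ⧸ K₃) => y.out • z)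
      (finite_support hf) hg.2.2
    refine hfin.subset ?_
    rintro _ ⟨x, hx, rfl⟩
    obtain ⟨y, hy⟩ : ∃ y : G ⧸ K₂, f y.out * g (y.out⁻¹ * x) ≠ 0 := by
      by_contra! hc
      exact hx ((finsum_congr hc).trans finsum_zero)
    refine ⟨y, left_ne_zero_of_mul hy, ((y.out⁻¹ * x : G) : G ⧸ K₃),
      ⟨_, right_ne_zero_of_mul hy, rfl⟩, ?_⟩
    change ((y.out * (y.out⁻¹ * x) : G) : G ⧸ K₃) = _
    rw [mul_inv_cancel_left]

theorem conv_assoc {K₁ K₂ K₃ K₄ : Subgroup G} {f g k : G → ℚ} (hf : f ∈ heckeSpace K₁ K₂)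
    (hg : g ∈ heckeSpace K₂ K₃) (hk : k ∈ heckeSpace K₃ K₄) :
    conv K₃ (conv K₂ f g) k = conv K₂ f (conv K₃ g k) := by
  funext x
  have hS := finite_support hf
  have key : ∀ φ : G ⧸ K₂ → ℚ, ∑ᶠ z, f z.out * φ z = ∑ z ∈ hS.toFinset, f z.out * φ z :=
    fun φ => finsum_eq_sum_of_support_subset _ fun z hz => by
      simpa using left_ne_zero_of_mul hz
  have h1 : conv K₃ (conv K₂ f g) k x = ∑ᶠ y : G ⧸ K₃, ∑ z ∈ hS.toFinset,
      f z.out * (g (z.out⁻¹ * y.out) * k (y.out⁻¹ * x)) := by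
    refine finsum_congr fun y => ?_
    change (∑ᶠ z : G ⧸ K₂, f z.out * g (z.out⁻¹ * y.out)) * _ = _
    rw [key fun z => g (z.out⁻¹ * y.out), Finset.sum_mul]
    simp only [mul_assoc]
  have hfin : ∀ z : G, (Function.support fun y : G ⧸ K₃ =>
      g (z⁻¹ * y.out) * k (y.out⁻¹ * x)).Finite := fun z => by
    refine (hg.2.2.image fun w : G ⧸ K₃ => z • w).subset fun y hy => ?_
    refine ⟨((z⁻¹ * y.out : G) : G ⧸ K₃), ⟨_, left_ne_zero_of_mul hy, rfl⟩, ?_⟩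
    change ((z * (z⁻¹ * y.out) : G) : G ⧸ K₃) = y
    simp
  rw [h1, finsum_sum_comm]
  · change _ = ∑ᶠ z : G ⧸ K₂, f z.out * conv K₃ g k (z.out⁻¹ * x)
    rw [key fun z => conv K₃ g k (z.out⁻¹ * x)]
    refine Finset.sum_congr rfl fun z _ => ?_
    rw [← mul_finsum, conv_translate hg.2.1 hk.1]
  · intro z _
    exact (hfin z.out).subset fun y hy => right_ne_zero_of_mul hy

/-- The indicator function of a subset of `G`, with rational values. -/
def charFun (S : Set G) : G → ℚ := S.indicator 1

theorem charFun_mem (K : Subgroup G) : charFun (K : Set G) ∈ heckeSpace K K := by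
  classical
  refine ⟨fun k hk x => ?_, fun k hk x => ?_, (Set.finite_singleton ((1 : G) : G ⧸ K)).subset ?_⟩
  · simp [charFun, Set.indicator_apply, K.mul_mem_cancel_left hk]
  · simp [charFun, Set.indicator_apply, K.mul_mem_cancel_right hk]
  · rintro _ ⟨x, hx, rfl⟩
    have : x ∈ K := by
      by_contra h
      exact hx (by simp [charFun, h])
    simpa [eq_comm, QuotientGroup.eq] using this

theorem charFun_conv {K K' : Subgroup G} {f : G → ℚ} (hf : f ∈ heckeSpace K K') :
    conv K (charFun (K : Set G)) f = f := by
  funext x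
  unfold conv
  rw [finsum_eq_single _ ((1 : G) : G ⧸ K)]
  · rw [out_eq (charFun_mem K).2.1 hf.1]
    simp [charFun]
  · intro y hy
    have : y.out ∉ K := fun h => hy (by
      rw [← QuotientGroup.out_eq' y, QuotientGroup.eq]; simpa using h)
    simp [charFun, this]

theorem conv_charFun {K K' : Subgroup G} {f : G → ℚ} (hf : f ∈ heckeSpace K' K) :
    conv K f (charFun (K : Set G)) = f := by
  funext x
  unfold conv
  rw [finsum_eq_single _ (x : G ⧸ K)]
  · rw [out_eq hf.2.1 (charFun_mem K).1]
    simp [charFun]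
  · intro y hy
    have : y.out⁻¹ * x ∉ K := fun h => hy (by
      rw [← QuotientGroup.out_eq' y, QuotientGroup.eq]; simpa using h)
    simp [charFun, this]

theorem conv_add {K₁ K₂ : Subgroup G} {f : G → ℚ} (hf : f ∈ heckeSpace K₁ K₂) (g g' : G → ℚ) :
    conv K₂ f (g + g') = conv K₂ f g + conv K₂ f g' := by
  funext x
  change ∑ᶠ y : G ⧸ K₂, f y.out * (g (y.out⁻¹ * x) + g' (y.out⁻¹ * x)) = _
  simp only [mul_add]
  exact finsum_add_distrib (finite_support_mul hf fun y => g (y.out⁻¹ * x))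
    (finite_support_mul hf fun y => g' (y.out⁻¹ * x))

theorem add_conv {K₁ K₂ : Subgroup G} {f f' : G → ℚ} (hf : f ∈ heckeSpace K₁ K₂)
    (hf' : f' ∈ heckeSpace K₁ K₂) (g : G → ℚ) :
    conv K₂ (f + f') g = conv K₂ f g + conv K₂ f' g := by
  funext x
  change ∑ᶠ y : G ⧸ K₂, (f y.out + f' y.out) * g (y.out⁻¹ * x) = _
  simp only [add_mul]
  exact finsum_add_distrib (finite_support_mul hf fun y => g (y.out⁻¹ * x))
    (finite_support_mul hf' fun y => g (y.out⁻¹ * x))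

theorem smul_conv (K : Subgroup G) (c : ℚ) (f g : G → ℚ) :
    conv K (c • f) g = c • conv K f g := by
  funext x
  change ∑ᶠ y : G ⧸ K, c * f y.out * g (y.out⁻¹ * x) = c • ∑ᶠ y : G ⧸ K, _
  rw [smul_finsum]
  exact finsum_congr fun y => by simp [mul_assoc]

theorem conv_smul (K : Subgroup G) (c : ℚ) (f g : G → ℚ) :
    conv K f (c • g) = c • conv K f g := by
  funext x
  change ∑ᶠ y : G ⧸ K, f y.out * (c * g (y.out⁻¹ * x)) = c • ∑ᶠ y : G ⧸ K, _
  rw [smul_finsum]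
  exact finsum_congr fun y => by simp [mul_left_comm]

/-- The Hecke algebra `ℚ[K\G/K]` of bi-`K`-invariant functions, with convolution as product. -/
def HeckeAlgebra (K : Subgroup G) : Type _ := heckeSpace K K

namespace HeckeAlgebra

variable (K : Subgroup G)

instance : CoeFun (HeckeAlgebra K) fun _ => G → ℚ := ⟨fun f => f.1⟩

instance : AddCommGroup (HeckeAlgebra K) := inferInstanceAs (AddCommGroup (heckeSpace K K))

instance : Module ℚ (HeckeAlgebra K) := inferInstanceAs (Module ℚ (heckeSpace K K))

instance : Mul (HeckeAlgebra K) := ⟨fun f g => ⟨conv K f.1 g.1, conv_mem f.2 g.2⟩⟩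

instance : One (HeckeAlgebra K) := ⟨⟨charFun (K : Set G), charFun_mem K⟩⟩

instance : Ring (HeckeAlgebra K) :=
  { (inferInstance : AddCommGroup (HeckeAlgebra K)),
    (inferInstance : Mul (HeckeAlgebra K)), (inferInstance : One (HeckeAlgebra K)) with
    mul_assoc := fun f g k => Subtype.ext (conv_assoc f.2 g.2 k.2)
    one_mul := fun f => Subtype.ext (charFun_conv f.2)
    mul_one := fun f => Subtype.ext (conv_charFun f.2)
    left_distrib := fun f g g' => Subtype.ext (conv_add f.2 g.1 g'.1)
    right_distrib := fun f f' g => Subtype.ext (add_conv f.2 f'.2 g.1)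
    zero_mul := fun f => Subtype.ext <| by
      have h := smul_conv K 0 0 f.1
      rw [zero_smul, zero_smul] at h
      exact h
    mul_zero := fun f => Subtype.ext <| by
      have h := conv_smul K 0 f.1 0
      rw [zero_smul, zero_smul] at h
      exact h }

instance : Algebra ℚ (HeckeAlgebra K) :=
  Algebra.ofModule (fun c f g => Subtype.ext (smul_conv K c f.1 g.1))
    (fun c f g => Subtype.ext (conv_smul K c f.1 g.1))

end HeckeAlgebra

/-- The intertwining function `φ_{[K, K']} = 1_{K K'}`. -/
def intertwining (K K' : Subgroup G) : G → ℚ := charFun ((K : Set G) * (K' : Set G))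

/-- The atomic function `1_{K K'} * 1_{K' K}`. -/
def atomic (K K' : Subgroup G) : G → ℚ := conv K' (intertwining K K') (intertwining K' K)

end Hecke

/-! ### Rings of integers -/

section Integers

variable (p : ℕ) [Fact p.Prime] (F₀ F : Type*) [Field F₀] [Algebra ℤ_[p] F₀] [Field F]
  [Algebra F₀ F]

/-- The ring of integers of an extension `F₀` of `ℚ_p`. -/
abbrev baseIntegers : Subalgebra ℤ_[p] F₀ := integralClosure ℤ_[p] F₀

/-- The ring of integers of an extension `F` of `F₀`. -/
abbrev extIntegers : Subalgebra (baseIntegers p F₀) F := integralClosure (baseIntegers p F₀) F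

variable {F₀} in
/-- `ϖ` is a uniformizer of `F₀`. -/
def IsUniformizer (ϖ : F₀) : Prop := ∃ π : baseIntegers p F₀, Irreducible π ∧ (π : F₀) = ϖ

variable {p F₀} in
theorem IsUniformizer.ne_zero {ϖ : F₀} (h : IsUniformizer p ϖ) : ϖ ≠ 0 := by
  obtain ⟨π, hπ, rfl⟩ := h
  simpa using hπ.ne_zero

end Integers

/-! ### Hermitian spaces, vertex lattices, unitary groups -/

section Hermitian

variable {F₀ F W : Type*} [Field F₀] [Field F] [Algebra F₀ F] {σ : F ≃ₐ[F₀] F}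
  [AddCommGroup W] [Module F W] (h : W →ₛₗ[(σ : F →+* F)] W →ₗ[F] F)

/-- The unitary group of the `σ`-hermitian form `h`. -/
def unitaryGroup : Subgroup (W ≃ₗ[F] W) where
  carrier := {g | ∀ x y, h (g x) (g y) = h x y}
  mul_mem' := fun {a b} ha hb x y => (ha (b x) (b y)).trans (hb x y)
  one_mem' := fun _ _ => rfl
  inv_mem' := fun {a} ha x y => by
    have e : ∀ z, a (a⁻¹ z) = z := fun z => LinearEquiv.apply_symm_apply a z
    rw [← ha (a⁻¹ x) (a⁻¹ y), e, e]

/-- The Gram matrix of `h` in the basis `b` is the antidiagonal unit matrix. -/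
def IsAntidiagonal {n : ℕ} (b : Module.Basis (Fin n) F W) : Prop :=
  ∀ i j, h (b i) (b j) = if j = Fin.rev i then 1 else 0

/-- The hermitian space is split of dimension `n`. -/
def IsSplit (n : ℕ) : Prop := ∃ b : Module.Basis (Fin n) F W, IsAntidiagonal h b

section Lattices

variable {R : Type*} [CommRing R] [Algebra R F] [Module R W] [IsScalarTower R F W]

/-- The dual lattice `Λ^∨ = {x | h(Λ, x) ⊆ R}` (here `R` is the ring of integers of `F`). -/
def dualLattice (Λ : Submodule R W) : Submodule R W where
  carrier := {x | ∀ y ∈ Λ, h y x ∈ (algebraMap R F).range}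
  zero_mem' := fun y _ => by simp
  add_mem' := fun {a b} ha hb y hy => by
    rw [map_add]; exact add_mem (ha y hy) (hb y hy)
  smul_mem' := fun r x hx y hy => by
    rw [LinearMap.map_smul_of_tower, Algebra.smul_def]
    exact mul_mem ⟨r, rfl⟩ (hx y hy)

/-- `Λ` is a vertex lattice of type `t`: a lattice with `Λ ⊆ Λ^∨ ⊆ ϖ⁻¹ Λ` such that `Λ^∨ / Λ`
has dimension `t` over the residue field of `R` (i.e. has length `t` as `R`-module). -/
structure IsVertexLattice (ϖ : F₀) (t : ℕ) (Λ : Submodule R W) : Prop where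
  isLattice : Λ.IsLattice F
  le_dual : Λ ≤ dualLattice h Λ
  smul_mem : ∀ x ∈ dualLattice h Λ, algebraMap F₀ F ϖ • x ∈ Λ
  type_eq : Module.length R (dualLattice h Λ ⧸ Λ.submoduleOf (dualLattice h Λ)) = t

/-- The stabilizer of the lattice `Λ` in the unitary group. -/
def latticeStabilizer (Λ : Submodule R W) : Subgroup (unitaryGroup h) where
  carrier := {g | ∀ x, (g : W ≃ₗ[F] W) x ∈ Λ ↔ x ∈ Λ}
  mul_mem' := fun {a b} ha hb x => (ha ((b : W ≃ₗ[F] W) x)).trans (hb x)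
  one_mem' := fun _ => Iff.rfl
  inv_mem' := fun {a} ha x => by
    have e : (a : W ≃ₗ[F] W) (((a⁻¹ : unitaryGroup h) : W ≃ₗ[F] W) x) = x :=
      LinearEquiv.apply_symm_apply (a : W ≃ₗ[F] W) x
    rw [← ha, e]

end Lattices

/-- The cocharacter `(1^s, 0^{n-2s}, (-1)^s)`. -/
def cochar (n s : ℕ) (i : Fin n) : ℤ :=
  if (i : ℕ) < s then 1 else if n ≤ (i : ℕ) + s then -1 else 0

theorem cochar_rev {n s : ℕ} (hs : 2 * s ≤ n) (i : Fin n) :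
    cochar n s (Fin.rev i) = -cochar n s i := by
  have := i.2
  simp only [cochar, Fin.val_rev]
  split_ifs <;> omega

variable {h} in
/-- The element `ϖ^{(1^s, 0^{n-2s}, (-1)^s)}` of the unitary group: the diagonal matrix with these
powers of `ϖ` in a basis in which `h` is antidiagonal. -/
def cocharElt {n s : ℕ} {b : Module.Basis (Fin n) F W} (hb : IsAntidiagonal h b)
    (hs : 2 * s ≤ n) {ϖ : F₀} (hϖ : ϖ ≠ 0) : unitaryGroup h :=
  ⟨b.equiv (b.unitsSMul fun i => Units.map (algebraMap F₀ F : F₀ →* F) (Units.mk0 ϖ hϖ) ^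
      cochar n s i) (Equiv.refl _), by
    set a : W ≃ₗ[F] W := b.equiv (b.unitsSMul fun i =>
      Units.map (algebraMap F₀ F : F₀ →* F) (Units.mk0 ϖ hϖ) ^ cochar n s i) (Equiv.refl _) with ha
    have hab : ∀ i, a (b i) = (algebraMap F₀ F ϖ ^ cochar n s i) • b i := fun i => by
      simp [ha, Module.Basis.unitsSMul_apply, Units.smul_def]
    have hz : algebraMap F₀ F ϖ ≠ 0 := by simpa using hϖ
    intro x y
    have key₁ : ∀ i y, h (a (b i)) (a y) = h (b i) y := fun i y => by
      have : (h (a (b i))).comp (a : W →ₗ[F] W) = h (b i) := by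
        refine b.ext fun j => ?_
        simp only [LinearMap.comp_apply, LinearEquiv.coe_coe, hab, LinearMap.map_smulₛₗ,
          LinearMap.smul_apply, hb i j, smul_eq_mul]
        by_cases hij : j = Fin.rev i
        · subst hij
          simpa [cochar_rev hs] using inv_mul_cancel₀ (zpow_ne_zero (cochar n s i) hz)
        · simp [hij]
      exact congrArg (fun B : W →ₗ[F] F => B y) this
    have key₂ : (h.flip (a y)).comp (a : W →ₗ[F] W) = h.flip y :=
      b.ext fun i => key₁ i y
    exact congrArg (fun B : W →ₛₗ[(σ : F →+* F)] F => B x) key₂⟩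

variable {h} in
theorem cocharElt_apply {n s : ℕ} {b : Module.Basis (Fin n) F W} (hb : IsAntidiagonal h b)
    (hs : 2 * s ≤ n) {ϖ : F₀} (hϖ : ϖ ≠ 0) (i : Fin n) :
    (cocharElt hb hs hϖ : W ≃ₗ[F] W) (b i) = (algebraMap F₀ F ϖ ^ cochar n s i) • b i := by
  simp [cocharElt, Module.Basis.unitsSMul_apply, Units.smul_def]

variable {h} in
/-- The function `f^{[2s]}`: the indicator function of the double coset
`K ϖ^{(1^s, 0^{n-2s}, (-1)^s)} K`. -/
def basicFun (K : Subgroup (unitaryGroup h)) {n s : ℕ} {b : Module.Basis (Fin n) F W}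
    (hb : IsAntidiagonal h b) (hs : 2 * s ≤ n) {ϖ : F₀} (hϖ : ϖ ≠ 0) : unitaryGroup h → ℚ :=
  charFun (DoubleCoset.doubleCoset (cocharElt hb hs hϖ) K K)

end Hermitian

end UnitaryHecke

end

/-!
The proof rests on the relative position of lattices in the hermitian space `W`. Throughout,
`R` is the ring of integers of `F`; all that is used of it is that it is a discrete valuation ring
with finite residue field, uniformizer `ϖ` and invertible `2`, on which `σ` acts, and that Hensel's
lemma holds for the equations `t ^ 2 + 2 * t + e = 0` (`extIntegers_properties`).

*Apartments.* For a self-dual lattice `L` and a vertex lattice `M` there is an `R`-basis of `L` in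
which the form is antidiagonal and which becomes a basis of `M` after scaling by powers of `ϖ`
(`IsAntidiagonal.exists_common_basis`). Indeed, let `a` be minimal with `ϖ ^ a M^∨ ⊆ L`. A vector
of `ϖ ^ a M^∨`, of `ϖ ^ a M` where possible, which is primitive in `L` can be corrected by Hensel's
lemma to an isotropic vector, and this vector spans with a partner a hyperbolic plane that splits
off from both lattices; for `a = 0` the lattices coincide, and any primitive isotropic vector will
do. The orthogonal complement is treated by induction. In the end there may
remain a line, on which the form is a unit; comparing discriminants, that unit is a norm, so that
it can be scaled to `1`. For `M = g L` this is the Cartan decomposition (`exists_cartan`). For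
`M ⊆ L` it gives a normal form of the pairs of lattices occurring in the definition of the atomic
functions (`IsVertexLattice.exists_basis`).

*Hecke algebra.* The double cosets `K \ G / K` are thus represented by the elements `ϖ ^ ν`, `ν`
running through the dominant cocharacters, which form a free commutative monoid on the fundamental
ones `(1 ^ s, 0, (-1) ^ s)`. Bounding the denominators of minors shows that the double coset of
`γ` can occur in the product of those of `α` and `β` only if `γ ≤ α + β` in the dominance order
(`partialSum_le_of_eq`). Each double coset is stable under inversion, so the Hecke algebra is
commutative (`IsCartanSystem.conv_comm`). Functions with nonnegative values multiply without
cancellation, so the product of nonnegative functions with leading terms `α` and `β` has leading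
term `α + β`. Hence the monomials in a family of nonnegative functions whose leading terms are the
fundamental cocharacters form a triangular system with respect to the double cosets, and the Hecke
algebra is the polynomial algebra in this family (`IsCartanSystem.exists_algEquiv`).

*Atomic functions.* The value of an atomic function at `g` counts certain lattices of the form
`k Ξ_{2s}`, `k ∈ K`, all contained in `L ∩ g L` (`latticeMap_le_of_mem_mul`). Existence of such a
lattice forces `ϖ L ⊆ g L`, so `g` lies in the double coset of a fundamental cocharacter
`(1 ^ r, 0, (-1) ^ r)`; since `L ∩ g L` has colength `r` in `L`, one has `r ≤ s`, and for `r = s`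
the lattice must be equal to `L ∩ g L`, which does contribute. So the leading coefficient is `1`
(`atomic_domElt`), which gives both the triangular matrix and the hypothesis on leading terms.
-/

noncomputable section

namespace UnitaryHecke

set_option linter.unusedSectionVars false

/-! ### Integers of finite extensions of `ℚ_p` -/

section PadicIntegers

variable {p : ℕ} [Fact p.Prime]

/-- Integral elements of a finite extension of `ℚ_p` are the elements of the unit ball of the
spectral norm. -/
theorem isIntegral_iff_spectralNorm_le_one {E : Type*} [Field E] [Algebra ℚ_[p] E]
    [FiniteDimensional ℚ_[p] E] [Algebra ℤ_[p] E] [IsScalarTower ℤ_[p] ℚ_[p] E] (z : E) :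
    IsIntegral ℤ_[p] z ↔ spectralNorm ℚ_[p] E z ≤ 1 := by
  have hint : IsIntegral ℚ_[p] z := Algebra.IsIntegral.isIntegral z
  rw [spectralNorm, spectralValue_le_one_iff (minpoly.monic hint)]
  constructor
  · intro hz n
    rw [minpoly.isIntegrallyClosed_eq_field_fractions' ℚ_[p] hz, Polynomial.coeff_map]
    exact PadicInt.norm_le_one _
  · intro hz
    have hl : minpoly ℚ_[p] z ∈ Polynomial.lifts (algebraMap ℤ_[p] ℚ_[p]) := by
      rw [Polynomial.lifts_iff_coeff_lifts]
      exact fun n => ⟨⟨_, hz n⟩, rfl⟩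
    obtain ⟨P, hP, -, hmon⟩ := Polynomial.lifts_and_degree_eq_and_monic hl (minpoly.monic hint)
    refine ⟨P, hmon, ?_⟩
    rw [← Polynomial.aeval_def, ← Polynomial.aeval_map_algebraMap ℚ_[p], hP, minpoly.aeval]

/-- The integral elements of a finite extension of `ℚ_p` form a local ring. -/
theorem isLocalRing_of_range_eq {E : Type*} [Field E] [Algebra ℚ_[p] E]
    [FiniteDimensional ℚ_[p] E] [Algebra ℤ_[p] E] [IsScalarTower ℤ_[p] ℚ_[p] E]
    {C : Type*} [CommRing C] (f : C →+* E) (hf : Function.Injective f)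
    (hr : ∀ z, z ∈ f.range ↔ IsIntegral ℤ_[p] z) : IsLocalRing C := by
  let := spectralNorm.normedField ℚ_[p] E
  have hr' : ∀ z, z ∈ f.range ↔ ‖z‖ ≤ 1 := fun z =>
    (hr z).trans (isIntegral_iff_spectralNorm_le_one z)
  have hna : ∀ x y : E, ‖x + y‖ ≤ max ‖x‖ ‖y‖ := isNonarchimedean_spectralNorm
  have hunit : ∀ c : C, IsUnit c ↔ ‖f c‖ = 1 := by
    intro c
    constructor
    · rintro ⟨u, rfl⟩
      have h1 : ‖f u‖ ≤ 1 := (hr' _).1 ⟨_, rfl⟩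
      have h2 : ‖f (u⁻¹ : Cˣ)‖ ≤ 1 := (hr' _).1 ⟨_, rfl⟩
      have h3 : ‖f u‖ * ‖f (u⁻¹ : Cˣ)‖ = 1 := by
        rw [← norm_mul, ← map_mul, Units.mul_inv, map_one, norm_one]
      nlinarith [norm_nonneg (f u), norm_nonneg (f (u⁻¹ : Cˣ))]
    · intro hc
      have h0 : f c ≠ 0 := fun h0 => by simp [h0] at hc
      obtain ⟨d, hd⟩ := (hr' (f c)⁻¹).2 (by rw [norm_inv, hc, inv_one])
      refine IsUnit.of_mul_eq_one d (hf ?_)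
      rw [map_mul, hd, mul_inv_cancel₀ h0, map_one]
  have : Nontrivial C := ⟨0, 1, fun h01 => by simpa using congrArg f h01⟩
  refine IsLocalRing.of_nonunits_add fun a b ha hb => ?_
  have hlt : ∀ c ∈ nonunits C, ‖f c‖ < 1 := fun c hc =>
    lt_of_le_of_ne ((hr' _).1 ⟨_, rfl⟩) fun h1 => hc ((hunit c).2 h1)
  intro hab
  have h1 := (hunit _).1 hab
  have h2 := hna (f a) (f b)
  rw [← map_add, h1] at h2
  exact absurd (max_lt (hlt a ha) (hlt b hb)) (not_lt.2 h2)

/-- For odd `p`, the equation `t ^ 2 + 2 * t + e = 0` over a finite extension of `ℚ_p` has a small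
solution when `e` is small: `t` is the fixed point of the contraction `t ↦ -(e + t ^ 2) / 2`. -/
theorem exists_root_of_norm_lt_one (hp : p ≠ 2) {E : Type*} [Field E] [Algebra ℚ_[p] E]
    [FiniteDimensional ℚ_[p] E] (e : E) (he : spectralNorm ℚ_[p] E e < 1) :
    ∃ t : E, t * t + 2 * t + e = 0 ∧ spectralNorm ℚ_[p] E t < 1 := by
  let := spectralNorm.normedField ℚ_[p] E
  have hcomplete : CompleteSpace E := spectralNorm.completeSpace ℚ_[p] E
  have hna : ∀ x y : E, ‖x + y‖ ≤ max ‖x‖ ‖y‖ := isNonarchimedean_spectralNorm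
  change ‖e‖ < 1 at he
  change ∃ t : E, t * t + 2 * t + e = 0 ∧ ‖t‖ < 1
  have h2 : ‖(2 : E)‖ = 1 := by
    have h2' : ‖((2 : ℤ) : ℚ_[p])‖ = 1 := by
      refine le_antisymm (Padic.norm_int_le_one 2) (not_lt.1 fun hlt => hp ?_)
      have h := (Padic.norm_intCast_lt_one_iff (k := 2)).1 hlt
      exact (Nat.prime_dvd_prime_iff_eq Fact.out Nat.prime_two).1 (by exact_mod_cast h)
    have h := spectralNorm_extends (K := ℚ_[p]) (L := E) ((2 : ℤ) : ℚ_[p])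
    rw [h2', map_intCast] at h
    exact_mod_cast h
  have h20 : (2 : E) ≠ 0 := fun h0 => by simp [h0] at h2
  let g : E → E := fun t => -(e + t * t) / 2
  let s : Set E := Metric.closedBall 0 ‖e‖
  have hs : ∀ {t}, t ∈ s ↔ ‖t‖ ≤ ‖e‖ := by simp [s]
  have hg : ∀ t, ‖g t‖ = ‖e + t * t‖ := fun t => by simp [g, norm_div, h2]; rw [← norm_neg]; ring_nf
  have hmaps : Set.MapsTo g s s := by
    intro t ht
    rw [hs] at ht ⊢
    rw [hg]
    refine (hna _ _).trans (max_le le_rfl ?_)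
    rw [norm_mul]
    nlinarith [norm_nonneg t, norm_nonneg e]
  have hcontr : ContractingWith ‖e‖₊ (hmaps.restrict g s s) := by
    refine ⟨by exact_mod_cast he, LipschitzWith.of_dist_le_mul ?_⟩
    rintro ⟨t, ht⟩ ⟨u, hu⟩
    rw [hs] at ht hu
    change dist (g t) (g u) ≤ ‖e‖ * dist t u
    rw [dist_eq_norm, dist_eq_norm]
    have : g t - g u = (-(t + u)) * (t - u) / 2 := by simp only [g]; ring
    rw [this, norm_div, h2, div_one, norm_mul, norm_neg]
    exact mul_le_mul_of_nonneg_right ((hna _ _).trans (max_le ht hu)) (norm_nonneg _)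
  obtain ⟨t, hts, hfix, -⟩ := ContractingWith.exists_fixedPoint' (x := 0)
    Metric.isClosed_closedBall.isComplete hmaps hcontr (hs.2 (by simp)) (edist_ne_top _ _)
  refine ⟨t, ?_, (hs.1 hts).trans_lt he⟩
  have hfix' : -(e + t * t) / 2 = t := hfix
  field_simp at hfix'
  linear_combination -hfix'

end PadicIntegers

/-! ### Unramified rings of integers -/

/-- The arithmetic input on the ring of integers `R` of `F`, besides `R` being a discrete valuation
ring with finite residue field: `ϖ` is a uniformizer, `σ` preserves `R`, `2` is a unit, and
Hensel's lemma holds for the quadratic equations that occur when isotropic vectors are lifted. -/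
structure IsUnramifiedIntegers {F₀ F : Type*} [Field F₀] [Field F] [Algebra F₀ F]
    (R : Type*) [CommRing R] [Algebra R F] (σ : F ≃ₐ[F₀] F) (ϖ : F₀) : Prop where
  uniformizer : ∃ π : R, Irreducible π ∧ algebraMap R F π = algebraMap F₀ F ϖ
  map_mem : ∀ r : R, σ (algebraMap R F r) ∈ (algebraMap R F).range
  two : IsUnit (2 : R)
  quadratic : ∀ e : R, ¬ IsUnit e → ∃ t : R, ¬ IsUnit t ∧ t * t + 2 * t + e = 0

/-- A finite unramified extension of a discrete valuation ring by a local Dedekind domain is a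
discrete valuation ring with the same uniformizer. -/
theorem isDiscreteValuationRing_of_unramified {A C : Type*} [CommRing A] [CommRing C]
    [IsDedekindDomain A] [IsDedekindDomain C] [IsLocalRing A] [IsLocalRing C] [Algebra A C]
    [Module.Finite A C] [FaithfulSMul A C] [Algebra.FormallyUnramified A C]
    {π : A} (hπ : Irreducible π) :
    IsDiscreteValuationRing C ∧ Irreducible (algebraMap A C π) := by
  have hlh : IsLocalHom (algebraMap A C) :=
    inferInstance
  have hmax := Algebra.FormallyUnramified.map_maximalIdeal (R := A) (S := C)
  have hnf : ¬ IsField A := fun hf => by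
    let := hf.toField
    exact hπ.not_isUnit (isUnit_iff_ne_zero.2 hπ.ne_zero)
  have hAdvr : IsDiscreteValuationRing A := ((IsDiscreteValuationRing.TFAE _ hnf).out 0 2).2 ‹_›
  have hπ0 : algebraMap A C π ≠ 0 := fun h0 => hπ.ne_zero
    (FaithfulSMul.algebraMap_injective A C (by simpa using h0))
  have hspan : IsLocalRing.maximalIdeal C = Ideal.span {algebraMap A C π} := by
    rw [← hmax, hπ.maximalIdeal_eq, Ideal.map_span, Set.image_singleton]
  have hnfC : ¬ IsField C := fun hf => hπ0 (by
    have h0 := (IsLocalRing.isField_iff_maximalIdeal_eq.1 hf)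
    rw [hspan, Ideal.span_singleton_eq_bot] at h0
    exact h0)
  have hC : IsDiscreteValuationRing C := ((IsDiscreteValuationRing.TFAE _ hnfC).out 0 2).2 ‹_›
  exact ⟨hC, (IsDiscreteValuationRing.irreducible_iff_uniformizer _).2 hspan⟩

theorem finite_residueField_of_finite {A C : Type*} [CommRing A] [CommRing C] [IsDomain C]
    [IsLocalRing A] [IsLocalRing C] [Algebra A C] [Module.Finite A C]
    (hinj : Function.Injective (algebraMap A C)) (hA : Finite (IsLocalRing.ResidueField A)) :
    Finite (IsLocalRing.ResidueField C) := by
  have : FaithfulSMul A C := (faithfulSMul_iff_algebraMap_injective _ _).2 hinj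
  exact IsLocalRing.ResidueField.finite_of_finite (R := A) hA

section PadicIntegers

variable (p : ℕ) [Fact p.Prime] {F₀ F : Type*}
  [Field F₀] [Algebra ℤ_[p] F₀] [Field F] [Algebra F₀ F]

theorem isLocalRing_baseIntegers [Algebra ℚ_[p] F₀] [FiniteDimensional ℚ_[p] F₀]
    [IsScalarTower ℤ_[p] ℚ_[p] F₀] : IsLocalRing (baseIntegers p F₀) :=
  isLocalRing_of_range_eq (p := p) (algebraMap (baseIntegers p F₀) F₀) Subtype.val_injective
    fun z => ⟨by rintro ⟨c, rfl⟩; exact c.2, fun hz => ⟨⟨z, hz⟩, rfl⟩⟩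

theorem isIntegral_baseIntegers_iff [Algebra ℤ_[p] F] [IsScalarTower ℤ_[p] F₀ F] (z : F) :
    IsIntegral (baseIntegers p F₀) z ↔ IsIntegral ℤ_[p] z := by
  constructor
  · intro hz
    have : Algebra.IsIntegral ℤ_[p] (baseIntegers p F₀) := inferInstance
    exact isIntegral_trans (R := ℤ_[p]) (A := baseIntegers p F₀) z hz
  · exact fun hz => hz.tower_top

/-- The ring of integers of the unramified quadratic extension is a discrete valuation ring with
finite residue field having the required properties. -/
theorem extIntegers_properties (hp : p ≠ 2) [Algebra ℚ_[p] F₀] [FiniteDimensional ℚ_[p] F₀]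
    [IsScalarTower ℤ_[p] ℚ_[p] F₀] [FiniteDimensional F₀ F]
    [Algebra.FormallyUnramified (baseIntegers p F₀) (extIntegers p F₀ F)]
    (σ : F ≃ₐ[F₀] F) {ϖ : F₀} (hϖ : IsUniformizer p ϖ) :
    ∃ _ : IsDiscreteValuationRing (extIntegers p F₀ F), IsFractionRing (extIntegers p F₀ F) F ∧
      Finite (IsLocalRing.ResidueField (extIntegers p F₀ F)) ∧
      IsUnramifiedIntegers (extIntegers p F₀ F) σ ϖ := by
  let : Algebra ℚ_[p] F := ((algebraMap F₀ F).comp (algebraMap ℚ_[p] F₀)).toAlgebra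
  let : Algebra ℤ_[p] F := ((algebraMap F₀ F).comp (algebraMap ℤ_[p] F₀)).toAlgebra
  have : IsScalarTower ℚ_[p] F₀ F := .of_algebraMap_eq' rfl
  have : IsScalarTower ℤ_[p] F₀ F := .of_algebraMap_eq' rfl
  have : IsScalarTower ℤ_[p] ℚ_[p] F := .of_algebraMap_eq' (by
    rw [IsScalarTower.algebraMap_eq ℚ_[p] F₀ F, IsScalarTower.algebraMap_eq ℤ_[p] F₀ F,
      IsScalarTower.algebraMap_eq ℤ_[p] ℚ_[p] F₀, RingHom.comp_assoc])
  have : FiniteDimensional ℚ_[p] F := .trans ℚ_[p] F₀ F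
  have : CharZero F₀ := charZero_of_injective_algebraMap (algebraMap ℚ_[p] F₀).injective
  have hA : IsDedekindDomain (baseIntegers p F₀) := integralClosure.isDedekindDomain ℤ_[p] ℚ_[p] F₀
  have : IsFractionRing (baseIntegers p F₀) F₀ :=
    integralClosure.isFractionRing_of_finite_extension ℚ_[p] F₀
  have hAfin : Module.Finite ℤ_[p] (baseIntegers p F₀) :=
    IsIntegralClosure.finite ℤ_[p] ℚ_[p] F₀ (baseIntegers p F₀)
  have hAloc := isLocalRing_baseIntegers p (F₀ := F₀)
  have hCded : IsDedekindDomain (extIntegers p F₀ F) :=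
    integralClosure.isDedekindDomain (baseIntegers p F₀) F₀ F
  have hfrac : IsFractionRing (extIntegers p F₀ F) F :=
    integralClosure.isFractionRing_of_finite_extension F₀ F
  have hCfin : Module.Finite (baseIntegers p F₀) (extIntegers p F₀ F) :=
    IsIntegralClosure.finite (baseIntegers p F₀) F₀ F (extIntegers p F₀ F)
  have hmem : ∀ z : F, z ∈ (algebraMap (extIntegers p F₀ F) F).range ↔ IsIntegral ℤ_[p] z := by
    intro z
    rw [← isIntegral_baseIntegers_iff p (F₀ := F₀)]
    exact ⟨by rintro ⟨c, rfl⟩; exact c.2, fun hz => ⟨⟨z, hz⟩, rfl⟩⟩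
  have hloc : IsLocalRing (extIntegers p F₀ F) :=
    isLocalRing_of_range_eq (p := p) (algebraMap (extIntegers p F₀ F) F) Subtype.val_injective hmem
  have hinj : Function.Injective (algebraMap (baseIntegers p F₀) (extIntegers p F₀ F)) :=
    fun a b hab => Subtype.ext
      ((algebraMap F₀ F).injective (congrArg (Subtype.val : extIntegers p F₀ F → F) hab))
  have : FaithfulSMul (baseIntegers p F₀) (extIntegers p F₀ F) :=
    (faithfulSMul_iff_algebraMap_injective _ _).2 hinj
  obtain ⟨π, hπ, hπϖ⟩ := hϖ
  obtain ⟨hCdvr, hπ'⟩ := isDiscreteValuationRing_of_unramified (C := extIntegers p F₀ F) hπ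
  have hZ : Finite (IsLocalRing.ResidueField ℤ_[p]) :=
    Finite.of_equiv (ZMod p) (@PadicInt.residueField p _).symm.toEquiv
  have hAres : Finite (IsLocalRing.ResidueField (baseIntegers p F₀)) := by
    refine finite_residueField_of_finite (A := ℤ_[p]) (fun a b hab => ?_) hZ
    refine FaithfulSMul.algebraMap_injective ℤ_[p] ℚ_[p]
      ((algebraMap ℚ_[p] F₀).injective ?_)
    rw [← IsScalarTower.algebraMap_apply, ← IsScalarTower.algebraMap_apply]
    exact congrArg (Subtype.val : baseIntegers p F₀ → F₀) hab
  have hCres : Finite (IsLocalRing.ResidueField (extIntegers p F₀ F)) :=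
    finite_residueField_of_finite hinj hAres
  have hnorm : ∀ z : F, z ∈ (algebraMap (extIntegers p F₀ F) F).range ↔
      spectralNorm ℚ_[p] F z ≤ 1 := fun z =>
    (hmem z).trans (isIntegral_iff_spectralNorm_le_one z)
  have hunit : ∀ c : extIntegers p F₀ F, ¬ IsUnit c ↔ spectralNorm ℚ_[p] F (c : F) < 1 := by
    let := spectralNorm.normedField ℚ_[p] F
    intro c
    have hle : ‖(c : F)‖ ≤ 1 := (hnorm _).1 ⟨c, rfl⟩
    change _ ↔ ‖(c : F)‖ < 1
    rw [lt_iff_le_and_ne, and_iff_right hle, ne_eq, not_iff_not]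
    constructor
    · rintro ⟨u, rfl⟩
      have h1 : ‖((u : extIntegers p F₀ F) : F)‖ ≤ 1 := (hnorm _).1 ⟨_, rfl⟩
      have h2 : ‖(((u⁻¹ : (extIntegers p F₀ F)ˣ) : extIntegers p F₀ F) : F)‖ ≤ 1 :=
        (hnorm _).1 ⟨_, rfl⟩
      have h3 : ‖((u : extIntegers p F₀ F) : F)‖ *
          ‖(((u⁻¹ : (extIntegers p F₀ F)ˣ) : extIntegers p F₀ F) : F)‖ = 1 := by
        rw [← norm_mul, ← MulMemClass.coe_mul, Units.mul_inv, OneMemClass.coe_one, norm_one]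
      nlinarith [norm_nonneg ((u : extIntegers p F₀ F) : F),
        norm_nonneg (((u⁻¹ : (extIntegers p F₀ F)ˣ) : extIntegers p F₀ F) : F)]
    · intro hc
      have h0 : (c : F) ≠ 0 := fun h0 => by simp [h0] at hc
      obtain ⟨d, hd⟩ := (hnorm (c : F)⁻¹).2 (by
        change ‖(c : F)⁻¹‖ ≤ 1
        rw [norm_inv, hc, inv_one])
      refine IsUnit.of_mul_eq_one d (Subtype.ext ?_)
      change (c : F) * algebraMap _ _ d = 1
      rw [hd, mul_inv_cancel₀ h0]
  refine ⟨hCdvr, hfrac, hCres, ⟨_, hπ', ?_⟩, ?_, ?_, ?_⟩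
  · rw [← hπϖ]; rfl
  · intro r
    have hr : IsIntegral (baseIntegers p F₀) (r : F) := r.2
    exact ⟨⟨_, hr.map (σ.toAlgHom.restrictScalars (baseIntegers p F₀))⟩, rfl⟩
  · by_contra h2
    rw [hunit] at h2
    have h2' : ‖((2 : ℤ) : ℚ_[p])‖ = 1 := by
      refine le_antisymm (Padic.norm_int_le_one 2) (not_lt.1 fun hlt => hp ?_)
      have h := (Padic.norm_intCast_lt_one_iff (k := 2)).1 hlt
      exact (Nat.prime_dvd_prime_iff_eq Fact.out Nat.prime_two).1 (by exact_mod_cast h)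
    have h := spectralNorm_extends (K := ℚ_[p]) (L := F) ((2 : ℤ) : ℚ_[p])
    rw [h2', map_intCast] at h
    exact h2.ne (by exact_mod_cast h)
  · intro e he
    obtain ⟨t, ht, ht1⟩ := exists_root_of_norm_lt_one hp (e : F) ((hunit e).1 he)
    obtain ⟨t', rfl⟩ := (hnorm t).2 ht1.le
    exact ⟨t', (hunit t').2 ht1, Subtype.ext ht⟩

end PadicIntegers

/-! ### Divisibility by powers of the uniformizer -/

section Valuation

variable {F₀ F R : Type*} [Field F₀] [Field F] [Algebra F₀ F] [CommRing R] [Algebra R F]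
  {σ : F ≃ₐ[F₀] F} {ϖ : F₀}

local notation "𝒪" => RingHom.range (algebraMap R F)
local notation "𝓆" => algebraMap F₀ F ϖ

namespace IsUnramifiedIntegers

theorem q_mem (H : IsUnramifiedIntegers R σ ϖ) : 𝓆 ∈ 𝒪 := by
  obtain ⟨π, -, h⟩ := H.uniformizer
  exact ⟨π, h⟩

theorem q_pow_mem (H : IsUnramifiedIntegers R σ ϖ) (k : ℕ) : 𝓆 ^ k ∈ 𝒪 := pow_mem H.q_mem k

theorem q_zpow_mem (H : IsUnramifiedIntegers R σ ϖ) {k : ℤ} (hk : 0 ≤ k) : 𝓆 ^ k ∈ 𝒪 := by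
  lift k to ℕ using hk
  simpa using H.q_pow_mem k

theorem two_inv_mem (H : IsUnramifiedIntegers R σ ϖ) : (2 : F)⁻¹ ∈ 𝒪 := by
  obtain ⟨u, hu⟩ := H.two
  refine ⟨(u⁻¹ : Rˣ), eq_inv_of_mul_eq_one_left ?_⟩
  rw [← map_ofNat (algebraMap R F) 2, ← hu, ← map_mul, Units.inv_mul, map_one]

theorem two_ne_zero [Nontrivial R] (H : IsUnramifiedIntegers R σ ϖ) : (2 : F) ≠ 0 := by
  obtain ⟨u, hu⟩ := H.two
  rw [← map_ofNat (algebraMap R F) 2, ← hu]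
  exact (u.isUnit.map (algebraMap R F)).ne_zero

theorem map_mem' (H : IsUnramifiedIntegers R σ ϖ) {z : F} (hz : z ∈ 𝒪) : σ z ∈ 𝒪 := by
  obtain ⟨r, rfl⟩ := hz
  exact H.map_mem r

variable [IsFractionRing R F]

theorem q_ne_zero (H : IsUnramifiedIntegers R σ ϖ) : 𝓆 ≠ 0 := by
  obtain ⟨π, hπ, h⟩ := H.uniformizer
  rw [← h, ne_eq, FaithfulSMul.algebraMap_eq_zero_iff]
  exact hπ.ne_zero

theorem isUnit_of_mem_of_inv_mem {r : R} (hr : algebraMap R F r ≠ 0)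
    (h : (algebraMap R F r)⁻¹ ∈ 𝒪) : IsUnit r := by
  obtain ⟨s, hs⟩ := h
  refine IsUnit.of_mul_eq_one s (FaithfulSMul.algebraMap_injective R F ?_)
  rw [map_mul, hs, mul_inv_cancel₀ hr, map_one]

theorem q_zpow_mem_iff (H : IsUnramifiedIntegers R σ ϖ) {k : ℤ} : 𝓆 ^ k ∈ 𝒪 ↔ 0 ≤ k := by
  refine ⟨fun h => ?_, H.q_zpow_mem⟩
  by_contra! hk
  have h1 : (𝓆)⁻¹ ∈ 𝒪 := by
    have := mul_mem h (H.q_zpow_mem (k := -k - 1) (by omega))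
    rwa [← zpow_add₀ H.q_ne_zero, show k + (-k - 1) = -1 by omega, zpow_neg_one] at this
  obtain ⟨π, hπ, hq⟩ := H.uniformizer
  rw [← hq] at h1
  exact hπ.not_isUnit (isUnit_of_mem_of_inv_mem (by rw [hq]; exact H.q_ne_zero) h1)

variable [IsDomain R] [IsDiscreteValuationRing R]

theorem exists_zpow_mul_unit (H : IsUnramifiedIntegers R σ ϖ) {z : F} (hz : z ≠ 0) :
    ∃ (k : ℤ) (u : F), u ∈ 𝒪 ∧ u⁻¹ ∈ 𝒪 ∧ u ≠ 0 ∧ z = 𝓆 ^ k * u := by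
  obtain ⟨π, hπ, hq⟩ := H.uniformizer
  obtain ⟨r, s, hs, rfl⟩ := IsFractionRing.div_surjective (A := R) z
  have hs0 : s ≠ 0 := nonZeroDivisors.ne_zero hs
  have hr0 : r ≠ 0 := by rintro rfl; simp at hz
  obtain ⟨k, u, rfl⟩ := IsDiscreteValuationRing.eq_unit_mul_pow_irreducible hr0 hπ
  obtain ⟨l, v, rfl⟩ := IsDiscreteValuationRing.eq_unit_mul_pow_irreducible hs0 hπ
  have hu : ∀ w : Rˣ, (algebraMap R F w)⁻¹ = algebraMap R F (w⁻¹ : Rˣ) := fun w =>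
    inv_eq_of_mul_eq_one_right (by rw [← map_mul, Units.mul_inv, map_one])
  have hne : ∀ w : Rˣ, algebraMap R F w ≠ 0 := fun w => (w.isUnit.map _).ne_zero
  refine ⟨(k : ℤ) - l, algebraMap R F (u * (v⁻¹ : Rˣ)), ⟨_, rfl⟩, ?_, ?_, ?_⟩
  · rw [← Units.val_mul, hu]
    exact ⟨_, rfl⟩
  · rw [← Units.val_mul]; exact hne _
  · rw [map_mul, map_mul, map_mul, ← hu, map_pow, map_pow, hq, zpow_sub₀ H.q_ne_zero,
      zpow_natCast, zpow_natCast]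
    have := hne v
    have := H.q_ne_zero
    field_simp

/-- An integral element not divisible by the uniformizer is a unit. -/
theorem inv_mem_of_not_dvd (H : IsUnramifiedIntegers R σ ϖ) {z : F} (hz : z ∈ 𝒪)
    (h : 𝓆⁻¹ * z ∉ 𝒪) : z⁻¹ ∈ 𝒪 := by
  have hz0 : z ≠ 0 := by rintro rfl; simp at h
  obtain ⟨k, u, hu, hu', hu0, rfl⟩ := H.exists_zpow_mul_unit hz0
  have hk : 0 ≤ k := H.q_zpow_mem_iff.1 (by simpa [hu0, mul_assoc] using mul_mem hz hu')
  have hk' : k ≤ 0 := by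
    by_contra! hk1
    refine h ?_
    rw [← mul_assoc]
    refine mul_mem ?_ hu
    rw [← zpow_neg_one, ← zpow_add₀ H.q_ne_zero]
    exact H.q_zpow_mem (by omega)
  obtain rfl : k = 0 := by omega
  simpa using hu'

/-- An element whose norm to the `σ`-fixed field is a unit is a unit. -/
theorem mem_and_inv_mem_of_norm (H : IsUnramifiedIntegers R σ ϖ) {z : F} (h0 : z ≠ 0)
    (h : σ z * z ∈ 𝒪) (h' : (σ z * z)⁻¹ ∈ 𝒪) : z ∈ 𝒪 ∧ z⁻¹ ∈ 𝒪 := by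
  obtain ⟨k, u, hu, hu', hu0, rfl⟩ := H.exists_zpow_mul_unit h0
  have hσu0 : σ u ≠ 0 := by simpa using hu0
  have hσu' : (σ u)⁻¹ ∈ 𝒪 := by rw [← map_inv₀]; exact H.map_mem' hu'
  have hq := H.q_ne_zero
  have e : σ (𝓆 ^ k * u) * (𝓆 ^ k * u) = 𝓆 ^ (2 * k) * (σ u * u) := by
    rw [map_mul, map_zpow₀, AlgEquiv.commutes, two_mul, zpow_add₀ hq]; ring
  rw [e] at h h'
  have h1 : 0 ≤ 2 * k := H.q_zpow_mem_iff.1 (by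
    have := mul_mem h (mul_mem hσu' hu')
    rwa [show 𝓆 ^ (2 * k) * (σ u * u) * ((σ u)⁻¹ * u⁻¹) = 𝓆 ^ (2 * k) by field_simp] at this)
  have h2 : 0 ≤ -(2 * k) := H.q_zpow_mem_iff.1 (by
    have := mul_mem h' (mul_mem (H.map_mem' hu) hu)
    rw [zpow_neg]
    rwa [show (𝓆 ^ (2 * k) * (σ u * u))⁻¹ * (σ u * u) = (𝓆 ^ (2 * k))⁻¹ by field_simp] at this)
  obtain rfl : k = 0 := by omega
  simpa using ⟨hu, hu'⟩

/-- A `σ`-invariant small solution of `a + 2c + b c² = 0`. It is obtained from a small solution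
`t` of the monic equation `t² + 2t + ab = 0` by `c = -a / (2 + t)`, and it is `σ`-invariant since
small solutions are unique. -/
theorem exists_root (H : IsUnramifiedIntegers R σ ϖ) {a b : F} {k : ℕ} (hk : 1 ≤ k)
    (ha : 𝓆 ^ (-(k : ℤ)) * a ∈ 𝒪) (hb : b ∈ 𝒪) (hσa : σ a = a) (hσb : σ b = b) :
    ∃ c : F, 𝓆 ^ (-(k : ℤ)) * c ∈ 𝒪 ∧ σ c = c ∧ a + 2 * c + b * (c * c) = 0 := by
  have hq := H.q_ne_zero
  have ha' : 𝓆⁻¹ * a ∈ 𝒪 := by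
    have := mul_mem (H.q_zpow_mem (k := k - 1) (by omega)) ha
    rwa [← mul_assoc, ← zpow_add₀ hq, show (k : ℤ) - 1 + -k = -1 by ring, zpow_neg_one] at this
  have hmem : a * b ∈ 𝒪 := by
    have := mul_mem (mul_mem H.q_mem ha') hb
    rwa [mul_inv_cancel_left₀ hq] at this
  obtain ⟨π, hπ, hπq⟩ := H.uniformizer
  -- membership in the maximal ideal, as divisibility by `𝓆`
  have hsmall : ∀ r : R, ¬ IsUnit r ↔ 𝓆⁻¹ * algebraMap R F r ∈ 𝒪 := by
    intro r
    rw [← hπq] at hq ⊢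
    constructor
    · intro hr
      have hr' : r ∈ IsLocalRing.maximalIdeal R := hr
      rw [hπ.maximalIdeal_eq, Ideal.mem_span_singleton] at hr'
      obtain ⟨s, rfl⟩ := hr'
      exact ⟨s, by rw [map_mul, inv_mul_cancel_left₀ hq]⟩
    · rintro ⟨s, hs⟩ hr
      refine hπ.not_isUnit (isUnit_of_mul_isUnit_left (y := s) ?_)
      rwa [show π * s = r from FaithfulSMul.algebraMap_injective R F (by
        rw [map_mul, hs, mul_inv_cancel_left₀ hq])]
  -- `2` plus something small is a unit
  have hunit : ∀ z : F, 𝓆⁻¹ * z ∈ 𝒪 → 2 + z ≠ 0 ∧ (2 + z)⁻¹ ∈ 𝒪 := by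
    intro z hz
    have h2 : (2 : F) ∈ 𝒪 := ⟨2, map_ofNat _ 2⟩
    have hz' : z ∈ 𝒪 := by
      have := mul_mem H.q_mem hz
      rwa [mul_inv_cancel_left₀ hq] at this
    have hn : 𝓆⁻¹ * (2 + z) ∉ 𝒪 := fun hc => by
      have h3 := mul_mem (sub_mem hc hz) H.two_inv_mem
      rw [show (𝓆⁻¹ * (2 + z) - 𝓆⁻¹ * z) * 2⁻¹ = 𝓆⁻¹ * (2 * 2⁻¹) by ring,
        mul_inv_cancel₀ H.two_ne_zero, mul_one] at h3
      have := H.q_zpow_mem_iff (k := -1)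
      rw [zpow_neg_one] at this
      exact absurd (this.1 h3) (by norm_num)
    refine ⟨fun h0 => hn ?_, H.inv_mem_of_not_dvd (add_mem h2 hz') hn⟩
    simp [h0]
  obtain ⟨e, he⟩ := hmem
  obtain ⟨t, ht, hteq⟩ := H.quadratic e ((hsmall e).2 (by
    rw [he, ← mul_assoc]; exact mul_mem ha' hb))
  rw [hsmall] at ht
  set T := algebraMap R F t with hT
  have hTeq : T * T + 2 * T + a * b = 0 := by
    rw [← he, hT, ← map_mul, ← map_ofNat (algebraMap R F) 2, ← map_mul, ← map_add, ← map_add, hteq,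
      map_zero]
  obtain ⟨hT0, hTinv⟩ := hunit T ht
  have hc : ∀ l : F, l * a ∈ 𝒪 → l * (-a / (2 + T)) ∈ 𝒪 := fun l hl => by
    rw [show l * (-a / (2 + T)) = -(l * a * (2 + T)⁻¹) by ring]
    exact neg_mem (mul_mem hl hTinv)
  have hroot : a + 2 * (-a / (2 + T)) + b * ((-a / (2 + T)) * (-a / (2 + T))) = 0 := by
    field_simp
    linear_combination a * hTeq
  refine ⟨-a / (2 + T), hc _ ha, ?_, hroot⟩
  set c := -a / (2 + T)
  have hcq : 𝓆⁻¹ * c ∈ 𝒪 := hc _ ha'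
  have hσcq : 𝓆⁻¹ * σ c ∈ 𝒪 := by
    have := H.map_mem' hcq
    rwa [map_mul, map_inv₀, AlgEquiv.commutes] at this
  have hroot' : a + 2 * σ c + b * (σ c * σ c) = 0 := by
    have := congrArg σ hroot
    simpa [hσa, hσb, map_ofNat σ 2] using this
  have hne := (hunit (b * (σ c + c)) (by
    rw [show 𝓆⁻¹ * (b * (σ c + c)) = b * (𝓆⁻¹ * σ c + 𝓆⁻¹ * c) by ring]
    exact mul_mem hb (add_mem hσcq hcq))).1
  have hprod : (σ c - c) * (2 + b * (σ c + c)) = 0 := by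
    linear_combination hroot' - hroot
  exact sub_eq_zero.1 ((mul_eq_zero.1 hprod).resolve_right hne)

end IsUnramifiedIntegers

end Valuation

/-! ### Hyperbolic pairs adapted to two lattices -/

section HyperbolicPair

variable {F₀ F R W : Type*} [Field F₀] [Field F] [Algebra F₀ F] [CommRing R] [Algebra R F]
  {σ : F ≃ₐ[F₀] F} {ϖ : F₀} [AddCommGroup W] [Module F W] [Module R W]
  {h : W →ₛₗ[(σ : F →+* F)] W →ₗ[F] F}

local notation "𝒪" => RingHom.range (algebraMap R F)
local notation "𝓆" => algebraMap F₀ F ϖ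

theorem form_smul_left (h : W →ₛₗ[(σ : F →+* F)] W →ₗ[F] F) (c : F) (x y : W) :
    h (c • x) y = σ c * h x y := by
  rw [LinearMap.map_smulₛₗ, LinearMap.smul_apply, smul_eq_mul]; rfl

theorem form_zpow_smul_left (h : W →ₛₗ[(σ : F →+* F)] W →ₗ[F] F) (k : ℤ) (x y : W) :
    h (𝓆 ^ k • x) y = 𝓆 ^ k * h x y := by
  rw [form_smul_left, map_zpow₀, AlgEquiv.commutes]

theorem form_zpow_smul_right (h : W →ₛₗ[(σ : F →+* F)] W →ₗ[F] F) (k : ℤ) (x y : W) :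
    h x (𝓆 ^ k • y) = 𝓆 ^ k * h x y := by
  rw [map_smul, smul_eq_mul]

theorem form_symm (hherm : h.IsSymm) (x y : W) : σ (h x y) = h y x := hherm.eq x y

theorem smul_mem_of_mem_range [IsScalarTower R F W] (Λ : Submodule R W) {c : F} (hc : c ∈ 𝒪)
    {z : W} (hz : z ∈ Λ) : c • z ∈ Λ := by
  obtain ⟨r, rfl⟩ := hc
  rw [algebraMap_smul]
  exact Λ.smul_mem r hz

variable (h ϖ) in
/-- `L` is a self-dual lattice and `M`, with dual lattice `N`, is a vertex lattice in the
nondegenerate hermitian space `V`, a subspace of `W`. The lattices are kept inside the ambient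
space `W`, so that hyperbolic planes can be split off without changing types. -/
structure IsLatticePair (V : Submodule F W) (L M N : Submodule R W) : Prop where
  mem_left : ∀ z, z ∈ L ↔ z ∈ V ∧ ∀ w ∈ L, h w z ∈ 𝒪
  mem_dual : ∀ z, z ∈ N ↔ z ∈ V ∧ ∀ w ∈ M, h w z ∈ 𝒪
  mem_right : ∀ z, z ∈ M ↔ z ∈ V ∧ ∀ w ∈ N, h w z ∈ 𝒪
  le : M ≤ N
  smul_mem : ∀ z ∈ N, 𝓆 • z ∈ M
  bound : ∃ a : ℕ, ∀ z ∈ N, 𝓆 ^ (a : ℤ) • z ∈ L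
  absorb : ∀ z ∈ V, ∃ k : ℕ, 𝓆 ^ (k : ℤ) • z ∈ L
  nondeg : ∀ x ∈ V, (∀ v ∈ V, h v x = 0) → x = 0

namespace IsLatticePair

variable {V : Submodule F W} {L M N : Submodule R W}

theorem form_mem (P : IsLatticePair ϖ h V L M N) {x y : W} (hx : x ∈ L) (hy : y ∈ L) :
    h x y ∈ 𝒪 := ((P.mem_left y).1 hy).2 x hx

theorem form_dual_mem (P : IsLatticePair ϖ h V L M N) {x y : W} (hx : x ∈ N) (hy : y ∈ M) :
    h x y ∈ 𝒪 := ((P.mem_right y).1 hy).2 x hx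

theorem form_mem_dual (P : IsLatticePair ϖ h V L M N) {x y : W} (hx : x ∈ M) (hy : y ∈ N) :
    h x y ∈ 𝒪 := ((P.mem_dual y).1 hy).2 x hx

variable [IsFractionRing R F] [IsDomain R] [IsDiscreteValuationRing R]

theorem exists_primitive_zpow_smul (P : IsLatticePair ϖ h V L M N)
    (H : IsUnramifiedIntegers R σ ϖ) {x : W} (hx : x ∈ V) (hx0 : x ≠ 0) :
    ∃ k : ℤ, 𝓆 ^ k • x ∈ L ∧ 𝓆⁻¹ • (𝓆 ^ k • x) ∉ L := by
  have hq := H.q_ne_zero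
  obtain ⟨v, hv, hvx⟩ : ∃ v ∈ L, h v x ≠ 0 := by
    by_contra! hc
    refine hx0 (P.nondeg x hx fun v hv => ?_)
    obtain ⟨k, hk⟩ := P.absorb v hv
    have := hc _ hk
    rw [form_zpow_smul_left] at this
    exact (mul_eq_zero.1 this).resolve_left (zpow_ne_zero _ hq)
  obtain ⟨j, u, hu, hu', hu0, hj⟩ := H.exists_zpow_mul_unit hvx
  obtain ⟨k₀, hk₀⟩ := P.absorb x hx
  obtain ⟨k, hk, hmin⟩ := Int.exists_least_of_bdd (P := fun k : ℤ => 𝓆 ^ k • x ∈ L)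
    ⟨-j, fun k hk => by
      have h1 := mul_mem (P.form_mem hv hk) hu'
      rw [form_zpow_smul_right, hj, ← mul_assoc, ← zpow_add₀ hq, mul_assoc, mul_inv_cancel₀ hu0,
        mul_one, H.q_zpow_mem_iff] at h1
      omega⟩ ⟨_, hk₀⟩
  refine ⟨k, hk, fun hk' => ?_⟩
  rw [smul_smul, ← zpow_neg_one, ← zpow_add₀ hq] at hk'
  have := hmin _ hk'
  omega

variable [IsScalarTower R F W]

/-- A primitive vector of a self-dual lattice pairs to `1` with some vector of the lattice. -/
theorem exists_form_eq_one (P : IsLatticePair ϖ h V L M N) (H : IsUnramifiedIntegers R σ ϖ)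
    (hherm : h.IsSymm) {x : W} (hx : x ∈ L) (hx' : 𝓆⁻¹ • x ∉ L) :
    ∃ y ∈ L, h x y = 1 ∧ h y x = 1 := by
  have hV : 𝓆⁻¹ • x ∈ V := V.smul_mem _ ((P.mem_left x).1 hx).1
  obtain ⟨w, hw, hwx⟩ : ∃ w ∈ L, h w (𝓆⁻¹ • x) ∉ 𝒪 := by
    by_contra! hc
    exact hx' ((P.mem_left _).2 ⟨hV, hc⟩)
  rw [map_smul, smul_eq_mul] at hwx
  have hinv := H.inv_mem_of_not_dvd (P.form_mem hw hx) hwx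
  have h0 : h w x ≠ 0 := by intro h0; simp [h0] at hwx
  have h0' : h x w ≠ 0 := by rw [← form_symm hherm w x]; simpa using h0
  have h1 : h x ((h x w)⁻¹ • w) = 1 := by rw [map_smul, smul_eq_mul, inv_mul_cancel₀ h0']
  refine ⟨(h x w)⁻¹ • w, smul_mem_of_mem_range L ?_ hw, h1, ?_⟩
  · rw [← form_symm hherm w x, ← map_inv₀]
    exact H.map_mem' hinv
  · rw [← form_symm hherm, h1, map_one]

/-- A primitive isotropic vector of a self-dual lattice is part of a hyperbolic pair. -/
theorem exists_hyperbolic (P : IsLatticePair ϖ h V L M N) (H : IsUnramifiedIntegers R σ ϖ)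
    (hherm : h.IsSymm) {x : W} (hx : x ∈ L) (hx' : 𝓆⁻¹ • x ∉ L) (hxx : h x x = 0) :
    ∃ y ∈ L, h y y = 0 ∧ h x y = 1 ∧ h y x = 1 := by
  obtain ⟨y, hy, hxy, hyx⟩ := P.exists_form_eq_one H hherm hx hx'
  have h2 := H.two_ne_zero
  have hσ : σ (h y y / 2) = h y y / 2 := by rw [map_div₀, map_ofNat, form_symm hherm]
  refine ⟨y - (h y y / 2) • x, sub_mem hy (smul_mem_of_mem_range L ?_ hx), ?_, ?_, ?_⟩
  · rw [div_eq_mul_inv]; exact mul_mem (P.form_mem hy hy) H.two_inv_mem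
  · simp only [map_sub, LinearMap.sub_apply, form_smul_left, map_smul, smul_eq_mul, hσ, hxy, hyx,
      hxx]
    field_simp
    ring
  · simp [hxy, hxx]
  · simp only [map_sub, LinearMap.sub_apply, form_smul_left, hxx, hyx]
    ring

/-- A primitive vector of a self-dual lattice whose length is divisible by `ϖ ^ k`, `k ≥ 1`, is
congruent to an isotropic one modulo `ϖ ^ k`. -/
theorem exists_isotropic (P : IsLatticePair ϖ h V L M N) (H : IsUnramifiedIntegers R σ ϖ)
    (hherm : h.IsSymm) {x : W} (hx : x ∈ L) (hx' : 𝓆⁻¹ • x ∉ L) {k : ℕ} (hk : 1 ≤ k)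
    (hxx : 𝓆 ^ (-(k : ℤ)) * h x x ∈ 𝒪) :
    ∃ z ∈ L, h (x + 𝓆 ^ (k : ℤ) • z) (x + 𝓆 ^ (k : ℤ) • z) = 0 := by
  obtain ⟨y, hy, hxy, hyx⟩ := P.exists_form_eq_one H hherm hx hx'
  obtain ⟨c, hc, hσc, hroot⟩ := H.exists_root hk hxx (P.form_mem hy hy) (form_symm hherm x x)
    (form_symm hherm y y)
  refine ⟨(𝓆 ^ (-(k : ℤ)) * c) • y, smul_mem_of_mem_range L hc hy, ?_⟩
  rw [smul_smul, ← mul_assoc, ← zpow_add₀ H.q_ne_zero, add_neg_cancel, zpow_zero, one_mul]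
  simp only [map_add, LinearMap.add_apply, form_smul_left, map_smul, smul_eq_mul, hσc, hxy, hyx]
  linear_combination hroot

variable (h ϖ V L M N) in
/-- A hyperbolic pair `x, y` of the self-dual lattice `L` which is adapted to the vertex lattice
`M`: up to a complement, `M` is spanned by `ϖ ^ a y` and `ϖ ^ α x`, with extremal exponents. -/
structure IsAdaptedPair (x y : W) (a : ℕ) (α : ℤ) : Prop where
  left_mem : x ∈ L
  right_mem : y ∈ L
  left_left : h x x = 0
  right_right : h y y = 0
  left_right : h x y = 1
  right_left : h y x = 1
  exponent : α = -a ∨ α = 1 - a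
  smul_left_mem : 𝓆 ^ α • x ∈ M
  smul_right_mem : 𝓆 ^ (a : ℤ) • y ∈ M
  form_left : ∀ z ∈ M, 𝓆 ^ (-(a : ℤ)) * h x z ∈ 𝒪
  form_right : ∀ z ∈ M, 𝓆 ^ (-α) * h y z ∈ 𝒪
  dual_bound : ∀ z ∈ N, 𝓆 ^ (a : ℤ) • z ∈ L
  bound : ∀ z ∈ M, 𝓆 ^ (-α) • z ∈ L

/-- An adapted hyperbolic pair exists as soon as `N ⊄ L` or `V` contains an isotropic vector. One
takes the least `a` with `ϖ ^ a N ⊆ L` and corrects a vector of `ϖ ^ a M` (if possible) or of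
`ϖ ^ a N` that is primitive in `L` to an isotropic one. -/
theorem exists_isAdaptedPair (P : IsLatticePair ϖ h V L M N) (H : IsUnramifiedIntegers R σ ϖ)
    (hherm : h.IsSymm) (hiso : (∃ x ∈ V, x ≠ 0 ∧ h x x = 0) ∨ ¬ N ≤ L) :
    ∃ (x y : W) (a : ℕ) (α : ℤ), IsAdaptedPair ϖ h L M N x y a α := by
  classical
  have hq := H.q_ne_zero
  set a := Nat.find P.bound with ha
  have hbd : ∀ z ∈ N, 𝓆 ^ (a : ℤ) • z ∈ L := Nat.find_spec P.bound
  rcases Nat.eq_zero_or_pos a with ha0 | hapos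
  -- if `a = 0`, then `L = M = N`, and any primitive isotropic vector of `L` will do
  · have hNL : N ≤ L := fun z hz => by simpa [ha0] using hbd z hz
    have hLM : L ≤ M := fun z hz => (P.mem_right z).2
      ⟨((P.mem_left z).1 hz).1, fun w hw => P.form_mem (hNL hw) hz⟩
    obtain ⟨x₀, hx₀, hx₀0, hx₀x₀⟩ := hiso.resolve_right (not_not.2 hNL)
    obtain ⟨k, hk, hk'⟩ := P.exists_primitive_zpow_smul H hx₀ hx₀0
    have hxx : h (𝓆 ^ k • x₀) (𝓆 ^ k • x₀) = 0 := by
      rw [form_zpow_smul_left, form_zpow_smul_right, hx₀x₀, mul_zero, mul_zero]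
    obtain ⟨y, hy, hyy, hxy, hyx⟩ := P.exists_hyperbolic H hherm hk hk' hxx
    refine ⟨_, y, 0, 0, hk, hy, hxx, hyy, hxy, hyx, Or.inl (by simp), ?_, ?_, ?_, ?_, ?_, ?_⟩
    · simpa using hLM hk
    · simpa using hLM hy
    · intro z hz; simpa using P.form_mem hk (hNL (P.le hz))
    · intro z hz; simpa using P.form_mem hy (hNL (P.le hz))
    · intro z hz; simpa using hNL hz
    · intro z hz; simpa using hNL (P.le hz)
  · have hLM : ∀ w ∈ L, 𝓆 ^ (a : ℤ) • w ∈ M := fun w hw => (P.mem_right _).2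
      ⟨V.smul_mem _ ((P.mem_left w).1 hw).1, fun v hv => by
        rw [form_zpow_smul_right, ← form_zpow_smul_left]
        exact P.form_mem (hbd v hv) hw⟩
    have hmin : ∃ z ∈ N, 𝓆 ^ ((a : ℤ) - 1) • z ∉ L := by
      have := Nat.find_min P.bound (m := a - 1) (by omega)
      push Not at this
      rwa [show ((a - 1 : ℕ) : ℤ) = (a : ℤ) - 1 by omega] at this
    have hprim : ∀ z : W, 𝓆⁻¹ • (𝓆 ^ (a : ℤ) • z) = 𝓆 ^ ((a : ℤ) - 1) • z := fun z => by
      rw [smul_smul, ← zpow_neg_one, ← zpow_add₀ hq, neg_add_eq_sub]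
    by_cases hM : ∃ z ∈ M, 𝓆 ^ ((a : ℤ) - 1) • z ∉ L
    -- the length of `ϖ ^ a z` is divisible by `ϖ ^ (2 * a)`, since `h z z` is integral
    · obtain ⟨z, hz, hzL⟩ := hM
      obtain ⟨w, hw, hiso⟩ := P.exists_isotropic H hherm (x := 𝓆 ^ (a : ℤ) • z) (k := 2 * a)
        (hbd z (P.le hz)) (by rwa [hprim]) (by omega) (by
          rw [form_zpow_smul_left, form_zpow_smul_right, ← mul_assoc, ← mul_assoc,
            ← zpow_add₀ hq, ← zpow_add₀ hq]
          push_cast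
          rw [show -(2 * (a : ℤ)) + a + a = 0 by ring, zpow_zero, one_mul]
          exact P.form_dual_mem (P.le hz) hz)
      set x := 𝓆 ^ (a : ℤ) • z + 𝓆 ^ ((2 * a : ℕ) : ℤ) • w with hx
      have hxM : 𝓆 ^ (-(a : ℤ)) • x ∈ M := by
        rw [hx, smul_add, smul_smul, smul_smul, ← zpow_add₀ hq, ← zpow_add₀ hq]
        push_cast
        rw [show -(a : ℤ) + a = 0 by ring, show -(a : ℤ) + 2 * a = a by ring, zpow_zero, one_smul]
        exact add_mem hz (hLM w hw)
      have hxL : x ∈ L := add_mem (hbd z (P.le hz))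
        (smul_mem_of_mem_range L (H.q_zpow_mem (by omega)) hw)
      have hxL' : 𝓆⁻¹ • x ∉ L := fun hc => hzL (by
        have h1 := sub_mem hc (smul_mem_of_mem_range L
          (H.q_zpow_mem (k := 2 * a - 1) (by omega)) hw)
        rw [hx, smul_add, hprim, smul_smul, ← zpow_neg_one, ← zpow_add₀ hq] at h1
        push_cast at h1
        rwa [show (-1 : ℤ) + 2 * a = 2 * a - 1 by ring, add_sub_cancel_right] at h1)
      obtain ⟨y, hy, hyy, hxy, hyx⟩ := P.exists_hyperbolic H hherm hxL hxL' hiso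
      refine ⟨x, y, a, -a, hxL, hy, hiso, hyy, hxy, hyx, Or.inl rfl, hxM, hLM y hy, ?_, ?_, hbd, ?_⟩
      · intro v hv
        rw [← form_zpow_smul_left]
        exact P.form_dual_mem (P.le hxM) hv
      · intro v hv
        rw [neg_neg, ← form_zpow_smul_left]
        exact P.form_dual_mem (P.le (hLM y hy)) hv
      · intro v hv
        rw [neg_neg]
        exact hbd v (P.le hv)
    -- here `z` is only in `N`, so `ϖ * h z z` is integral, and the exponent is `2 * a - 1`
    · push Not at hM
      obtain ⟨z, hz, hzL⟩ := hmin
      have hLN : ∀ w ∈ L, 𝓆 ^ ((a : ℤ) - 1) • w ∈ N := fun w hw => (P.mem_dual _).2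
        ⟨V.smul_mem _ ((P.mem_left w).1 hw).1, fun v hv => by
          rw [form_zpow_smul_right, ← form_zpow_smul_left]
          exact P.form_mem (hM v hv) hw⟩
      obtain ⟨w, hw, hiso⟩ := P.exists_isotropic H hherm (x := 𝓆 ^ (a : ℤ) • z) (k := 2 * a - 1)
        (hbd z hz) (by rwa [hprim]) (by omega) (by
          have h1 := P.form_dual_mem hz (P.smul_mem z hz)
          rw [map_smul, smul_eq_mul] at h1
          rw [form_zpow_smul_left, form_zpow_smul_right, ← mul_assoc, ← mul_assoc,
            ← zpow_add₀ hq, ← zpow_add₀ hq,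
            show -((2 * a - 1 : ℕ) : ℤ) + a + a = 1 by omega, zpow_one]
          exact h1)
      set x := 𝓆 ^ (a : ℤ) • z + 𝓆 ^ ((2 * a - 1 : ℕ) : ℤ) • w with hx
      have hxN : 𝓆 ^ (-(a : ℤ)) • x ∈ N := by
        rw [hx, smul_add, smul_smul, smul_smul, ← zpow_add₀ hq, ← zpow_add₀ hq,
          show -(a : ℤ) + a = 0 by ring, show -(a : ℤ) + (2 * a - 1 : ℕ) = a - 1 by omega,
          zpow_zero, one_smul]
        exact add_mem hz (hLN w hw)
      have hxM : 𝓆 ^ (1 - (a : ℤ)) • x ∈ M := by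
        rw [sub_eq_add_neg, zpow_add₀ hq, mul_smul, zpow_one]
        exact P.smul_mem _ hxN
      have hxL : x ∈ L := add_mem (hbd z hz)
        (smul_mem_of_mem_range L (H.q_zpow_mem (by omega)) hw)
      have hxL' : 𝓆⁻¹ • x ∉ L := fun hc => hzL (by
        have h1 := sub_mem hc (smul_mem_of_mem_range L
          (H.q_zpow_mem (k := 2 * a - 2) (by omega)) hw)
        rw [hx, smul_add, hprim, smul_smul, ← zpow_neg_one, ← zpow_add₀ hq,
          show (-1 : ℤ) + (2 * a - 1 : ℕ) = 2 * a - 2 by omega, add_sub_cancel_right] at h1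
        exact h1)
      obtain ⟨y, hy, hyy, hxy, hyx⟩ := P.exists_hyperbolic H hherm hxL hxL' hiso
      refine ⟨x, y, a, 1 - a, hxL, hy, hiso, hyy, hxy, hyx, Or.inr rfl, hxM, hLM y hy, ?_, ?_, hbd,
        ?_⟩
      · intro v hv
        rw [← form_zpow_smul_left]
        exact P.form_dual_mem hxN hv
      · intro v hv
        rw [neg_sub, ← form_zpow_smul_left]
        exact P.form_dual_mem (hLN y hy) hv
      · intro v hv
        rw [neg_sub]
        exact hM v hv

end IsLatticePair

end HyperbolicPair

/-! ### Splitting off a hyperbolic pair -/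

section OrthogonalComplement

variable {F₀ F R W : Type*} [Field F₀] [Field F] [Algebra F₀ F] [CommRing R] [Algebra R F]
  {σ : F ≃ₐ[F₀] F} {ϖ : F₀} [AddCommGroup W] [Module F W] [Module R W]
  {h : W →ₛₗ[(σ : F →+* F)] W →ₗ[F] F}

local notation "𝒪" => RingHom.range (algebraMap R F)
local notation "𝓆" => algebraMap F₀ F ϖ

variable (h) in
/-- The orthogonal complement of a pair of vectors. -/
def orthPair (x y : W) : Submodule F W := LinearMap.ker (h x) ⊓ LinearMap.ker (h y)

theorem mem_orthPair {x y z : W} : z ∈ orthPair h x y ↔ h x z = 0 ∧ h y z = 0 := by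
  simp [orthPair]

variable (h) in
/-- The projection to the orthogonal complement of a hyperbolic pair `x, y`. -/
def orthProj (x y : W) : W →ₗ[F] W :=
  LinearMap.id - (h y).smulRight x - (h x).smulRight y

theorem orthProj_apply (x y z : W) : orthProj h x y z = z - h y z • x - h x z • y := rfl

theorem eq_orthProj_add (x y z : W) : z = orthProj h x y z + (h y z • x + h x z • y) := by
  rw [orthProj_apply]; abel

variable {V : Submodule F W} {L M N : Submodule R W}

namespace IsLatticePair

variable [IsScalarTower R F W] [IsFractionRing R F] [IsDomain R] [IsDiscreteValuationRing R]
variable {x y : W} {a : ℕ} {α : ℤ}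

theorem IsAdaptedPair.orthProj_mem (Q : IsAdaptedPair ϖ h L M N x y a α) (z : W) :
    orthProj h x y z ∈ orthPair h x y := by
  rw [mem_orthPair, orthProj_apply]
  simp [Q.left_left, Q.left_right, Q.right_left, Q.right_right]

theorem form_orthProj {x y w z : W} (hz : z ∈ orthPair h x y) :
    h (orthProj h x y w) z = h w z := by
  rw [mem_orthPair] at hz
  rw [orthProj_apply]
  simp [hz.1, hz.2]

theorem form_orthProj_comm (hherm : h.IsSymm) (x y w z : W) :
    h (orthProj h x y w) z = h w (orthProj h x y z) := by
  simp only [orthProj_apply, map_sub, LinearMap.sub_apply, form_smul_left, map_smul, smul_eq_mul,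
    form_symm hherm]
  ring

theorem IsAdaptedPair.orthProj_mem_left (P : IsLatticePair ϖ h V L M N)
    (Q : IsAdaptedPair ϖ h L M N x y a α) {z : W} (hz : z ∈ L) : orthProj h x y z ∈ L := by
  rw [orthProj_apply]
  exact sub_mem (sub_mem hz (smul_mem_of_mem_range L (P.form_mem Q.right_mem hz) Q.left_mem))
    (smul_mem_of_mem_range L (P.form_mem Q.left_mem hz) Q.right_mem)

theorem IsAdaptedPair.orthProj_mem_right (H : IsUnramifiedIntegers R σ ϖ)
    (Q : IsAdaptedPair ϖ h L M N x y a α) {z : W} (hz : z ∈ M) : orthProj h x y z ∈ M := by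
  have hq := H.q_ne_zero
  have hx := smul_mem_of_mem_range M (Q.form_right z hz) Q.smul_left_mem
  have hy := smul_mem_of_mem_range M (Q.form_left z hz) Q.smul_right_mem
  rw [smul_smul, mul_right_comm, ← zpow_add₀ hq, neg_add_cancel, zpow_zero, one_mul] at hx hy
  rw [orthProj_apply]
  exact sub_mem (sub_mem hz hx) hy

theorem IsAdaptedPair.orthProj_mem_space (P : IsLatticePair ϖ h V L M N)
    (Q : IsAdaptedPair ϖ h L M N x y a α) {z : W} (hz : z ∈ V) : orthProj h x y z ∈ V := by
  rw [orthProj_apply]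
  exact sub_mem (sub_mem hz (V.smul_mem _ ((P.mem_left x).1 Q.left_mem).1))
    (V.smul_mem _ ((P.mem_left y).1 Q.right_mem).1)

theorem IsAdaptedPair.orthProj_mem_dual (P : IsLatticePair ϖ h V L M N)
    (H : IsUnramifiedIntegers R σ ϖ) (hherm : h.IsSymm)
    (Q : IsAdaptedPair ϖ h L M N x y a α) {z : W} (hz : z ∈ N) : orthProj h x y z ∈ N := by
  refine (P.mem_dual _).2 ⟨Q.orthProj_mem_space P ((P.mem_dual z).1 hz).1, fun w hw => ?_⟩
  rw [← form_orthProj_comm hherm]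
  exact P.form_mem_dual (Q.orthProj_mem_right H hw) hz

/-- Splitting off an adapted hyperbolic pair. -/
theorem inf_orthPair (P : IsLatticePair ϖ h V L M N) (H : IsUnramifiedIntegers R σ ϖ)
    (hherm : h.IsSymm) (Q : IsAdaptedPair ϖ h L M N x y a α) :
    IsLatticePair ϖ h (V ⊓ orthPair h x y) (L ⊓ (orthPair h x y).restrictScalars R)
      (M ⊓ (orthPair h x y).restrictScalars R) (N ⊓ (orthPair h x y).restrictScalars R) where
  mem_left z := by
    simp only [Submodule.mem_inf, Submodule.restrictScalars_mem]
    refine ⟨fun hz => ⟨⟨((P.mem_left z).1 hz.1).1, hz.2⟩, fun w hw => P.form_mem hw.1 hz.1⟩,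
      fun hz => ⟨(P.mem_left z).2 ⟨hz.1.1, fun w hw => ?_⟩, hz.1.2⟩⟩
    rw [← form_orthProj hz.1.2]
    exact hz.2 _ ⟨Q.orthProj_mem_left P hw, Q.orthProj_mem w⟩
  mem_dual z := by
    simp only [Submodule.mem_inf, Submodule.restrictScalars_mem]
    refine ⟨fun hz => ⟨⟨((P.mem_dual z).1 hz.1).1, hz.2⟩, fun w hw => P.form_mem_dual hw.1 hz.1⟩,
      fun hz => ⟨(P.mem_dual z).2 ⟨hz.1.1, fun w hw => ?_⟩, hz.1.2⟩⟩
    rw [← form_orthProj hz.1.2]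
    exact hz.2 _ ⟨Q.orthProj_mem_right H hw, Q.orthProj_mem w⟩
  mem_right z := by
    simp only [Submodule.mem_inf, Submodule.restrictScalars_mem]
    refine ⟨fun hz => ⟨⟨((P.mem_right z).1 hz.1).1, hz.2⟩, fun w hw => P.form_dual_mem hw.1 hz.1⟩,
      fun hz => ⟨(P.mem_right z).2 ⟨hz.1.1, fun w hw => ?_⟩, hz.1.2⟩⟩
    rw [← form_orthProj hz.1.2]
    exact hz.2 _ ⟨Q.orthProj_mem_dual P H hherm hw, Q.orthProj_mem w⟩
  le := inf_le_inf_right _ P.le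
  smul_mem z hz := ⟨P.smul_mem z hz.1, (orthPair h x y).smul_mem _ hz.2⟩
  bound := by
    obtain ⟨b, hb⟩ := P.bound
    exact ⟨b, fun z hz => ⟨hb z hz.1, (orthPair h x y).smul_mem _ hz.2⟩⟩
  absorb z hz := by
    obtain ⟨k, hk⟩ := P.absorb z hz.1
    exact ⟨k, hk, (orthPair h x y).smul_mem _ hz.2⟩
  nondeg z hz hz0 := P.nondeg z hz.1 fun v hv => by
    rw [← form_orthProj hz.2]
    exact hz0 _ ⟨Q.orthProj_mem_space P hv, Q.orthProj_mem v⟩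

theorem finrank_inf_orthPair [FiniteDimensional F W] (P : IsLatticePair ϖ h V L M N)
    (Q : IsAdaptedPair ϖ h L M N x y a α) :
    Module.finrank F (V ⊓ orthPair h x y : Submodule F W) + 2 = Module.finrank F V := by
  let f : V →ₗ[F] F × F := ((h x).prod (h y)).domRestrict V
  have hx : x ∈ V := ((P.mem_left x).1 Q.left_mem).1
  have hy : y ∈ V := ((P.mem_left y).1 Q.right_mem).1
  have hsurj : Function.Surjective f := by
    rintro ⟨c, d⟩
    refine ⟨⟨d • x + c • y, add_mem (V.smul_mem _ hx) (V.smul_mem _ hy)⟩, ?_⟩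
    simp [f, LinearMap.domRestrict_apply, Q.left_left, Q.left_right, Q.right_left, Q.right_right]
  have hker : LinearMap.ker f = (V ⊓ orthPair h x y).submoduleOf V := by
    ext ⟨z, hz⟩
    simp [f, LinearMap.domRestrict_apply, Submodule.submoduleOf, mem_orthPair]
  have h1 := LinearMap.finrank_range_add_finrank_ker f
  rw [LinearMap.range_eq_top.2 hsurj, finrank_top, Module.finrank_prod, Module.finrank_self, hker,
    (Submodule.submoduleOfEquivOfLe inf_le_left).finrank_eq] at h1
  omega

/-- A totally isotropic subspace loses at most one dimension when a hyperbolic pair is split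
off. -/
theorem exists_isotropic_inf_orthPair [FiniteDimensional F W] (P : IsLatticePair ϖ h V L M N)
    (hherm : h.IsSymm) (Q : IsAdaptedPair ϖ h L M N x y a α) {U : Submodule F W} (hU : U ≤ V)
    (hiso : ∀ u ∈ U, ∀ v ∈ U, h u v = 0) :
    ∃ U' ≤ V ⊓ orthPair h x y, (∀ u ∈ U', ∀ v ∈ U', h u v = 0) ∧
      Module.finrank F U ≤ Module.finrank F U' + 1 := by
  have hx0 : x ≠ 0 := by
    rintro rfl
    simpa using Q.left_right
  set U₁ : Submodule F W := U ⊓ LinearMap.ker (h x) with hU₁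
  have hform : ∀ u ∈ U₁, ∀ v ∈ U₁, h (orthProj h x y u) (orthProj h x y v) = 0 := by
    rintro u ⟨hu, hu'⟩ v ⟨hv, hv'⟩
    replace hu' : h x u = 0 := hu'
    replace hv' : h x v = 0 := hv'
    have hux : h u x = 0 := by rw [← form_symm hherm, hu', map_zero]
    simp only [orthProj_apply, map_sub, LinearMap.sub_apply, form_smul_left, map_smul,
      smul_eq_mul, hu', hv', hux, hiso u hu v hv, Q.left_left, map_zero]
    ring
  refine ⟨U₁.map (orthProj h x y), ?_, ?_, ?_⟩
  · rintro _ ⟨u, hu, rfl⟩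
    exact ⟨Q.orthProj_mem_space P (hU hu.1), Q.orthProj_mem u⟩
  · rintro _ ⟨u, hu, rfl⟩ _ ⟨v, hv, rfl⟩
    exact hform u hu v hv
  · let f : U₁ →ₗ[F] W := (orthProj h x y).domRestrict U₁
    have hrange : LinearMap.range f = U₁.map (orthProj h x y) := by
      rw [LinearMap.range_domRestrict]
    have hker : ∀ u : U₁, u ∈ LinearMap.ker f → (u : W) ∈ Submodule.span F {x} := by
      rintro ⟨u, hu⟩ hfu
      rw [LinearMap.mem_ker, LinearMap.domRestrict_apply] at hfu
      have hu' : h x u = 0 := hu.2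
      have := eq_orthProj_add (h := h) x y u
      rw [hfu, hu', zero_smul, add_zero, zero_add] at this
      rw [Submodule.mem_span_singleton]
      exact ⟨_, this.symm⟩
    have h1 := LinearMap.finrank_range_add_finrank_ker f
    rw [hrange] at h1
    by_cases hxU : ∀ u ∈ U, h x u = 0
    · have hU₁U : U₁ = U := inf_eq_left.2 fun u hu => hxU u hu
      have h2 : Module.finrank F (LinearMap.ker f) ≤ 1 := by
        have h3 : (LinearMap.ker f).map U₁.subtype ≤ Submodule.span F {x} := by
          rintro _ ⟨u, hu, rfl⟩
          exact hker u hu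
        have h4 := Submodule.finrank_mono h3
        rwa [finrank_span_singleton hx0, Submodule.finrank_map_subtype_eq] at h4
      rw [← hU₁U]
      omega
    · push Not at hxU
      obtain ⟨v, hv, hxv⟩ := hxU
      have h2 : LinearMap.ker f = ⊥ := by
        rw [eq_bot_iff]
        intro u hu
        obtain ⟨c, hc⟩ := Submodule.mem_span_singleton.1 (hker u hu)
        rcases eq_or_ne c 0 with rfl | hc0
        · rw [Submodule.mem_bot]
          exact Subtype.ext (by rw [← hc, zero_smul]; rfl)
        · exfalso
          have h3 := hiso u u.2.1 v hv
          rw [← hc, form_smul_left] at h3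
          simp [hc0, hxv] at h3
      rw [h2, finrank_bot, add_zero] at h1
      have h3 := LinearMap.finrank_range_add_finrank_ker ((h x).domRestrict U)
      have h4 : Module.finrank F (LinearMap.range ((h x).domRestrict U)) ≤ 1 := by
        simpa using Submodule.finrank_le (LinearMap.range ((h x).domRestrict U))
      have h5 : LinearMap.ker ((h x).domRestrict U) = U₁.submoduleOf U := by
        ext ⟨z, hz⟩
        simp [LinearMap.domRestrict_apply, Submodule.submoduleOf, hU₁]
      rw [h5, (Submodule.submoduleOfEquivOfLe inf_le_left).finrank_eq, ← hU₁] at h3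
      omega

end IsLatticePair

end OrthogonalComplement

/-! ### A self-dual lattice and a vertex lattice lie in a common apartment -/

section Apartment

variable {F₀ F R W : Type*} [Field F₀] [Field F] [Algebra F₀ F] [CommRing R] [Algebra R F]
  {σ : F ≃ₐ[F₀] F} {ϖ : F₀} [AddCommGroup W] [Module F W] [Module R W]
  {h : W →ₛₗ[(σ : F →+* F)] W →ₗ[F] F}

local notation "𝒪" => RingHom.range (algebraMap R F)
local notation "𝓆" => algebraMap F₀ F ϖ

variable {V : Submodule F W} {L M N : Submodule R W}
variable [IsScalarTower R F W] [IsFractionRing R F] [IsDomain R] [IsDiscreteValuationRing R]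

variable (ϖ h) in
/-- The family `e` is a basis of the lattice `L`, the family `ϖ ^ μ i • e i` is a basis of the
lattice `M`, and the Gram matrix of `e` is antidiagonal with entries `1`, except that the central
entry (for odd `n`) is the unit `u`. -/
structure IsApartment (L M : Submodule R W) {n : ℕ} (e : Fin n → W) (μ : Fin n → ℤ) (u : F) :
    Prop where
  unit_ne_zero : u ≠ 0
  unit_mem : u ∈ 𝒪
  inv_mem : u⁻¹ ∈ 𝒪
  gram : ∀ i j, h (e i) (e j) = if j = Fin.rev i then (if j = i then u else 1) else 0
  span_left : L = Submodule.span R (Set.range e)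
  span_right : M = Submodule.span R (Set.range fun i => 𝓆 ^ μ i • e i)
  antitone : Antitone μ
  exponent : ∀ i, μ i + μ (Fin.rev i) = 0 ∨ μ i + μ (Fin.rev i) = 1

namespace IsApartment

variable {n : ℕ} {e : Fin n → W} {μ : Fin n → ℤ} {u : F}

theorem mem_left (A : IsApartment ϖ h L M e μ u) (i : Fin n) : e i ∈ L := by
  rw [A.span_left]
  exact Submodule.subset_span ⟨i, rfl⟩

theorem mem_right (A : IsApartment ϖ h L M e μ u) (i : Fin n) : 𝓆 ^ μ i • e i ∈ M := by
  rw [A.span_right]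
  exact Submodule.subset_span ⟨i, rfl⟩

theorem nonneg_of_smul_mem (A : IsApartment ϖ h L M e μ u) (H : IsUnramifiedIntegers R σ ϖ)
    (P : IsLatticePair ϖ h V L M N) {i : Fin n} {k : ℤ} (hk : 𝓆 ^ k • e i ∈ L) : 0 ≤ k := by
  have h1 := P.form_mem (A.mem_left (Fin.rev i)) hk
  rw [form_zpow_smul_right, A.gram, Fin.rev_rev, if_pos rfl] at h1
  split_ifs at h1
  · have h2 := mul_mem h1 A.inv_mem
    rwa [mul_assoc, mul_inv_cancel₀ A.unit_ne_zero, mul_one, H.q_zpow_mem_iff] at h2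
  · rwa [mul_one, H.q_zpow_mem_iff] at h1

theorem mem_dual (A : IsApartment ϖ h L M e μ u) (H : IsUnramifiedIntegers R σ ϖ)
    (P : IsLatticePair ϖ h V L M N) (i : Fin n) : 𝓆 ^ (-μ (Fin.rev i)) • e i ∈ N := by
  refine (P.mem_dual _).2 ⟨V.smul_mem _ ((P.mem_left _).1 (A.mem_left i)).1, fun w hw => ?_⟩
  rw [A.span_right] at hw
  induction hw using Submodule.span_induction with
  | mem w hw =>
    obtain ⟨j, rfl⟩ := hw
    change h (𝓆 ^ μ j • e j) _ ∈ 𝒪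
    rw [form_zpow_smul_left, form_zpow_smul_right, A.gram]
    split_ifs with h1 h2
    · subst h1
      rw [Fin.rev_rev, ← mul_assoc, ← zpow_add₀ H.q_ne_zero, add_neg_cancel, zpow_zero, one_mul]
      exact A.unit_mem
    · subst h1
      rw [Fin.rev_rev, ← mul_assoc, ← zpow_add₀ H.q_ne_zero, add_neg_cancel, zpow_zero, one_mul]
      exact one_mem _
    · simp
  | zero => simp
  | add w w' _ _ hw hw' => rw [map_add, LinearMap.add_apply]; exact add_mem hw hw'
  | smul r w _ hw =>
    rw [← algebraMap_smul F r w, form_smul_left]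
    exact mul_mem (H.map_mem r) hw

end IsApartment

namespace IsLatticePair

variable {x y : W} {a : ℕ} {α : ℤ}

/-- An apartment for the complement of an adapted hyperbolic pair extends to an apartment. -/
theorem IsAdaptedPair.isApartment (P : IsLatticePair ϖ h V L M N)
    (H : IsUnramifiedIntegers R σ ϖ) (hherm : h.IsSymm)
    (Q : IsAdaptedPair ϖ h L M N x y a α) {n : ℕ} {e : Fin n → W} {μ : Fin n → ℤ} {u : F}
    (A : IsApartment ϖ h (L ⊓ (orthPair h x y).restrictScalars R)
      (M ⊓ (orthPair h x y).restrictScalars R) e μ u) :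
    IsApartment ϖ h L M (Fin.cons y (Fin.snoc e x : Fin (n + 1) → W) : Fin (n + 2) → W)
      (Fin.cons (a : ℤ) (Fin.snoc μ α : Fin (n + 1) → ℤ) : Fin (n + 2) → ℤ) u := by
  have hq := H.q_ne_zero
  have P₁ := P.inf_orthPair H hherm Q
  have horth : ∀ i, h x (e i) = 0 ∧ h y (e i) = 0 := fun i => mem_orthPair.1 (A.mem_left i).2
  have horth' : ∀ i, h (e i) x = 0 ∧ h (e i) y = 0 := fun i => by
    rw [← form_symm hherm x, ← form_symm hherm y, (horth i).1, (horth i).2, map_zero]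
    exact ⟨rfl, rfl⟩
  have hle : ∀ i, μ i ≤ a := fun i => by
    have h1 := A.mem_dual H P₁ (Fin.rev i)
    rw [Fin.rev_rev] at h1
    have h2 := Q.dual_bound _ h1.1
    rw [smul_smul, ← zpow_add₀ hq] at h2
    have := A.nonneg_of_smul_mem H P₁ ⟨h2, (orthPair h x y).smul_mem _ (A.mem_left _).2⟩
    omega
  have hge : ∀ i, α ≤ μ i := fun i => by
    have h2 := Q.bound _ (A.mem_right i).1
    rw [smul_smul, ← zpow_add₀ hq] at h2
    have := A.nonneg_of_smul_mem H P₁ ⟨h2, (orthPair h x y).smul_mem _ (A.mem_left _).2⟩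
    omega
  have hαa : α ≤ a := by
    rcases Q.exponent with h1 | h1
    · omega
    · by_contra! hc
      -- then `a = 0`, and `M` would be contained in `ϖ L`
      obtain rfl : a = 0 := by omega
      have h2 := P.form_mem Q.left_mem (Q.bound _ Q.smul_right_mem)
      rw [form_zpow_smul_right, form_zpow_smul_right, Q.left_right, h1, mul_one,
        ← zpow_add₀ hq, H.q_zpow_mem_iff] at h2
      simp at h2
  refine ⟨A.unit_ne_zero, A.unit_mem, A.inv_mem, ?_, ?_, ?_, ?_, ?_⟩
  · intro i j
    induction i using Fin.cases with
    | zero =>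
      induction j using Fin.cases with
      | zero => simp [Q.right_right, Fin.ext_iff]
      | succ j =>
        induction j using Fin.lastCases with
        | last => simp [Q.right_left, Fin.ext_iff]
        | cast j => simp [(horth j).2, Fin.ext_iff]; intro h1; exact absurd j.2 (by omega)
    | succ i =>
      induction i using Fin.lastCases with
      | last =>
        induction j using Fin.cases with
        | zero => simp [Q.left_right, Fin.ext_iff]
        | succ j =>
          induction j using Fin.lastCases with
          | last => simp [Q.left_left, Fin.ext_iff]
          | cast j => simp [(horth j).1, Fin.ext_iff]
      | cast i =>
        induction j using Fin.cases with
        | zero => simp [(horth' i).2, Fin.ext_iff]; intro h1; exact absurd i.2 (by omega)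
        | succ j =>
          induction j using Fin.lastCases with
          | last => simp [(horth' i).1, Fin.ext_iff]; intro h1; exact absurd i.2 (by omega)
          | cast j =>
            simp only [Fin.cons_succ, Fin.snoc_castSucc, A.gram, Fin.ext_iff, Fin.val_succ,
              Fin.val_castSucc, Fin.val_rev]
            split_ifs <;> first | rfl | omega
  · refine le_antisymm (fun z hz => ?_) (Submodule.span_le.2 ?_)
    · have h1 : orthProj h x y z ∈ L ⊓ (orthPair h x y).restrictScalars R :=
        ⟨Q.orthProj_mem_left P hz, Q.orthProj_mem z⟩
      rw [A.span_left] at h1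
      rw [eq_orthProj_add (h := h) x y z]
      refine add_mem (Submodule.span_mono ?_ h1) (add_mem
        (smul_mem_of_mem_range _ (P.form_mem Q.right_mem hz) (Submodule.subset_span ?_))
        (smul_mem_of_mem_range _ (P.form_mem Q.left_mem hz) (Submodule.subset_span ?_)))
      · rintro _ ⟨i, rfl⟩
        exact ⟨i.castSucc.succ, by simp⟩
      · exact ⟨(Fin.last n).succ, by simp⟩
      · exact ⟨0, by simp⟩
    · rintro _ ⟨i, rfl⟩
      induction i using Fin.cases with
      | zero => simpa using Q.right_mem
      | succ i =>
        induction i using Fin.lastCases with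
        | last => simpa using Q.left_mem
        | cast i => simpa using (A.mem_left i).1
  · refine le_antisymm (fun z hz => ?_) (Submodule.span_le.2 ?_)
    · have h1 : orthProj h x y z ∈ M ⊓ (orthPair h x y).restrictScalars R :=
        ⟨Q.orthProj_mem_right H hz, Q.orthProj_mem z⟩
      rw [A.span_right] at h1
      have h2 : ∀ (k : ℤ) (c : F) (w : W), (𝓆 ^ (-k) * c) • (𝓆 ^ k • w) = c • w := fun k c w => by
        rw [smul_smul, mul_right_comm, ← zpow_add₀ hq, neg_add_cancel, zpow_zero, one_mul]
      rw [eq_orthProj_add (h := h) x y z, ← h2 α _ x, ← h2 a _ y]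
      refine add_mem (Submodule.span_mono ?_ h1) (add_mem
        (smul_mem_of_mem_range _ (Q.form_right z hz) (Submodule.subset_span ?_))
        (smul_mem_of_mem_range _ (Q.form_left z hz) (Submodule.subset_span ?_)))
      · rintro _ ⟨i, rfl⟩
        exact ⟨i.castSucc.succ, by simp⟩
      · exact ⟨(Fin.last n).succ, by simp⟩
      · exact ⟨0, by simp⟩
    · rintro _ ⟨i, rfl⟩
      induction i using Fin.cases with
      | zero => simpa using Q.smul_right_mem
      | succ i =>
        induction i using Fin.lastCases with
        | last => simpa using Q.smul_left_mem
        | cast i => simpa using (A.mem_right i).1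
  · intro i j hij
    induction i using Fin.cases with
    | zero =>
      induction j using Fin.cases with
      | zero => simp
      | succ j =>
        induction j using Fin.lastCases with
        | last => simpa using hαa
        | cast j => simpa using hle j
    | succ i =>
      induction j using Fin.cases with
      | zero => simp at hij
      | succ j =>
        induction i using Fin.lastCases with
        | last =>
          induction j using Fin.lastCases with
          | last => simp
          | cast j =>
            simp only [Fin.le_def, Fin.val_succ, Fin.val_last, Fin.val_castSucc] at hij
            exact absurd j.2 (by omega)
        | cast i =>
          induction j using Fin.lastCases with
          | last => simpa using hge i
          | cast j => simpa using A.antitone (a := i) (b := j) (by simpa using hij)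
  · intro i
    have hα := Q.exponent
    induction i using Fin.cases with
    | zero =>
      simp only [Fin.cons_zero, Fin.rev_zero, ← Fin.succ_last, Fin.cons_succ, Fin.snoc_last]
      omega
    | succ i =>
      induction i using Fin.lastCases with
      | last =>
        have e1 : Fin.rev (Fin.last n).succ = 0 := by ext; simp
        simp only [e1, Fin.cons_succ, Fin.snoc_last, Fin.cons_zero]
        omega
      | cast i =>
        rw [Fin.rev_succ, Fin.rev_castSucc]
        simpa [Fin.castSucc_succ, ← Fin.succ_castSucc] using A.exponent i

/-- A self-dual lattice and a vertex lattice in a nondegenerate hermitian space containing a totally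
isotropic subspace of half the dimension lie in a common apartment. -/
theorem exists_isApartment [FiniteDimensional F W] (H : IsUnramifiedIntegers R σ ϖ)
    (hherm : h.IsSymm) (n : ℕ) :
    ∀ {V : Submodule F W} {L M N : Submodule R W}, IsLatticePair ϖ h V L M N →
      Module.finrank F V = n → (∃ U ≤ V, (∀ u ∈ U, ∀ v ∈ U, h u v = 0) ∧
        n ≤ 2 * Module.finrank F U + 1) →
      ∃ (e : Fin n → W) (μ : Fin n → ℤ) (u : F), IsApartment ϖ h L M e μ u := by
  induction n using Nat.twoStepInduction with
  | zero =>
    intro V L M N P hV _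
    have hV0 : V = ⊥ := Submodule.finrank_eq_zero.1 hV
    refine ⟨Fin.elim0, Fin.elim0, 1, one_ne_zero, one_mem _, by simp [one_mem], fun i => i.elim0,
      ?_, ?_, fun i => i.elim0, fun i => i.elim0⟩
    · rw [Set.range_eq_empty, Submodule.span_empty, eq_bot_iff]
      intro z hz
      simpa [hV0] using ((P.mem_left z).1 hz).1
    · rw [Set.range_eq_empty, Submodule.span_empty, eq_bot_iff]
      intro z hz
      simpa [hV0] using ((P.mem_right z).1 hz).1
  | one =>
    intro V L M N P hV _
    -- otherwise a hyperbolic plane would fit into the line `V`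
    have hNL : N ≤ L := by
      by_contra hc
      obtain ⟨x, y, a, α, Q⟩ := P.exists_isAdaptedPair H hherm (Or.inr hc)
      have := P.finrank_inf_orthPair Q
      omega
    have hLM : L ≤ M := fun z hz => (P.mem_right z).2
      ⟨((P.mem_left z).1 hz).1, fun w hw => P.form_mem (hNL hw) hz⟩
    have hML : M = L := le_antisymm (P.le.trans hNL) hLM
    have hV0 : V ≠ ⊥ := by
      rintro rfl
      simp at hV
    obtain ⟨x₀, hx₀, hx₀0⟩ := V.ne_bot_iff.1 hV0
    obtain ⟨k, hx, hx'⟩ := P.exists_primitive_zpow_smul H hx₀ hx₀0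
    set x := 𝓆 ^ k • x₀
    have hxV : x ∈ V := ((P.mem_left x).1 hx).1
    have hx0 : x ≠ 0 := by
      intro h0
      simp [h0] at hx'
    have hspan : ∀ z ∈ V, ∃ c : F, c • x = z := by
      intro z hz
      obtain ⟨c, hc⟩ := exists_smul_eq_of_finrank_eq_one hV (x := ⟨x, hxV⟩)
        (by simpa using hx0) ⟨z, hz⟩
      exact ⟨c, congrArg Subtype.val hc⟩
    obtain ⟨y, hy, hxy, hyx⟩ := P.exists_form_eq_one H hherm hx hx'
    obtain ⟨c, rfl⟩ := hspan y ((P.mem_left y).1 hy).1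
    have hu0 : h x x ≠ 0 := by
      intro h0
      simp [h0] at hxy
    have hinv : (h x x)⁻¹ ∈ 𝒪 := by
      have h1 := P.form_mem hy hy
      rw [map_smul, form_smul_left] at h1
      rw [form_smul_left] at hyx
      rw [map_smul, smul_eq_mul] at hxy
      rwa [hyx, smul_eq_mul, mul_one, eq_inv_of_mul_eq_one_left hxy] at h1
    have hL : L = Submodule.span R (Set.range fun _ : Fin 1 => x) := by
      refine le_antisymm (fun z hz => ?_) (Submodule.span_le.2 ?_)
      · obtain ⟨d, rfl⟩ := hspan z ((P.mem_left z).1 hz).1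
        refine smul_mem_of_mem_range _ ?_ (Submodule.subset_span ⟨0, rfl⟩)
        have h1 := P.form_mem hx hz
        rw [map_smul, smul_eq_mul] at h1
        simpa [hu0] using mul_mem h1 hinv
      · rintro _ ⟨i, rfl⟩
        exact hx
    refine ⟨fun _ => x, fun _ => 0, h x x, hu0, P.form_mem hx hx, hinv, ?_, hL, ?_, ?_, ?_⟩
    · intro i j
      simp [Subsingleton.elim j (Fin.rev i), Subsingleton.elim (Fin.rev i) i]
    · simpa [hML] using hL
    · exact antitone_const
    · simp
  | more n ih _ =>
    intro V L M N P hV hU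
    obtain ⟨U, hUV, hU, hUn⟩ := hU
    obtain ⟨x₀, hx₀, hx₀0⟩ := U.ne_bot_iff.1 (by
      rintro rfl
      simp at hUn)
    obtain ⟨x, y, a, α, Q⟩ := P.exists_isAdaptedPair H hherm
      (Or.inl ⟨x₀, hUV hx₀, hx₀0, hU _ hx₀ _ hx₀⟩)
    obtain ⟨U', hU'V, hU', hU'n⟩ := P.exists_isotropic_inf_orthPair hherm Q hUV hU
    have hfin := P.finrank_inf_orthPair Q
    obtain ⟨e, μ, u, A⟩ := ih (P.inf_orthPair H hherm Q) (by omega) ⟨U', hU'V, hU', by omega⟩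
    exact ⟨_, _, u, Q.isApartment P H hherm A⟩

end IsLatticePair

end Apartment

/-! ### Common bases of two lattices in a split hermitian space -/

section AdaptedBasis

variable {F₀ F R W : Type*} [Field F₀] [Field F] [Algebra F₀ F] [CommRing R] [Algebra R F]
  {σ : F ≃ₐ[F₀] F} {ϖ : F₀} [AddCommGroup W] [Module F W] [Module R W]
  {h : W →ₛₗ[(σ : F →+* F)] W →ₗ[F] F}

local notation "𝒪" => RingHom.range (algebraMap R F)
local notation "𝓆" => algebraMap F₀ F ϖ

/-- Every linear functional is represented by a vector: the form is perfect. -/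
theorem IsAntidiagonal.exists_form_eq {n : ℕ} {b : Module.Basis (Fin n) F W}
    (hb : IsAntidiagonal h b) (f : W →ₗ[F] F) : ∃ y, h y = f := by
  refine ⟨∑ k, σ.symm (f (b k)) • b (Fin.rev k), b.ext fun j => ?_⟩
  rw [map_sum, LinearMap.sum_apply, Finset.sum_eq_single j]
  · rw [form_smul_left, hb, Fin.rev_rev, if_pos rfl, mul_one, AlgEquiv.apply_symm_apply]
  · intro k _ hkj
    rw [form_smul_left, hb, Fin.rev_rev, if_neg hkj.symm, mul_zero]
  · simp

theorem IsAntidiagonal.eq_zero_of_form {n : ℕ} {b : Module.Basis (Fin n) F W}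
    (hb : IsAntidiagonal h b) {x : W} (hx : ∀ v, h v x = 0) : x = 0 := by
  rw [← b.forall_coord_eq_zero_iff]
  intro i
  obtain ⟨y, hy⟩ := hb.exists_form_eq (b.coord i)
  rw [← hy, hx]

section Lattice

variable [IsScalarTower R F W] [IsFractionRing R F] [IsDomain R] [IsDiscreteValuationRing R]

theorem span_smul_of_units {n : ℕ} (v : Fin n → W) (c : Fin n → F) (hc0 : ∀ i, c i ≠ 0)
    (hc : ∀ i, c i ∈ 𝒪) (hc' : ∀ i, (c i)⁻¹ ∈ 𝒪) :
    Submodule.span R (Set.range fun i => c i • v i) = Submodule.span R (Set.range v) := by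
  refine le_antisymm (Submodule.span_le.2 ?_) (Submodule.span_le.2 ?_)
  · rintro _ ⟨i, rfl⟩
    exact smul_mem_of_mem_range _ (hc i) (Submodule.subset_span ⟨i, rfl⟩)
  · rintro _ ⟨i, rfl⟩
    have h1 := smul_mem_of_mem_range (Submodule.span R (Set.range fun i => c i • v i)) (hc' i)
      (Submodule.subset_span ⟨i, rfl⟩)
    simpa [smul_smul, inv_mul_cancel₀ (hc0 i)] using h1

/-- A lattice is the dual lattice of its dual lattice. -/
theorem dualLattice_dualLattice {n : ℕ} {b : Module.Basis (Fin n) F W}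
    (hb : IsAntidiagonal h b) (hherm : h.IsSymm) (H : IsUnramifiedIntegers R σ ϖ)
    (Λ : Submodule R W) (hΛ : Λ.IsLattice F) : dualLattice h (dualLattice h Λ) = Λ := by
  refine le_antisymm (fun x hx => ?_) fun x hx y hy => ?_
  · have : Module.Finite R Λ := Submodule.IsLattice.finite F Λ
    have : Module.Free R Λ := Submodule.IsLattice.free F Λ
    let c := Module.Free.chooseBasis R Λ
    let c' := c.extendOfIsLattice F
    have hc' : ∀ i, c' i = c i := fun i => Module.Basis.extendOfIsLattice_apply F c i
    have key : ∀ i, c'.repr x i ∈ 𝒪 := by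
      intro i
      obtain ⟨y, hy⟩ := hb.exists_form_eq (c'.coord i)
      have h1 : y ∈ dualLattice h Λ := by
        intro z hz
        rw [← form_symm hherm, hy]
        refine H.map_mem' ?_
        have h2 : c'.coord i z = algebraMap R F (c.repr ⟨z, hz⟩ i) := by
          have h3 : z = ∑ j, algebraMap R F (c.repr ⟨z, hz⟩ j) • c' j := by
            have h4 := congrArg Subtype.val (c.sum_repr ⟨z, hz⟩)
            simp only [AddSubmonoidClass.coe_finsetSum, Submodule.coe_smul] at h4
            simp only [algebraMap_smul, hc', h4]
          conv_lhs => rw [h3]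
          rw [Module.Basis.coord_apply, Module.Basis.repr_sum_self]
        rw [h2]
        exact ⟨_, rfl⟩
      have h5 := hx y h1
      rwa [hy] at h5
    rw [← c'.sum_repr x]
    exact sum_mem fun i _ => smul_mem_of_mem_range Λ (key i) (by rw [hc']; exact (c i).2)
  · rw [← form_symm hherm]
    exact H.map_mem' (hy x hx)

theorem exists_zpow_smul_mem (H : IsUnramifiedIntegers R σ ϖ) (Λ : Submodule R W)
    (hΛ : Λ.IsLattice F) (z : W) : ∃ k : ℕ, 𝓆 ^ (k : ℤ) • z ∈ Λ := by
  have hz : z ∈ Submodule.span F (Λ : Set W) := by rw [hΛ.span_eq_top]; trivial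
  induction hz using Submodule.span_induction with
  | mem z hz => exact ⟨0, by simpa using hz⟩
  | zero => exact ⟨0, by simp⟩
  | add z w _ _ hz hw =>
    obtain ⟨k, hk⟩ := hz
    obtain ⟨l, hl⟩ := hw
    refine ⟨k + l, ?_⟩
    rw [smul_add]
    push_cast
    refine add_mem ?_ ?_
    · rw [add_comm, zpow_add₀ H.q_ne_zero, mul_smul]
      exact smul_mem_of_mem_range Λ (H.q_zpow_mem (by omega)) hk
    · rw [zpow_add₀ H.q_ne_zero, mul_smul]
      exact smul_mem_of_mem_range Λ (H.q_zpow_mem (by omega)) hl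
  | smul c z _ hz =>
    obtain ⟨k, hk⟩ := hz
    rcases eq_or_ne c 0 with rfl | hc
    · exact ⟨0, by simp⟩
    obtain ⟨j, u, hu, -, -, rfl⟩ := H.exists_zpow_mul_unit hc
    refine ⟨k + j.natAbs, ?_⟩
    push_cast
    rw [smul_smul, show 𝓆 ^ ((k : ℤ) + |j|) * (𝓆 ^ j * u) = (𝓆 ^ (|j| + j) * u) * 𝓆 ^ (k : ℤ) by
      rw [zpow_add₀ H.q_ne_zero, zpow_add₀ H.q_ne_zero]; ring, mul_smul]
    refine smul_mem_of_mem_range Λ (mul_mem (H.q_zpow_mem ?_) hu) hk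
    have := neg_abs_le j
    omega

/-- Two lattices are commensurable. -/
theorem exists_zpow_smul_le (H : IsUnramifiedIntegers R σ ϖ) (Λ Λ' : Submodule R W)
    (hΛ : Λ.IsLattice F) (hΛ' : Λ'.IsLattice F) : ∃ k : ℕ, ∀ z ∈ Λ, 𝓆 ^ (k : ℤ) • z ∈ Λ' := by
  obtain ⟨s, hs⟩ := hΛ.fg
  choose k hk using exists_zpow_smul_mem H Λ' hΛ'
  refine ⟨s.sup k, fun z hz => ?_⟩
  rw [← hs] at hz
  induction hz using Submodule.span_induction with
  | mem z hz =>
    have h1 : k z ≤ s.sup k := Finset.le_sup hz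
    rw [show ((s.sup k : ℕ) : ℤ) = ((s.sup k : ℕ) - k z : ℤ) + k z by ring,
      zpow_add₀ H.q_ne_zero, mul_smul]
    exact smul_mem_of_mem_range Λ' (H.q_zpow_mem (by omega)) (hk z)
  | zero => simp
  | add z w _ _ hz hw => rw [smul_add]; exact add_mem hz hw
  | smul c z _ hz =>
    rw [← algebraMap_smul F c z, smul_comm]
    exact smul_mem_of_mem_range Λ' ⟨c, rfl⟩ hz

theorem isLatticePair_top {n : ℕ} {b : Module.Basis (Fin n) F W}
    (hb : IsAntidiagonal h b) (hherm : h.IsSymm) (H : IsUnramifiedIntegers R σ ϖ)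
    {L M : Submodule R W} (hL : L.IsLattice F) (hM : M.IsLattice F) (hLL : dualLattice h L = L)
    (hMM : M ≤ dualLattice h M) (hM' : ∀ x ∈ dualLattice h M, 𝓆 • x ∈ M) :
    IsLatticePair ϖ h ⊤ L M (dualLattice h M) where
  mem_left z := by
    conv_lhs => rw [← hLL]
    simp [dualLattice]
  mem_dual z := by simp [dualLattice]
  mem_right z := by
    conv_lhs => rw [← dualLattice_dualLattice hb hherm H M hM]
    simp [dualLattice]
  le := hMM
  smul_mem := hM'
  bound := by
    obtain ⟨a, ha⟩ := exists_zpow_smul_le H L M hL hM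
    refine ⟨a, fun z hz => ?_⟩
    rw [← hLL]
    intro w hw
    rw [form_zpow_smul_right, ← form_zpow_smul_left]
    exact hz _ (ha w hw)
  absorb z _ := exists_zpow_smul_mem H L hL z
  nondeg x _ hx := hb.eq_zero_of_form fun v => hx v trivial

end Lattice

theorem IsAntidiagonal.exists_isotropic {n : ℕ} {b : Module.Basis (Fin n) F W}
    (hb : IsAntidiagonal h b) : ∃ U : Submodule F W, (∀ u ∈ U, ∀ v ∈ U, h u v = 0) ∧
      n ≤ 2 * Module.finrank F U + 1 := by
  let f : Fin (n / 2) → Fin n := Fin.castLE (by omega)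
  have hf : Function.Injective f := Fin.castLE_injective _
  refine ⟨Submodule.span F (Set.range (b ∘ f)), fun u hu v hv => ?_, ?_⟩
  · induction hu using Submodule.span_induction with
    | mem u hu =>
      obtain ⟨i, rfl⟩ := hu
      induction hv using Submodule.span_induction with
      | mem v hv =>
        obtain ⟨j, rfl⟩ := hv
        rw [Function.comp_apply, Function.comp_apply, hb, if_neg]
        simp only [f, Fin.ext_iff, Fin.val_castLE, Fin.val_rev]
        omega
      | zero => simp
      | add v v' _ _ hv hv' => rw [map_add, hv, hv', add_zero]
      | smul c v _ hv => rw [map_smul, hv, smul_zero]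
    | zero => simp
    | add u u' _ _ hu hu' => rw [map_add, LinearMap.add_apply, hu, hu', add_zero]
    | smul c u _ hu => rw [form_smul_left, hu, mul_zero]
  · rw [finrank_span_eq_card (b.linearIndependent.comp f hf), Fintype.card_fin]
    omega

/-- If in some basis the Gram matrix is antidiagonal with entries `1` except for a central entry
`u`, then `u` is a norm: compare the determinants of the two Gram matrices. -/
theorem IsAntidiagonal.exists_norm_eq {n : ℕ} {b : Module.Basis (Fin n) F W}
    (hb : IsAntidiagonal h b) {e : Fin n → W} {u : F}
    (he : ∀ i j, h (e i) (e j) = if j = Fin.rev i then (if j = i then u else 1) else 0)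
    {i₀ : Fin n} (hi₀ : Fin.rev i₀ = i₀) : ∃ d : F, σ d * d = u := by
  let J : Matrix (Fin n) (Fin n) F := .of fun i j => if j = Fin.rev i then 1 else 0
  let D : Matrix (Fin n) (Fin n) F := .diagonal fun j => if j = i₀ then u else 1
  let P := b.toMatrix e
  have hJJ : J * J = 1 := by
    ext i j
    simp only [J, Matrix.mul_apply, Matrix.of_apply, Matrix.one_apply, ite_mul, one_mul, zero_mul]
    rw [Finset.sum_eq_single (Fin.rev i) (fun k _ hk => if_neg hk) (by simp), if_pos rfl,
      Fin.rev_rev]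
    simp [eq_comm]
  have hG : (P.map σ).transpose * J * P = J * D := by
    ext i j
    have h1 : ((P.map σ).transpose * J * P) i j = h (e i) (e j) := by
      conv_rhs => rw [← b.sum_repr (e i), ← b.sum_repr (e j)]
      simp only [Matrix.mul_apply, map_sum, LinearMap.sum_apply, form_smul_left, map_smul,
        smul_eq_mul, Matrix.transpose_apply, Matrix.map_apply, J, Matrix.of_apply, P,
        Module.Basis.toMatrix_apply, Finset.sum_mul, Finset.mul_sum]
      refine Finset.sum_congr rfl fun k _ => Finset.sum_congr rfl fun l _ => ?_
      rw [hb]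
      ring
    rw [h1, he, Matrix.mul_diagonal]
    simp only [J, Matrix.of_apply]
    have h2 : j = Fin.rev i → (j = i ↔ j = i₀) := by
      rintro rfl
      rw [Fin.ext_iff, Fin.ext_iff, Fin.val_rev]
      have := congrArg Fin.val hi₀
      rw [Fin.val_rev] at this
      omega
    by_cases h3 : j = Fin.rev i
    · simp only [if_pos h3, one_mul, h2 h3]
    · simp only [if_neg h3, zero_mul]
  have hdet := congrArg Matrix.det hG
  have hJ : J.det ≠ 0 := fun h0 => by
    have := congrArg Matrix.det hJJ
    simp [h0] at this
  have hD : D.det = u := by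
    simp only [D, Matrix.det_diagonal]
    rw [Finset.prod_ite_eq' Finset.univ i₀ fun _ => u]
    simp
  have hPσ : (P.map σ).det = σ P.det := (RingHom.map_det (σ : F →+* F) P).symm
  rw [Matrix.det_mul, Matrix.det_mul, Matrix.det_mul, Matrix.det_transpose, hD, hPσ] at hdet
  refine ⟨P.det, mul_left_cancel₀ hJ ?_⟩
  rw [← hdet]
  ring

variable [IsScalarTower R F W] [IsFractionRing R F] [IsDomain R] [IsDiscreteValuationRing R]

variable (ϖ) in
/-- The lattice spanned by the vectors `ϖ ^ μ i • b i`. -/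
def diagLattice (R : Type*) [CommRing R] [Module R W] {n : ℕ} (b : Module.Basis (Fin n) F W)
    (μ : Fin n → ℤ) : Submodule R W := Submodule.span R (Set.range fun i => 𝓆 ^ μ i • b i)

/-- Given a self-dual lattice `L` and a vertex lattice `M` in a split hermitian space, there is a
basis of `L` in which the form is antidiagonal and which, after scaling by powers of the
uniformizer, is a basis of `M`. -/
theorem IsAntidiagonal.exists_common_basis {n : ℕ} {b : Module.Basis (Fin n) F W}
    (hb : IsAntidiagonal h b) (hherm : h.IsSymm) (H : IsUnramifiedIntegers R σ ϖ)
    {L M : Submodule R W} (hL : L.IsLattice F) (hM : M.IsLattice F) (hLL : dualLattice h L = L)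
    (hMM : M ≤ dualLattice h M) (hM' : ∀ x ∈ dualLattice h M, 𝓆 • x ∈ M) :
    ∃ (c : Module.Basis (Fin n) F W) (μ : Fin n → ℤ), IsAntidiagonal h c ∧ Antitone μ ∧
      (∀ i, μ i + μ (Fin.rev i) = 0 ∨ μ i + μ (Fin.rev i) = 1) ∧
      Submodule.span R (Set.range c) = L ∧ diagLattice ϖ R c μ = M := by
  have : FiniteDimensional F W := b.finiteDimensional_of_finite
  have hfin : Module.finrank F W = n := by rw [Module.finrank_eq_card_basis b, Fintype.card_fin]
  obtain ⟨U, hU, hUn⟩ := hb.exists_isotropic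
  obtain ⟨e, μ, u, A⟩ := (isLatticePair_top hb hherm H hL hM hLL hMM hM').exists_isApartment H
    hherm n (by rw [finrank_top, hfin]) ⟨U, le_top, hU, hUn⟩
  obtain ⟨d, hd0, hd, hd', hdu⟩ : ∃ d : F, d ≠ 0 ∧ d ∈ 𝒪 ∧ d⁻¹ ∈ 𝒪 ∧
      ∀ i : Fin n, Fin.rev i = i → σ d * d = u := by
    by_cases hi : ∃ i : Fin n, Fin.rev i = i
    · obtain ⟨i, hi⟩ := hi
      obtain ⟨d, rfl⟩ := hb.exists_norm_eq A.gram hi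
      have hd0 : d ≠ 0 := right_ne_zero_of_mul A.unit_ne_zero
      obtain ⟨h1, h2⟩ := H.mem_and_inv_mem_of_norm hd0 A.unit_mem A.inv_mem
      exact ⟨d, hd0, h1, h2, fun _ _ => rfl⟩
    · exact ⟨1, one_ne_zero, one_mem _, by simp [one_mem], fun i hi' => absurd ⟨i, hi'⟩ hi⟩
  let w : Fin n → F := fun i => if Fin.rev i = i then d⁻¹ else 1
  have hw0 : ∀ i, w i ≠ 0 := fun i => by
    simp only [w]; split_ifs <;> simp [hd0]
  have hw : ∀ i, w i ∈ 𝒪 := fun i => by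
    simp only [w]; split_ifs
    exacts [hd', one_mem _]
  have hw' : ∀ i, (w i)⁻¹ ∈ 𝒪 := fun i => by
    simp only [w]; split_ifs
    · rwa [inv_inv]
    · simp [one_mem]
  have hgram : ∀ i j, h (w i • e i) (w j • e j) = if j = Fin.rev i then 1 else 0 := by
    intro i j
    rw [form_smul_left, map_smul, smul_eq_mul, A.gram]
    by_cases hij : j = Fin.rev i
    · subst hij
      by_cases hi : Fin.rev i = i
      · have := hdu i hi
        have hσd : σ d ≠ 0 := by simpa using hd0
        simp only [w, hi, if_true, map_inv₀, ← this]
        field_simp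
      · simp [w, hi, Ne.symm hi]
    · simp [hij]
  have hli : LinearIndependent F fun i => w i • e i := by
    rw [Fintype.linearIndependent_iff]
    intro g hg i
    have h1 := congrArg (h (w (Fin.rev i) • e (Fin.rev i))) hg
    simp only [map_sum, map_zero] at h1
    rw [Finset.sum_eq_single i] at h1
    · rw [map_smul, hgram, Fin.rev_rev, if_pos rfl, smul_eq_mul, mul_one] at h1
      exact h1
    · intro j _ hj
      rw [map_smul, hgram, Fin.rev_rev, if_neg hj, smul_zero]
    · simp
  let c : Module.Basis (Fin n) F W := basisOfLinearIndependentOfCardEqFinrank' _ hli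
    (by rw [Fintype.card_fin, hfin])
  have hc : ⇑c = fun i => w i • e i := coe_basisOfLinearIndependentOfCardEqFinrank' _ _ _
  refine ⟨c, μ, ?_, A.antitone, A.exponent, ?_, ?_⟩
  · intro i j
    rw [hc]
    exact hgram i j
  · rw [hc, span_smul_of_units e w hw0 hw hw', ← A.span_left]
  · rw [diagLattice, hc, A.span_right,
      ← span_smul_of_units (fun i => 𝓆 ^ μ i • e i) w hw0 hw hw']
    simp only [smul_smul, mul_comm]

end AdaptedBasis

/-! ### Diagonal lattices -/

section DiagLattice

variable {F₀ F R W : Type*} [Field F₀] [Field F] [Algebra F₀ F] [CommRing R] [Algebra R F]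
  {σ : F ≃ₐ[F₀] F} {ϖ : F₀} [AddCommGroup W] [Module F W] [Module R W]
  {h : W →ₛₗ[(σ : F →+* F)] W →ₗ[F] F}

local notation "𝒪" => RingHom.range (algebraMap R F)
local notation "𝓆" => algebraMap F₀ F ϖ

variable {n : ℕ} {b c : Module.Basis (Fin n) F W}

/-- The basis `ϖ ^ μ i • b i`. -/
def scaleBasis (hq : 𝓆 ≠ 0) (b : Module.Basis (Fin n) F W) (μ : Fin n → ℤ) :
    Module.Basis (Fin n) F W := b.unitsSMul fun i => Units.mk0 𝓆 hq ^ μ i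

theorem scaleBasis_apply (hq : 𝓆 ≠ 0) (b : Module.Basis (Fin n) F W) (μ : Fin n → ℤ)
    (i : Fin n) : scaleBasis hq b μ i = 𝓆 ^ μ i • b i := by
  simp [scaleBasis, Module.Basis.unitsSMul_apply, Units.smul_def]

theorem scaleBasis_repr (hq : 𝓆 ≠ 0) (b : Module.Basis (Fin n) F W) (μ : Fin n → ℤ)
    (x : W) (i : Fin n) : (scaleBasis hq b μ).repr x i = 𝓆 ^ (-μ i) * b.repr x i := by
  simp [scaleBasis, Module.Basis.repr_unitsSMul, Units.smul_def]

theorem isAntidiagonal_scaleBasis (hq : 𝓆 ≠ 0) (hb : IsAntidiagonal h b) {ν : Fin n → ℤ}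
    (hν : ∀ i, ν (Fin.rev i) = -ν i) : IsAntidiagonal h (scaleBasis hq b ν) := by
  intro i j
  rw [scaleBasis_apply, scaleBasis_apply, form_zpow_smul_left, form_zpow_smul_right, hb]
  split_ifs with hij
  · rw [hij, hν, mul_one, ← zpow_add₀ hq, add_neg_cancel, zpow_zero]
  · simp

theorem isAntidiagonal_reindex (hb : IsAntidiagonal h b) {τ : Equiv.Perm (Fin n)}
    (hτ : ∀ i, τ (Fin.rev i) = Fin.rev (τ i)) : IsAntidiagonal h (b.reindex τ.symm) := by
  intro i j
  rw [Module.Basis.reindex_apply, Module.Basis.reindex_apply, Equiv.symm_symm, hb, ← hτ]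
  simp only [τ.injective.eq_iff]

theorem IsAntidiagonal.form_basis (hb : IsAntidiagonal h b) (i : Fin n) (x : W) :
    h (b i) x = b.repr x (Fin.rev i) := by
  conv_lhs => rw [← b.sum_repr x]
  rw [map_sum, Finset.sum_eq_single (Fin.rev i)]
  · rw [map_smul, hb, if_pos rfl, smul_eq_mul, mul_one]
  · intro j _ hj
    rw [map_smul, hb, if_neg hj, smul_zero]
  · simp

variable [IsScalarTower R F W] [IsFractionRing R F] [IsDomain R] [IsDiscreteValuationRing R]

theorem mem_diagLattice (hq : 𝓆 ≠ 0) {μ : Fin n → ℤ} {x : W} :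
    x ∈ diagLattice ϖ R b μ ↔ ∀ i, 𝓆 ^ (-μ i) * b.repr x i ∈ 𝒪 := by
  have h1 : diagLattice ϖ R b μ = Submodule.span R (Set.range (scaleBasis hq b μ)) := by
    rw [diagLattice]
    congr 2
    funext i
    rw [scaleBasis_apply]
  rw [h1, Module.Basis.mem_span_iff_repr_mem]
  exact forall_congr' fun i => by rw [scaleBasis_repr]; rfl

theorem span_eq_diagLattice : Submodule.span R (Set.range b) = diagLattice ϖ R b 0 := by
  simp [diagLattice]

theorem zpow_smul_mem_diagLattice {μ : Fin n → ℤ} (i : Fin n) :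
    𝓆 ^ μ i • b i ∈ diagLattice ϖ R b μ := Submodule.subset_span ⟨i, rfl⟩

theorem diagLattice_isLattice (hq : 𝓆 ≠ 0) (μ : Fin n → ℤ) :
    (diagLattice ϖ R b μ).IsLattice F where
  fg := Submodule.fg_span (Set.finite_range _)
  span_eq_top := by
    rw [diagLattice, Submodule.span_span_of_tower, ← (scaleBasis hq b μ).span_eq]
    congr 2
    funext i
    rw [scaleBasis_apply]

theorem zpow_smul_mem_diagLattice_iff (H : IsUnramifiedIntegers R σ ϖ) {μ : Fin n → ℤ}
    {i : Fin n} {k : ℤ} : 𝓆 ^ k • b i ∈ diagLattice ϖ R b μ ↔ μ i ≤ k := by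
  rw [mem_diagLattice H.q_ne_zero]
  constructor
  · intro h1
    have h2 := h1 i
    rw [map_smul, Finsupp.smul_apply, b.repr_self, Finsupp.single_eq_same, smul_eq_mul, mul_one,
      ← zpow_add₀ H.q_ne_zero, H.q_zpow_mem_iff] at h2
    omega
  · intro hk j
    rw [map_smul, Finsupp.smul_apply, b.repr_self, Finsupp.single_apply]
    split_ifs with hij
    · subst hij
      rw [smul_eq_mul, mul_one, ← zpow_add₀ H.q_ne_zero]
      exact H.q_zpow_mem (by omega)
    · simp

theorem diagLattice_le_iff (H : IsUnramifiedIntegers R σ ϖ) {μ μ' : Fin n → ℤ} :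
    diagLattice ϖ R b μ ≤ diagLattice ϖ R b μ' ↔ μ' ≤ μ := by
  constructor
  · exact fun hle i => (zpow_smul_mem_diagLattice_iff H).1 (hle (zpow_smul_mem_diagLattice i))
  · intro hle
    rw [diagLattice, Submodule.span_le]
    rintro _ ⟨i, rfl⟩
    exact (zpow_smul_mem_diagLattice_iff H).2 (hle i)

theorem diagLattice_injective (H : IsUnramifiedIntegers R σ ϖ) {μ μ' : Fin n → ℤ}
    (he : diagLattice ϖ R b μ = diagLattice ϖ R b μ') : μ = μ' :=
  le_antisymm ((diagLattice_le_iff H).1 he.ge) ((diagLattice_le_iff H).1 he.le)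

theorem diagLattice_inf (H : IsUnramifiedIntegers R σ ϖ) (μ μ' : Fin n → ℤ) :
    diagLattice ϖ R b μ ⊓ diagLattice ϖ R b μ' = diagLattice ϖ R b (μ ⊔ μ') := by
  refine le_antisymm (fun x hx => ?_) (le_inf ((diagLattice_le_iff H).2 le_sup_left)
    ((diagLattice_le_iff H).2 le_sup_right))
  rw [Submodule.mem_inf, mem_diagLattice H.q_ne_zero, mem_diagLattice H.q_ne_zero] at hx
  rw [mem_diagLattice H.q_ne_zero]
  intro i
  rcases le_total (μ i) (μ' i) with h1 | h1
  · rw [Pi.sup_apply, sup_eq_right.2 h1]; exact hx.2 i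
  · rw [Pi.sup_apply, sup_eq_left.2 h1]; exact hx.1 i

theorem dualLattice_diagLattice (H : IsUnramifiedIntegers R σ ϖ) (hb : IsAntidiagonal h b)
    (μ : Fin n → ℤ) :
    dualLattice h (diagLattice ϖ R b μ) = diagLattice ϖ R b fun i => -μ (Fin.rev i) := by
  have hq := H.q_ne_zero
  ext x
  rw [mem_diagLattice hq]
  constructor
  · intro hx i
    have h1 := hx _ (zpow_smul_mem_diagLattice (Fin.rev i))
    rwa [form_zpow_smul_left, hb.form_basis, Fin.rev_rev, ← neg_neg (μ (Fin.rev i))] at h1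
  · intro hx y hy
    induction hy using Submodule.span_induction with
    | mem y hy =>
      obtain ⟨i, rfl⟩ := hy
      change h (𝓆 ^ μ i • b i) x ∈ 𝒪
      rw [form_zpow_smul_left, hb.form_basis]
      simpa using hx (Fin.rev i)
    | zero => simp
    | add y y' _ _ hy hy' => rw [map_add, LinearMap.add_apply]; exact add_mem hy hy'
    | smul r y _ hy =>
      rw [← algebraMap_smul F r y, form_smul_left]
      exact mul_mem (H.map_mem r) hy

/-- The length of the quotient of diagonal lattices whose exponents differ by at most one is the
number of exponents that differ. -/
theorem length_diagLattice (H : IsUnramifiedIntegers R σ ϖ) {μ μ' : Fin n → ℤ}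
    (hle : ∀ i, μ i = μ' i ∨ μ i = μ' i + 1) :
    Module.length R (diagLattice ϖ R b μ' ⧸
      (diagLattice ϖ R b μ).submoduleOf (diagLattice ϖ R b μ')) =
      (Finset.univ.filter fun i => μ i = μ' i + 1).card := by
  have hq := H.q_ne_zero
  obtain ⟨π, hπ, hπq⟩ := H.uniformizer
  let B := scaleBasis hq b μ'
  have h1 : diagLattice ϖ R b μ' = Submodule.span R (Set.range B) := by
    rw [diagLattice]
    congr 2
    funext i
    rw [scaleBasis_apply]
  rw [h1]
  let S := {i : Fin n // μ i = μ' i + 1}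
  let f : Submodule.span R (Set.range B) →ₗ[R] (S → IsLocalRing.ResidueField R) :=
    LinearMap.pi fun i => (Algebra.linearMap R (IsLocalRing.ResidueField R)) ∘ₗ
      (B.restrictScalars R).coord i
  have hf : ∀ x i, f x i = IsLocalRing.residue R ((B.restrictScalars R).repr x i) :=
    fun x i => rfl
  have hsurj : Function.Surjective f := by
    intro y
    choose r hr using fun i => IsLocalRing.residue_surjective (y i)
    classical
    refine ⟨(B.restrictScalars R).equivFun.symm fun i => if hi : μ i = μ' i + 1 then r ⟨i, hi⟩
      else 0, ?_⟩
    funext i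
    rw [hf, ← Module.Basis.equivFun_apply, LinearEquiv.apply_symm_apply, dif_pos i.2, hr]
  have hker : LinearMap.ker f = (diagLattice ϖ R b μ).submoduleOf _ := by
    ext x
    rw [LinearMap.mem_ker, Submodule.submoduleOf, Submodule.mem_comap, Submodule.coe_subtype,
      mem_diagLattice hq]
    have h2 : ∀ i, 𝓆 ^ (-μ' i) * b.repr x i = algebraMap R F ((B.restrictScalars R).repr x i) := by
      intro i
      rw [Module.Basis.restrictScalars_repr_apply]
      exact (scaleBasis_repr hq b μ' x i).symm
    have h3 : ∀ i, IsLocalRing.residue R ((B.restrictScalars R).repr x i) = 0 ↔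
        𝓆⁻¹ * (𝓆 ^ (-μ' i) * b.repr x i) ∈ 𝒪 := by
      intro i
      rw [IsLocalRing.residue_eq_zero_iff, hπ.maximalIdeal_eq, Ideal.mem_span_singleton, h2, ← hπq]
      rw [← hπq] at hq
      constructor
      · rintro ⟨s, hs⟩
        exact ⟨s, by rw [hs, map_mul, inv_mul_cancel_left₀ hq]⟩
      · rintro ⟨s, hs⟩
        exact ⟨s, FaithfulSMul.algebraMap_injective R F
          (by rw [map_mul, hs, mul_inv_cancel_left₀ hq])⟩
    have h4 : ∀ i, μ i = μ' i + 1 →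
        𝓆 ^ (-μ i) * b.repr x i = 𝓆⁻¹ * (𝓆 ^ (-μ' i) * b.repr x i) := by
      intro i hi
      rw [hi, ← mul_assoc, ← zpow_neg_one, ← zpow_add₀ hq]
      congr 2
      ring
    constructor
    · intro hx i
      rcases hle i with hi | hi
      · rw [hi, h2]; exact ⟨_, rfl⟩
      · rw [h4 i hi, ← h3, ← hf x ⟨i, hi⟩, hx]; rfl
    · intro hx
      funext i
      rw [hf, Pi.zero_apply, h3, ← h4 i i.2]
      exact hx i
  have hlen : Module.length R (IsLocalRing.ResidueField R) = 1 :=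
    Module.length_eq_one_iff.2
      (isSimpleModule_iff_isCoatom.2 (IsLocalRing.maximalIdeal.isMaximal R).out)
  rw [← hker, (f.quotKerEquivOfSurjective hsurj).length_eq, Module.length_pi, hlen, mul_one,
    ENat.card_eq_coe_fintype_card, Fintype.card_subtype]

end DiagLattice

/-- Two submodules `P ≤ P'` of the same finite colength are equal. -/
theorem eq_of_length_quotient_eq {R X : Type*} [Ring R] [AddCommGroup X] [Module R X]
    {P P' : Submodule R X} (hle : P ≤ P')
    (hfin : Module.length R (X ⧸ P) ≠ ⊤)
    (heq : Module.length R (X ⧸ P) = Module.length R (X ⧸ P')) : P = P' := by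
  let f : (X ⧸ P) →ₗ[R] (X ⧸ P') := Submodule.factor hle
  have hsurj : Function.Surjective f := Submodule.factor_surjective hle
  have h1 := Module.length_eq_add_of_exact (LinearMap.ker f).subtype f
    (Submodule.subtype_injective _) hsurj (LinearMap.exact_subtype_ker_map f)
  rw [← heq] at h1
  have h2 : Module.length R (LinearMap.ker f) = 0 := by
    have h3 : (0 : ℕ∞) + Module.length R (X ⧸ P) =
        Module.length R (LinearMap.ker f) + Module.length R (X ⧸ P) := by rw [zero_add]; exact h1
    exact ((ENat.add_left_injective_of_ne_top hfin) h3).symm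
  rw [Module.length_eq_zero_iff, Submodule.subsingleton_iff_eq_bot] at h2
  refine le_antisymm hle fun x hx => ?_
  have h3 : (Submodule.Quotient.mk x : X ⧸ P) ∈ LinearMap.ker f := by
    rw [LinearMap.mem_ker]
    exact (Submodule.Quotient.mk_eq_zero P').2 hx
  rw [h2, Submodule.mem_bot, Submodule.Quotient.mk_eq_zero] at h3
  exact h3

/-! ### The Cartan decomposition -/

section Cartan

variable {F₀ F R W : Type*} [Field F₀] [Field F] [Algebra F₀ F] [CommRing R] [Algebra R F]
  {σ : F ≃ₐ[F₀] F} {ϖ : F₀} [AddCommGroup W] [Module F W] [Module R W]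
  {h : W →ₛₗ[(σ : F →+* F)] W →ₗ[F] F}

local notation "𝒪" => RingHom.range (algebraMap R F)
local notation "𝓆" => algebraMap F₀ F ϖ

variable {n : ℕ} {b c : Module.Basis (Fin n) F W}

/-- The unitary transformation carrying one antidiagonal basis to another. -/
def transport (hb : IsAntidiagonal h b) (hc : IsAntidiagonal h c) : unitaryGroup h :=
  ⟨b.equiv c (Equiv.refl _), fun x y => by
    conv_rhs => rw [← b.sum_repr x, ← b.sum_repr y]
    conv_lhs => rw [← b.sum_repr x, ← b.sum_repr y]
    simp only [map_sum, LinearMap.sum_apply, LinearMap.map_smulₛₗ, LinearMap.smul_apply, map_smul,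
      Module.Basis.equiv_apply, Equiv.refl_apply, hb _ _, hc _ _]⟩

theorem transport_apply (hb : IsAntidiagonal h b) (hc : IsAntidiagonal h c) (i : Fin n) :
    (transport hb hc : W ≃ₗ[F] W) (b i) = c i := by
  simp [transport]

theorem unitaryGroup_ext (b : Module.Basis (Fin n) F W) {g g' : unitaryGroup h}
    (hg : ∀ i, (g : W ≃ₗ[F] W) (b i) = (g' : W ≃ₗ[F] W) (b i)) : g = g' :=
  Subtype.ext (LinearEquiv.toLinearMap_injective (b.ext hg))

variable [IsScalarTower R F W]

/-- The image of a lattice under a unitary transformation. -/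
def latticeMap (g : unitaryGroup h) (Λ : Submodule R W) : Submodule R W :=
  Λ.map ((g : W ≃ₗ[F] W).toLinearMap.restrictScalars R)

theorem apply_mem_latticeMap (g : unitaryGroup h) (Λ : Submodule R W) {x : W} :
    (g : W ≃ₗ[F] W) x ∈ latticeMap g Λ ↔ x ∈ Λ := by
  constructor
  · rintro ⟨y, hy, hxy⟩
    have : y = x := (g : W ≃ₗ[F] W).injective hxy
    rwa [← this]
  · exact fun hx => ⟨x, hx, rfl⟩

theorem mem_latticeMap_iff (g : unitaryGroup h) (Λ : Submodule R W) {x : W} :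
    x ∈ latticeMap g Λ ↔ ((g⁻¹ : unitaryGroup h) : W ≃ₗ[F] W) x ∈ Λ := by
  rw [← apply_mem_latticeMap g (Λ := Λ) (x := ((g⁻¹ : unitaryGroup h) : W ≃ₗ[F] W) x)]
  have : (g : W ≃ₗ[F] W) (((g⁻¹ : unitaryGroup h) : W ≃ₗ[F] W) x) = x :=
    LinearEquiv.apply_symm_apply (g : W ≃ₗ[F] W) x
  rw [this]

theorem latticeMap_mul (g g' : unitaryGroup h) (Λ : Submodule R W) :
    latticeMap (g * g') Λ = latticeMap g (latticeMap g' Λ) := by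
  rw [latticeMap, latticeMap, latticeMap, ← Submodule.map_comp]
  rfl

theorem latticeMap_one (Λ : Submodule R W) : latticeMap (1 : unitaryGroup h) Λ = Λ :=
  Submodule.map_id _

theorem latticeMap_le_latticeMap (g : unitaryGroup h) {Λ Λ' : Submodule R W} :
    latticeMap g Λ ≤ latticeMap g Λ' ↔ Λ ≤ Λ' :=
  ⟨fun hle _ hx => (apply_mem_latticeMap g Λ').1 (hle ((apply_mem_latticeMap g Λ).2 hx)),
    fun hle => Submodule.map_mono hle⟩

theorem latticeMap_injective (g : unitaryGroup h) :
    Function.Injective (latticeMap (R := R) g) := fun _ _ he =>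
  le_antisymm ((latticeMap_le_latticeMap g).1 he.le) ((latticeMap_le_latticeMap g).1 he.ge)

theorem mem_latticeStabilizer_iff {g : unitaryGroup h} {Λ : Submodule R W} :
    g ∈ latticeStabilizer h Λ ↔ latticeMap g Λ = Λ := by
  constructor
  · intro hg
    ext x
    rw [mem_latticeMap_iff]
    exact (latticeStabilizer h Λ).inv_mem hg x
  · intro hg x
    conv_lhs => rw [← hg]
    exact apply_mem_latticeMap g Λ

theorem latticeMap_eq_iff {g g' : unitaryGroup h} {Λ : Submodule R W} :
    latticeMap g Λ = latticeMap g' Λ ↔ g⁻¹ * g' ∈ latticeStabilizer h Λ := by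
  rw [mem_latticeStabilizer_iff, ← (latticeMap_injective g).eq_iff (a := latticeMap (g⁻¹ * g') Λ),
    ← latticeMap_mul, mul_inv_cancel_left, eq_comm]

theorem latticeMap_isLattice (g : unitaryGroup h) {Λ : Submodule R W} (hΛ : Λ.IsLattice F) :
    (latticeMap g Λ).IsLattice F where
  fg := hΛ.fg.map _
  span_eq_top := by
    have h1 : ((latticeMap g Λ : Submodule R W) : Set W) =
        (g : W ≃ₗ[F] W).toLinearMap '' (Λ : Set W) := rfl
    rw [h1, Submodule.span_image, hΛ.span_eq_top, Submodule.map_top, LinearEquiv.range]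

theorem dualLattice_latticeMap (g : unitaryGroup h) (Λ : Submodule R W) :
    dualLattice h (latticeMap g Λ) = latticeMap g (dualLattice h Λ) := by
  ext x
  rw [mem_latticeMap_iff]
  have hg : ∀ y, h ((g : W ≃ₗ[F] W) y) x =
      h y (((g⁻¹ : unitaryGroup h) : W ≃ₗ[F] W) x) := fun y => by
    rw [← g.2 y]
    congr 1
    exact (LinearEquiv.apply_symm_apply (g : W ≃ₗ[F] W) x).symm
  constructor
  · intro hx y hy
    rw [← hg]
    exact hx _ ((apply_mem_latticeMap g Λ).2 hy)
  · rintro hx _ ⟨y, hy, rfl⟩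
    have h1 := hx y hy
    rwa [← hg] at h1

theorem latticeMap_diagLattice {g : unitaryGroup h}
    (hg : ∀ i, (g : W ≃ₗ[F] W) (b i) = c i) (μ : Fin n → ℤ) :
    latticeMap g (diagLattice ϖ R b μ) = diagLattice ϖ R c μ := by
  rw [latticeMap, diagLattice, Submodule.map_span, ← Set.range_comp, diagLattice]
  congr 2
  funext i
  simp [hg]

variable [IsFractionRing R F] [IsDomain R] [IsDiscreteValuationRing R]

/-- The diagonal unitary transformation `b i ↦ ϖ ^ ν i • b i`. -/
def diagElt (hq : 𝓆 ≠ 0) (hb : IsAntidiagonal h b) {ν : Fin n → ℤ}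
    (hν : ∀ i, ν (Fin.rev i) = -ν i) : unitaryGroup h :=
  transport hb (isAntidiagonal_scaleBasis hq hb hν)

theorem diagElt_apply (hq : 𝓆 ≠ 0) (hb : IsAntidiagonal h b) {ν : Fin n → ℤ}
    (hν : ∀ i, ν (Fin.rev i) = -ν i) (i : Fin n) :
    (diagElt hq hb hν : W ≃ₗ[F] W) (b i) = 𝓆 ^ ν i • b i := by
  rw [diagElt, transport_apply, scaleBasis_apply]

theorem diagElt_mul (hq : 𝓆 ≠ 0) (hb : IsAntidiagonal h b) {ν ν' ν'' : Fin n → ℤ}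
    (hν : ∀ i, ν (Fin.rev i) = -ν i) (hν' : ∀ i, ν' (Fin.rev i) = -ν' i)
    (hν'' : ∀ i, ν'' (Fin.rev i) = -ν'' i) (hadd : ∀ i, ν'' i = ν i + ν' i) :
    diagElt hq hb hν * diagElt hq hb hν' = diagElt hq hb hν'' := by
  refine unitaryGroup_ext b fun i => ?_
  change (diagElt hq hb hν : W ≃ₗ[F] W) ((diagElt hq hb hν' : W ≃ₗ[F] W) (b i)) = _
  rw [diagElt_apply, map_smul, diagElt_apply, diagElt_apply, smul_smul, ← zpow_add₀ hq, hadd,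
    add_comm]

theorem latticeMap_diagElt (hq : 𝓆 ≠ 0) (hb : IsAntidiagonal h b) {ν : Fin n → ℤ}
    (hν : ∀ i, ν (Fin.rev i) = -ν i) (μ : Fin n → ℤ) :
    latticeMap (diagElt hq hb hν) (diagLattice ϖ R b μ) =
      diagLattice ϖ R b fun i => μ i + ν i := by
  rw [diagElt, latticeMap_diagLattice (transport_apply _ _), diagLattice, diagLattice]
  congr 2
  funext i
  rw [scaleBasis_apply, smul_smul, ← zpow_add₀ hq]

/-- Two antidiagonal bases of the same lattice differ by an element of the stabilizer. -/
theorem transport_mem (hb : IsAntidiagonal h b) (hc : IsAntidiagonal h c)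
    (hbc : Submodule.span R (Set.range b) = Submodule.span R (Set.range c)) :
    transport hb hc ∈ latticeStabilizer h (Submodule.span R (Set.range b)) := by
  rw [mem_latticeStabilizer_iff]
  conv_rhs => rw [hbc]
  have := latticeMap_diagLattice (ϖ := (1 : F₀)) (R := R) (transport_apply hb hc) 0
  simpa [diagLattice] using this

/-- The Cartan decomposition: a common basis of the self-dual lattices `L` and `g L` describes `g`
up to the stabilizer of `L` on both sides. -/
theorem exists_cartan (H : IsUnramifiedIntegers R σ ϖ) (hherm : h.IsSymm)
    (hb : IsAntidiagonal h b) (g : unitaryGroup h) :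
    ∃ (ν : Fin n → ℤ) (hν : ∀ i, ν (Fin.rev i) = -ν i), Antitone ν ∧
      ∃ k ∈ latticeStabilizer h (Submodule.span R (Set.range b)),
      ∃ k' ∈ latticeStabilizer h (Submodule.span R (Set.range b)),
        g = k * diagElt H.q_ne_zero hb hν * k' := by
  have hq := H.q_ne_zero
  set L := Submodule.span R (Set.range b) with hLdef
  have hL0 : L = diagLattice ϖ R b 0 := span_eq_diagLattice
  have hL : L.IsLattice F := by rw [hL0]; exact diagLattice_isLattice hq 0
  have hLL : dualLattice h L = L := by
    rw [hL0, dualLattice_diagLattice H hb]; congr 1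
  have hM : dualLattice h (latticeMap g L) = latticeMap g L := by
    rw [dualLattice_latticeMap, hLL]
  -- `g L` is self-dual, hence in particular a vertex lattice
  obtain ⟨c, μ, hc, hμ, hexp, hcL, hcM⟩ := hb.exists_common_basis hherm H hL
    (latticeMap_isLattice g hL) hLL hM.ge
    (fun x hx => by rw [hM] at hx; exact smul_mem_of_mem_range _ H.q_mem hx)
  have hν : ∀ i, μ (Fin.rev i) = -μ i := by
    rw [← hcM, dualLattice_diagLattice H hc] at hM
    intro i
    have := congrFun (diagLattice_injective H hM) i
    omega
  refine ⟨μ, hν, hμ, transport hb hc, transport_mem hb hc hcL.symm,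
    (transport hb hc * diagElt hq hb hν)⁻¹ * g, ?_, ?_⟩
  · rw [← latticeMap_eq_iff, latticeMap_mul, hL0, latticeMap_diagElt,
      latticeMap_diagLattice (transport_apply hb hc), ← hL0, ← hcM]
    simp
  · rw [mul_inv_cancel_left]

/-- The stabilizer of a self-dual lattice acts transitively on the vertex lattices of type `2 * s`
that it contains: such a lattice is spanned by `ϖ • c i` for `i < s` and `c i` for `i ≥ s` in a
suitable antidiagonal basis `c` of the self-dual lattice. -/
theorem IsVertexLattice.exists_basis (H : IsUnramifiedIntegers R σ ϖ) (hherm : h.IsSymm)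
    (hb : IsAntidiagonal h b) {L M : Submodule R W} {s : ℕ} (hL : L.IsLattice F)
    (hLL : dualLattice h L = L) (hM : IsVertexLattice h ϖ (2 * s) M) (hML : M ≤ L) :
    ∃ c : Module.Basis (Fin n) F W, IsAntidiagonal h c ∧ Submodule.span R (Set.range c) = L ∧
      M = diagLattice ϖ R c fun i => if (i : ℕ) < s then 1 else 0 := by
  obtain ⟨c, μ, hc, hμ, hexp, hcL, hcM⟩ := hb.exists_common_basis hherm H hL hM.isLattice hLL
    hM.le_dual hM.smul_mem
  refine ⟨c, hc, hcL, ?_⟩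
  have hμ0 : ∀ i, 0 ≤ μ i := by
    rw [← hcL, ← hcM, span_eq_diagLattice (ϖ := ϖ), diagLattice_le_iff H] at hML
    exact hML
  have hlen := hM.type_eq
  rw [← hcM, dualLattice_diagLattice H hc, length_diagLattice H (fun i => by
    have := hexp i; omega)] at hlen
  have hlen' : (Finset.univ.filter fun i => μ i = -μ (Fin.rev i) + 1).card = 2 * s := by
    exact_mod_cast hlen
  -- each exponent `1` contributes the two indices `i` and `rev i` to the length
  have hcount : (Finset.univ.filter fun i => μ i = 1).card = s := by
    have h1 : (Finset.univ.filter fun i => μ i = -μ (Fin.rev i) + 1) =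
        (Finset.univ.filter fun i => μ i = 1) ∪
          (Finset.univ.filter fun i => μ (Fin.rev i) = 1) := by
      ext i
      simp only [Finset.mem_filter, Finset.mem_univ, true_and, Finset.mem_union]
      have h2 := hexp i
      have h3 := hμ0 i
      have h4 := hμ0 (Fin.rev i)
      omega
    have h2 : Disjoint (Finset.univ.filter fun i => μ i = 1)
        (Finset.univ.filter fun i => μ (Fin.rev i) = 1) := by
      rw [Finset.disjoint_filter]
      intro i _ h3 h4
      have := hexp i
      omega
    have h3 : (Finset.univ.filter fun i => μ (Fin.rev i) = 1).card =
        (Finset.univ.filter fun i => μ i = 1).card :=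
      Finset.card_bij (fun i _ => Fin.rev i) (by simp) (by simp)
        (fun i hi => ⟨Fin.rev i, by simpa using hi, by simp⟩)
    rw [h1, Finset.card_union_of_disjoint h2, h3] at hlen'
    omega
  rw [← hcM]
  congr 1
  funext i
  have h01 : ∀ j, μ j = 0 ∨ μ j = 1 := fun j => by
    have h2 := hexp j
    have h3 := hμ0 j
    have h4 := hμ0 (Fin.rev j)
    omega
  split_ifs with hi
  · by_contra hne
    have h1 : (Finset.univ.filter fun j => μ j = 1) ⊆ Finset.univ.filter fun j => j < i := by
      intro j hj
      simp only [Finset.mem_filter, Finset.mem_univ, true_and] at hj ⊢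
      by_contra! hij
      have := hμ hij
      have := h01 i
      omega
    have h2 := Finset.card_le_card h1
    rw [hcount, show (Finset.univ.filter fun j => j < i) = Finset.Iio i by ext; simp,
      Fin.card_Iio] at h2
    omega
  · by_contra hne
    have h1 : (Finset.univ.filter fun j => j ≤ i) ⊆ Finset.univ.filter fun j => μ j = 1 := by
      intro j hj
      simp only [Finset.mem_filter, Finset.mem_univ, true_and] at hj ⊢
      have := hμ hj
      have := h01 i
      have := h01 j
      omega
    have h2 := Finset.card_le_card h1
    rw [hcount, show (Finset.univ.filter fun j => j ≤ i) = Finset.Iic i by ext; simp,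
      Fin.card_Iic] at h2
    omega

end Cartan

/-! ### Dominant cocharacters and minors -/

section Cochar

/-- The dominant cocharacter `∑ α s • (1 ^ (s + 1), 0, (-1) ^ (s + 1))`. -/
def domCochar (n : ℕ) (α : Fin (n / 2) →₀ ℕ) (i : Fin n) : ℤ :=
  ∑ s, (α s : ℤ) * cochar n (s + 1) i

/-- The sum of the first `j` entries of `domCochar n α`, for `j ≤ n / 2`. These sums describe the
dominance order. -/
def partialSum {n : ℕ} (α : Fin (n / 2) →₀ ℕ) (j : ℕ) : ℕ := ∑ s, α s * min ((s : ℕ) + 1) j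

variable {n : ℕ}

theorem domCochar_rev (α : Fin (n / 2) →₀ ℕ) (i : Fin n) :
    domCochar n α (Fin.rev i) = -domCochar n α i := by
  rw [domCochar, domCochar, ← Finset.sum_neg_distrib]
  exact Finset.sum_congr rfl fun s _ => by rw [cochar_rev (by omega), mul_neg]

theorem domCochar_add (α β : Fin (n / 2) →₀ ℕ) (i : Fin n) :
    domCochar n (α + β) i = domCochar n α i + domCochar n β i := by
  simp only [domCochar, Finsupp.add_apply, Nat.cast_add, add_mul, Finset.sum_add_distrib]

theorem domCochar_zero (i : Fin n) : domCochar n 0 i = 0 := by simp [domCochar]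

theorem domCochar_single (s : Fin (n / 2)) :
    domCochar n (Finsupp.single s 1) = cochar n (s + 1) := by
  funext i
  rw [domCochar, Finset.sum_eq_single s]
  · simp
  · intro t _ hts
    simp [hts.symm]
  · simp

theorem partialSum_add (α β : Fin (n / 2) →₀ ℕ) (j : ℕ) :
    partialSum (α + β) j = partialSum α j + partialSum β j := by
  simp only [partialSum, Finsupp.add_apply, add_mul, Finset.sum_add_distrib]

theorem partialSum_zero (j : ℕ) : partialSum (0 : Fin (n / 2) →₀ ℕ) j = 0 := by simp [partialSum]

/-- The partial sums determine the cocharacter: the multiplicities are their second differences. -/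
theorem eq_of_partialSum_eq {α β : Fin (n / 2) →₀ ℕ}
    (hαβ : ∀ j ≤ n / 2, partialSum α j = partialSum β j) : α = β := by
  have hall : ∀ j, partialSum α j = partialSum β j := by
    intro j
    rcases le_total j (n / 2) with hj | hj
    · exact hαβ j hj
    · have h1 : ∀ γ : Fin (n / 2) →₀ ℕ, partialSum γ j = partialSum γ (n / 2) := fun γ =>
        Finset.sum_congr rfl fun s _ => by
          have := s.2
          rw [min_eq_left (by omega), min_eq_left (by omega)]
      rw [h1, h1, hαβ _ le_rfl]
  have key : ∀ (γ : Fin (n / 2) →₀ ℕ) (s : Fin (n / 2)),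
      2 * partialSum γ (s + 1) = partialSum γ s + partialSum γ (s + 2) + γ s := by
    intro γ s
    have h1 : γ s = ∑ t, γ t * (if t = s then 1 else 0) := by simp
    rw [h1]
    simp only [partialSum]
    rw [Finset.mul_sum, ← Finset.sum_add_distrib, ← Finset.sum_add_distrib]
    refine Finset.sum_congr rfl fun t _ => ?_
    have h2 : 2 * min ((t : ℕ) + 1) (s + 1) =
        min ((t : ℕ) + 1) s + min ((t : ℕ) + 1) (s + 2) + (if t = s then 1 else 0) := by
      split_ifs with hts
      · subst hts; omega
      · have : (t : ℕ) ≠ s := fun h => hts (Fin.ext h)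
        omega
    rw [← mul_add, ← mul_add, ← h2]
    ring
  ext s
  have h1 := key α s
  have h2 := key β s
  rw [hall, hall, hall] at h1
  omega

/-- The sum of any `j` distinct entries of `(1 ^ t, 0, (-1) ^ t)` is at least `-min t j`. -/
theorem neg_min_le_sum_cochar {j t : ℕ} {f : Fin j → Fin n} (hf : Function.Injective f) :
    -((min t j : ℕ) : ℤ) ≤ ∑ i, cochar n t (f i) := by
  have h1 : ∀ i, -(if n ≤ (f i : ℕ) + t then 1 else 0 : ℤ) ≤ cochar n t (f i) := fun i => by
    rw [cochar]
    split_ifs <;> simp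
  refine le_trans ?_ (Finset.sum_le_sum fun i _ => h1 i)
  rw [Finset.sum_neg_distrib, neg_le_neg_iff, Finset.sum_boole]
  norm_cast
  refine le_min ?_ ((Finset.card_le_univ _).trans (by simp))
  have h2 : ((Finset.univ.filter fun i => n ≤ (f i : ℕ) + t).image fun i => n - 1 - (f i : ℕ)) ⊆
      Finset.range t := by
    intro k hk
    obtain ⟨i, hi, rfl⟩ := Finset.mem_image.1 hk
    have := (Finset.mem_filter.1 hi).2
    have := (f i).2
    rw [Finset.mem_range]
    omega
  have h3 := Finset.card_le_card h2
  rwa [Finset.card_image_of_injective, Finset.card_range] at h3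
  intro i i' hii'
  have := (f i).2
  have := (f i').2
  exact hf (Fin.ext (by dsimp only at hii'; omega))

/-- The last `j` entries of a dominant cocharacter have the smallest sum. -/
theorem neg_partialSum_le (α : Fin (n / 2) →₀ ℕ) {j : ℕ} {f : Fin j → Fin n}
    (hf : Function.Injective f) : -(partialSum α j : ℤ) ≤ ∑ i, domCochar n α (f i) := by
  simp only [domCochar]
  rw [Finset.sum_comm, partialSum]
  push_cast
  rw [← Finset.sum_neg_distrib]
  refine Finset.sum_le_sum fun s _ => ?_
  rw [← Finset.mul_sum, ← mul_neg]
  exact mul_le_mul_of_nonneg_left (by exact_mod_cast neg_min_le_sum_cochar hf) (by positivity)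

theorem sum_domCochar_rev (α : Fin (n / 2) →₀ ℕ) {j : ℕ} (hj : j ≤ n / 2) :
    ∑ i : Fin j, domCochar n α (Fin.rev (Fin.castLE (hj.trans (Nat.div_le_self n 2)) i)) =
      -(partialSum α j : ℤ) := by
  simp only [domCochar_rev, Finset.sum_neg_distrib, neg_inj]
  simp only [domCochar]
  rw [Finset.sum_comm, partialSum]
  push_cast
  refine Finset.sum_congr rfl fun s _ => ?_
  rw [← Finset.mul_sum]
  congr 1
  have hs := s.2
  have h1 : ∀ i : Fin j, cochar n (s + 1) (Fin.castLE (hj.trans (Nat.div_le_self n 2)) i) =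
      if (i : ℕ) < s + 1 then 1 else 0 := by
    intro i
    have := i.2
    rw [cochar, Fin.val_castLE]
    split_ifs <;> first | rfl | omega
  simp only [h1]
  rw [Fin.sum_univ_eq_sum_range (fun i => if i < (s : ℕ) + 1 then (1 : ℤ) else 0) j,
    Finset.sum_boole]
  have h2 : (Finset.range j).filter (fun i => i < (s : ℕ) + 1) = Finset.range (min (s + 1) j) := by
    ext i
    simp only [Finset.mem_filter, Finset.mem_range]
    omega
  rw [h2, Finset.card_range]
  push_cast
  rfl

/-- Every dominant cocharacter is a combination of the fundamental ones. -/
theorem exists_domCochar_eq {ν : Fin n → ℤ} (hν : ∀ i, ν (Fin.rev i) = -ν i)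
    (hanti : Antitone ν) : ∃ α, domCochar n α = ν := by
  -- the value at `k` of the cocharacter, or zero if `k` is at least `n / 2`
  let v : ℕ → ℤ := fun k => if hk : k < n / 2 then ν ⟨k, by omega⟩ else 0
  have hpos : ∀ k : Fin n, (k : ℕ) < n / 2 → 0 ≤ ν k := by
    intro k hk
    have h1 : k ≤ Fin.rev k := by rw [Fin.le_def, Fin.val_rev]; omega
    have := hanti h1
    have := hν k
    omega
  have hv : ∀ k, v (k + 1) ≤ v k := by
    intro k
    simp only [v]
    split_ifs with h1 h2 h2
    · exact hanti (by rw [Fin.le_def]; simp)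
    · omega
    · exact hpos _ h2
    · exact le_rfl
  let α : Fin (n / 2) →₀ ℕ := Finsupp.equivFunOnFinite.symm fun s => (v s - v (s + 1)).toNat
  have hα : ∀ s, (α s : ℤ) = v s - v (s + 1) := fun s => by
    simp only [α, Finsupp.equivFunOnFinite_symm_apply_apply]
    rw [Int.toNat_of_nonneg]
    have := hv s
    omega
  have hsmall : ∀ i : Fin n, (i : ℕ) < n / 2 → domCochar n α i = ν i := by
    intro i hi
    have h1 : ∀ s : Fin (n / 2), (α s : ℤ) * cochar n (s + 1) i =
        if (i : ℕ) ≤ s then v s - v (s + 1) else 0 := by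
      intro s
      have := s.2
      rw [hα, cochar]
      split_ifs <;> omega
    rw [domCochar, Finset.sum_congr rfl fun s _ => h1 s,
      Fin.sum_univ_eq_sum_range (fun s => if (i : ℕ) ≤ s then v s - v (s + 1) else 0) (n / 2),
      ← Finset.sum_filter]
    have h2 : (Finset.range (n / 2)).filter (fun s => (i : ℕ) ≤ s) =
        Finset.Ico (i : ℕ) (n / 2) := by
      ext s
      simp only [Finset.mem_filter, Finset.mem_range, Finset.mem_Ico]
      omega
    rw [h2, Finset.sum_Ico_eq_sum_range]
    have h3 := Finset.sum_range_sub' (fun k => v (i + k)) (n / 2 - i)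
    simp only [← add_assoc, add_zero] at h3
    rw [h3, Nat.add_sub_cancel' hi.le]
    simp [v, hi]
  refine ⟨α, funext fun i => ?_⟩
  rcases lt_trichotomy (i : ℕ) (Fin.rev i : ℕ) with hi | hi | hi
  · rw [Fin.val_rev] at hi
    exact hsmall i (by omega)
  · have h1 : Fin.rev i = i := Fin.ext hi.symm
    have h2 := hν i
    have h3 := domCochar_rev α i
    rw [h1] at h2 h3
    omega
  · rw [Fin.val_rev] at hi
    have h1 := hsmall (Fin.rev i) (by rw [Fin.val_rev]; omega)
    rw [domCochar_rev, hν] at h1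
    omega

end Cochar

/-- Expansion of the determinant of a product of rectangular matrices along the rows. -/
theorem det_mul_eq_sum {A : Type*} [CommRing A] {j n : ℕ} (X : Matrix (Fin j) (Fin n) A)
    (Y : Matrix (Fin n) (Fin j) A) :
    (X * Y).det = ∑ f : Fin j → Fin n, (∏ i, X i (f i)) * (Y.submatrix f id).det := by
  have h1 : (X * Y).det = Matrix.detRowAlternating.toMultilinearMap
      (fun i => ∑ k, X i k • Y k) := by
    congr 1
    ext i l
    simp [Matrix.mul_apply]
  rw [h1, MultilinearMap.map_sum]
  refine Finset.sum_congr rfl fun f _ => ?_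
  rw [MultilinearMap.map_smul_univ Matrix.detRowAlternating.toMultilinearMap
    (fun i => X i (f i)) (fun i => Y (f i)), smul_eq_mul]
  rfl

theorem prod_zpow_eq {A ι : Type*} [Field A] {q : A} (hq : q ≠ 0) (s : Finset ι) (e : ι → ℤ) :
    ∏ i ∈ s, q ^ e i = q ^ ∑ i ∈ s, e i := by
  classical
  induction s using Finset.induction_on with
  | empty => simp
  | insert i s hi ih => rw [Finset.prod_insert hi, Finset.sum_insert hi, ih, zpow_add₀ hq]

section Minors

variable {F₀ F R W : Type*} [Field F₀] [Field F] [Algebra F₀ F] [CommRing R] [Algebra R F]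
  {σ : F ≃ₐ[F₀] F} {ϖ : F₀} [AddCommGroup W] [Module F W] [Module R W]
  {h : W →ₛₗ[(σ : F →+* F)] W →ₗ[F] F}

local notation "𝒪" => RingHom.range (algebraMap R F)
local notation "𝓆" => algebraMap F₀ F ϖ

variable {n : ℕ} {b c : Module.Basis (Fin n) F W}

theorem det_mem {j : ℕ} {X : Matrix (Fin j) (Fin j) F} (hX : ∀ i k, X i k ∈ 𝒪) :
    X.det ∈ 𝒪 := by
  rw [Matrix.det_apply]
  exact sum_mem fun τ _ => by
    rw [Units.smul_def]
    exact zsmul_mem (prod_mem fun i _ => hX _ _) _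

variable [IsScalarTower R F W] [IsFractionRing R F] [IsDomain R] [IsDiscreteValuationRing R]

/-- Multiplication by an integral matrix and a diagonal matrix `ϖ ^ ν`, `ν` dominant, lowers the
valuation of the minors of size `j` by at most the sum of the first `j` entries of `ν`. -/
theorem zpow_mul_det_mem (H : IsUnramifiedIntegers R σ ϖ) (α : Fin (n / 2) →₀ ℕ) {j : ℕ}
    {X : Matrix (Fin j) (Fin n) F} (hX : ∀ i k, X i k ∈ 𝒪) {Y : Matrix (Fin n) (Fin j) F} {e : ℤ}
    (hY : ∀ f : Fin j → Fin n, 𝓆 ^ e * (Y.submatrix f id).det ∈ 𝒪) :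
    𝓆 ^ (e + partialSum α j) *
      (X * (Matrix.diagonal (fun i => 𝓆 ^ domCochar n α i) * Y)).det ∈ 𝒪 := by
  have hq := H.q_ne_zero
  rw [← Matrix.mul_assoc, det_mul_eq_sum, Finset.mul_sum]
  refine sum_mem fun f _ => ?_
  by_cases hf : Function.Injective f
  · have h1 : ∏ i, (X * Matrix.diagonal fun i => 𝓆 ^ domCochar n α i) i (f i) =
        (∏ i, X i (f i)) * 𝓆 ^ ∑ i, domCochar n α (f i) := by
      simp only [Matrix.mul_diagonal, Finset.prod_mul_distrib]
      rw [prod_zpow_eq hq]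
    rw [h1, zpow_add₀ hq, show ∀ a b c d e : F, a * b * (c * d * e) = c * ((b * d) * (a * e)) by
      intros; ring, ← zpow_add₀ hq]
    refine mul_mem (prod_mem fun i _ => hX _ _) (mul_mem (H.q_zpow_mem ?_) (hY f))
    have := neg_partialSum_le α hf
    omega
  · obtain ⟨i, i', hii', hne⟩ : ∃ i i', f i = f i' ∧ i ≠ i' := by
      simpa [Function.Injective] using hf
    rw [Matrix.det_zero_of_row_eq hne (by funext l; simp [hii']), mul_zero, mul_zero]
    exact zero_mem _

/-- The diagonal element attached to a dominant cocharacter. -/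
def domElt (hq : 𝓆 ≠ 0) (hb : IsAntidiagonal h b) (α : Fin (n / 2) →₀ ℕ) : unitaryGroup h :=
  diagElt hq hb (domCochar_rev α)

theorem domElt_add (hq : 𝓆 ≠ 0) (hb : IsAntidiagonal h b) (α β : Fin (n / 2) →₀ ℕ) :
    domElt hq hb α * domElt hq hb β = domElt hq hb (α + β) :=
  diagElt_mul hq hb _ _ _ (domCochar_add α β)

/-- The matrix of a unitary transformation. -/
def matrixOf (b : Module.Basis (Fin n) F W) (g : unitaryGroup h) : Matrix (Fin n) (Fin n) F :=
  LinearMap.toMatrix b b (g : W ≃ₗ[F] W).toLinearMap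

theorem matrixOf_mul (g g' : unitaryGroup h) :
    matrixOf b (g * g') = matrixOf b g * matrixOf b g' :=
  LinearMap.toMatrix_mul b (g : W ≃ₗ[F] W).toLinearMap (g' : W ≃ₗ[F] W).toLinearMap

theorem matrixOf_domElt (hq : 𝓆 ≠ 0) (hb : IsAntidiagonal h b) (α : Fin (n / 2) →₀ ℕ) :
    matrixOf b (domElt hq hb α) = Matrix.diagonal fun i => 𝓆 ^ domCochar n α i := by
  ext i k
  rw [matrixOf, LinearMap.toMatrix_apply, LinearEquiv.coe_coe, domElt, diagElt_apply, map_smul,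
    Module.Basis.repr_self, Matrix.diagonal_apply, Finsupp.smul_apply, Finsupp.single_apply]
  by_cases hik : i = k
  · subst hik; simp
  · simp [hik, Ne.symm hik]

theorem matrixOf_mem {k : unitaryGroup h}
    (hk : k ∈ latticeStabilizer h (Submodule.span R (Set.range b))) (i l : Fin n) :
    matrixOf b k i l ∈ 𝒪 := by
  have h1 := (hk (b l)).2 (Submodule.subset_span ⟨l, rfl⟩)
  rw [Module.Basis.mem_span_iff_repr_mem] at h1
  rw [matrixOf, LinearMap.toMatrix_apply]
  exact h1 i

/-- If the double coset of `γ` occurs in the product of the double cosets of `α` and `β`, then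
`γ ≤ α + β` for the dominance order. -/
theorem partialSum_le_of_eq (H : IsUnramifiedIntegers R σ ϖ) (hb : IsAntidiagonal h b)
    {α β γ : Fin (n / 2) →₀ ℕ} {k₁ k₂ k₃ : unitaryGroup h}
    (h₁ : k₁ ∈ latticeStabilizer h (Submodule.span R (Set.range b)))
    (h₂ : k₂ ∈ latticeStabilizer h (Submodule.span R (Set.range b)))
    (h₃ : k₃ ∈ latticeStabilizer h (Submodule.span R (Set.range b)))
    (he : domElt H.q_ne_zero hb γ =
      k₁ * (domElt H.q_ne_zero hb α * (k₂ * (domElt H.q_ne_zero hb β * k₃))))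
    {j : ℕ} (hj : j ≤ n / 2) : partialSum γ j ≤ partialSum α j + partialSum β j := by
  have hq := H.q_ne_zero
  -- the minor in the last `j` rows and columns, which for `γ` has valuation `-partialSum γ j`
  let ρ : Fin j → Fin n := fun i => Fin.rev (Fin.castLE (hj.trans (Nat.div_le_self n 2)) i)
  have hρ : Function.Injective ρ := Fin.rev_injective.comp (Fin.castLE_injective _)
  have hM := congrArg (matrixOf b) he
  simp only [matrixOf_mul, matrixOf_domElt] at hM
  have hdet := congrArg (fun X => (X.submatrix ρ ρ).det) hM
  rw [Matrix.submatrix_diagonal _ _ hρ, Matrix.det_diagonal] at hdet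
  simp only [Function.comp_apply] at hdet
  rw [prod_zpow_eq hq, sum_domCochar_rev γ hj] at hdet
  rw [Matrix.submatrix_mul _ _ ρ id ρ Function.bijective_id,
    Matrix.submatrix_mul _ _ id id ρ Function.bijective_id, Matrix.submatrix_id_id] at hdet
  have h1 := zpow_mul_det_mem H α (j := j) (X := (matrixOf b k₁).submatrix ρ id) (R := R)
    (fun i k => matrixOf_mem h₁ _ _) (e := partialSum β j)
    (Y := (matrixOf b k₂ * (Matrix.diagonal (fun i => 𝓆 ^ domCochar n β i) *
      matrixOf b k₃)).submatrix id ρ) (fun f => by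
        rw [Matrix.submatrix_submatrix, Function.id_comp, Function.comp_id,
          Matrix.submatrix_mul _ _ f id ρ Function.bijective_id,
          Matrix.submatrix_mul _ _ id id ρ Function.bijective_id, Matrix.submatrix_id_id]
        have := zpow_mul_det_mem H β (j := j) (X := (matrixOf b k₂).submatrix f id) (R := R)
          (fun i k => matrixOf_mem h₂ _ _) (e := 0)
          (Y := (matrixOf b k₃).submatrix id ρ) (fun f' => by
            rw [zpow_zero, one_mul]
            exact det_mem fun i k => matrixOf_mem h₃ _ _)
        rwa [zero_add] at this)
  rw [← hdet, ← zpow_add₀ hq, H.q_zpow_mem_iff] at h1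
  omega

end Minors

/-! ### Finiteness of double cosets -/

/-- There are finitely many submodules between `I • P` and `P` if `R ⧸ I` is finite and `P` is
finitely generated. -/
theorem finite_setOf_smul_le_le {R X : Type*} [CommRing R] [AddCommGroup X] [Module R X]
    (I : Ideal R) [Finite (R ⧸ I)] {P : Submodule R X} (hP : P.FG) :
    {Q : Submodule R X | I • P ≤ Q ∧ Q ≤ P}.Finite := by
  have : Module.Finite R P := Module.Finite.iff_fg.2 hP
  have hfin : Finite (P ⧸ I • (⊤ : Submodule R P)) :=
    Submodule.finite_quotient_smul I Module.Finite.fg_top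
  let f : Submodule R X → Set (P ⧸ I • (⊤ : Submodule R P)) := fun Q =>
    (I • (⊤ : Submodule R P)).mkQ '' (Q.submoduleOf P)
  refine Set.Finite.of_finite_image (f := f) (Set.toFinite _) ?_
  have key : ∀ Q Q' : Submodule R X, I • P ≤ Q' → Q ≤ P → f Q = f Q' → Q ≤ Q' := by
    intro Q Q' hQ' hQ he x hx
    have h1 : (I • (⊤ : Submodule R P)).mkQ ⟨x, hQ hx⟩ ∈ f Q := ⟨_, hx, rfl⟩
    rw [he] at h1
    obtain ⟨y, hy, hxy⟩ := h1
    rw [Submodule.mkQ_apply, Submodule.mkQ_apply, eq_comm, Submodule.Quotient.eq] at hxy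
    have h2 : (⟨x, hQ hx⟩ - y : P).1 ∈ I • P := by
      have := Submodule.mem_map_of_mem (f := P.subtype) hxy
      rwa [Submodule.map_smul'', Submodule.map_subtype_top] at this
    have h3 := add_mem (hQ' h2) (show (y : X) ∈ Q' from hy)
    simpa using h3
  exact fun Q hQ Q' hQ' he => le_antisymm (key Q Q' hQ'.1 hQ.2 he) (key Q' Q hQ.1 hQ'.2 he.symm)

section Finiteness

variable {F₀ F R W : Type*} [Field F₀] [Field F] [Algebra F₀ F] [CommRing R] [Algebra R F]
  {σ : F ≃ₐ[F₀] F} {ϖ : F₀} [AddCommGroup W] [Module F W] [Module R W]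
  {h : W →ₛₗ[(σ : F →+* F)] W →ₗ[F] F}

local notation "𝓆" => algebraMap F₀ F ϖ

variable [IsScalarTower R F W] [IsFractionRing R F] [IsDomain R] [IsDiscreteValuationRing R]
  [Finite (IsLocalRing.ResidueField R)]

theorem finite_quotient_span_singleton {r : R} (hr : r ≠ 0) : Finite (R ⧸ Ideal.span {r}) := by
  obtain ⟨π, hπ⟩ := IsDiscreteValuationRing.exists_irreducible R
  obtain ⟨k, hk⟩ := IsDiscreteValuationRing.ideal_eq_span_pow_irreducible
    (s := Ideal.span {r}) (by simpa using hr) hπ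
  rw [hk, ← Ideal.span_singleton_pow, ← hπ.maximalIdeal_eq]
  have : Finite (R ⧸ IsLocalRing.maximalIdeal R) := ‹Finite (IsLocalRing.ResidueField R)›
  exact Ideal.finite_quotient_pow (IsNoetherian.noetherian _) k

/-- Finitely many submodules lie between two given multiples of a lattice. -/
theorem finite_setOf_commensurable (H : IsUnramifiedIntegers R σ ϖ) {Λ : Submodule R W}
    (hΛ : Λ.FG) (k l : ℕ) :
    {Q : Submodule R W | (∀ z ∈ Λ, 𝓆 ^ (l : ℤ) • z ∈ Q) ∧ ∀ z ∈ Q, 𝓆 ^ (k : ℤ) • z ∈ Λ}.Finite := by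
  have hq := H.q_ne_zero
  obtain ⟨r, hr⟩ := H.q_zpow_mem (k := (k : ℤ)) (by positivity)
  obtain ⟨r', hr'⟩ := H.q_zpow_mem (k := (k + l : ℤ)) (by positivity)
  have hr0 : r' ≠ 0 := by
    rintro rfl
    rw [map_zero] at hr'
    exact zpow_ne_zero _ hq hr'.symm
  have hsmul : ∀ z : W, r • z = 𝓆 ^ (k : ℤ) • z := fun z => by
    rw [← hr, algebraMap_smul]
  have hsmul' : ∀ z : W, r' • z = 𝓆 ^ (k + l : ℤ) • z := fun z => by
    rw [← hr', algebraMap_smul]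
  have := finite_quotient_span_singleton hr0
  have hinj : Function.Injective (LinearMap.lsmul R W r) := by
    intro z z' hz
    rw [LinearMap.lsmul_apply, LinearMap.lsmul_apply, hsmul, hsmul] at hz
    exact smul_right_injective W (zpow_ne_zero _ hq) hz
  refine Set.Finite.of_finite_image (f := Submodule.map (LinearMap.lsmul R W r))
    ((finite_setOf_smul_le_le (Ideal.span {r'}) hΛ).subset ?_)
    (Submodule.map_injective_of_injective hinj).injOn
  rintro _ ⟨Q, ⟨hQ, hQ'⟩, rfl⟩
  constructor
  · rw [Submodule.ideal_span_singleton_smul]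
    rintro _ ⟨z, hz, rfl⟩
    refine ⟨_, hQ z hz, ?_⟩
    rw [LinearMap.lsmul_apply, hsmul, smul_smul, ← zpow_add₀ hq, ← hsmul']
    rfl
  · rintro _ ⟨z, hz, rfl⟩
    rw [LinearMap.lsmul_apply, hsmul]
    exact hQ' z hz

/-- Indicator functions of double cosets of lattice stabilizers belong to the Hecke spaces. -/
theorem charFun_doubleCoset_mem (H : IsUnramifiedIntegers R σ ϖ) {Λ Λ' : Submodule R W}
    (hΛ : Λ.IsLattice F) (hΛ' : Λ'.IsLattice F) (x : unitaryGroup h) :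
    charFun (DoubleCoset.doubleCoset x (latticeStabilizer h Λ : Set (unitaryGroup h))
      (latticeStabilizer h Λ')) ∈
      heckeSpace (latticeStabilizer h Λ) (latticeStabilizer h Λ') := by
  classical
  set K := latticeStabilizer h Λ
  set K' := latticeStabilizer h Λ' with hK'
  refine ⟨fun u hu y => ?_, fun u hu y => ?_, ?_⟩
  · have h1 : u * y ∈ DoubleCoset.doubleCoset x (K : Set (unitaryGroup h)) K' ↔
        y ∈ DoubleCoset.doubleCoset x (K : Set (unitaryGroup h)) K' := by
      simp only [DoubleCoset.mem_doubleCoset]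
      constructor
      · rintro ⟨a, ha, b, hb, he⟩
        exact ⟨u⁻¹ * a, K.mul_mem (K.inv_mem hu) ha, b, hb, by simp [mul_assoc, ← he]⟩
      · rintro ⟨a, ha, b, hb, he⟩
        exact ⟨u * a, K.mul_mem hu ha, b, hb, by simp [mul_assoc, he]⟩
    simp only [charFun, Set.indicator_apply, h1]
    rfl
  · have h1 : y * u ∈ DoubleCoset.doubleCoset x (K : Set (unitaryGroup h)) K' ↔
        y ∈ DoubleCoset.doubleCoset x (K : Set (unitaryGroup h)) K' := by
      simp only [DoubleCoset.mem_doubleCoset]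
      constructor
      · rintro ⟨a, ha, b, hb, he⟩
        exact ⟨a, ha, b * u⁻¹, K'.mul_mem hb (K'.inv_mem hu), by simp [← mul_assoc, ← he]⟩
      · rintro ⟨a, ha, b, hb, he⟩
        exact ⟨a, ha, b * u, K'.mul_mem hb hu, by simp [← mul_assoc, he]⟩
    simp only [charFun, Set.indicator_apply, h1]
    rfl
  -- a coset of the stabilizer of `Λ'` is given by a translate of `Λ'`, and the translates that
  -- occur are commensurable with `Λ` with bounded exponents
  · obtain ⟨k, hk⟩ := exists_zpow_smul_le H (latticeMap x Λ') Λ (latticeMap_isLattice x hΛ') hΛ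
    obtain ⟨l, hl⟩ := exists_zpow_smul_le H Λ (latticeMap x Λ') hΛ (latticeMap_isLattice x hΛ')
    refine Set.Finite.of_finite_image (f := fun y => latticeMap y.out Λ')
      ((finite_setOf_commensurable H hΛ.fg k l).subset ?_) ?_
    · rintro _ ⟨_, ⟨y, hy, rfl⟩, rfl⟩
      have hy' : y ∈ DoubleCoset.doubleCoset x (K : Set (unitaryGroup h)) K' := by
        by_contra hn
        exact hy (by rw [charFun, Set.indicator_of_notMem hn])
      obtain ⟨a, ha, b, hb, rfl⟩ := DoubleCoset.mem_doubleCoset.1 hy'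
      obtain ⟨u, hu⟩ := QuotientGroup.mk_out_eq_mul K' (a * x * b)
      have h1 : latticeMap ((a * x * b : unitaryGroup h) : unitaryGroup h ⧸ K').out Λ' =
          latticeMap a (latticeMap x Λ') := by
        rw [hu, mul_assoc, latticeMap_mul, mem_latticeStabilizer_iff.1 (K'.mul_mem hb u.2),
          latticeMap_mul]
      have ha' : latticeMap a Λ = Λ := mem_latticeStabilizer_iff.1 ha
      change latticeMap _ _ ∈ _
      rw [h1]
      refine ⟨fun z hz => ?_, fun z hz => ?_⟩
      · rw [← ha', mem_latticeMap_iff] at hz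
        rw [mem_latticeMap_iff, map_smul]
        exact hl _ hz
      · rw [mem_latticeMap_iff] at hz
        rw [← ha', mem_latticeMap_iff, map_smul]
        exact hk _ hz
    · intro y _ y' _ he
      rw [← QuotientGroup.out_eq' y, ← QuotientGroup.out_eq' y', QuotientGroup.eq]
      exact latticeMap_eq_iff.1 he

theorem intertwining_mem (H : IsUnramifiedIntegers R σ ϖ) {Λ Λ' : Submodule R W}
    (hΛ : Λ.IsLattice F) (hΛ' : Λ'.IsLattice F) :
    intertwining (latticeStabilizer h Λ) (latticeStabilizer h Λ') ∈
      heckeSpace (latticeStabilizer h Λ) (latticeStabilizer h Λ') := by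
  have := charFun_doubleCoset_mem (h := h) H hΛ hΛ' 1
  rwa [DoubleCoset.doubleCoset, Set.singleton_one, mul_one] at this

end Finiteness

/-! ### Hecke algebras that are polynomial algebras -/

section CartanSystem

variable {G ι J : Type*} [Group G]

/-- Representatives `x α` of the double cosets `K \ G / K`, indexed by a free commutative monoid,
together with a size `S` that controls which double cosets occur in a product of two. -/
structure IsCartanSystem (K : Subgroup G) (x : (ι →₀ ℕ) → G) (S : (ι →₀ ℕ) → J → ℕ) : Prop where
  exists_eq : ∀ g, ∃ α, ∃ k ∈ K, ∃ k' ∈ K, g = k * x α * k'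
  map_add : ∀ α β, x (α + β) = x α * x β
  inv_eq : ∀ α, ∃ k ∈ K, ∃ k' ∈ K, (x α)⁻¹ = k * x α * k'
  size_add : ∀ α β, S (α + β) = S α + S β
  size_injective : Function.Injective S
  size_le : ∀ α β γ, ∀ k₁ ∈ K, ∀ k₂ ∈ K, ∀ k₃ ∈ K,
    x γ = k₁ * (x α * (k₂ * (x β * k₃))) → S γ ≤ S α + S β

/-- The nonnegative function `f` is supported on double cosets of size at most that of `α`, and
does not vanish on the double coset of `α`. -/
structure HasLead (x : (ι →₀ ℕ) → G) (S : (ι →₀ ℕ) → J → ℕ) (f : G → ℚ) (α : ι →₀ ℕ) : Prop where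
  nonneg : ∀ g, 0 ≤ f g
  ne_zero : f (x α) ≠ 0
  size_le : ∀ β, f (x β) ≠ 0 → S β ≤ S α

namespace IsCartanSystem

variable {K : Subgroup G} {x : (ι →₀ ℕ) → G} {S : (ι →₀ ℕ) → J → ℕ}

theorem map_zero (hx : IsCartanSystem K x S) : x 0 = 1 := by
  have := hx.map_add 0 0
  rwa [add_zero, left_eq_mul] at this

theorem size_zero (hx : IsCartanSystem K x S) : S 0 = 0 := by
  have := hx.size_add 0 0
  rwa [add_zero, left_eq_add] at this

theorem apply_eq {f : G → ℚ} (hf : f ∈ heckeSpace K K) {k k' : G} (hk : k ∈ K) (hk' : k' ∈ K)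
    (g : G) : f (k * g * k') = f g := by
  rw [hf.2.1 k' hk', hf.1 k hk]

theorem ext_apply (hx : IsCartanSystem K x S) {f g : G → ℚ} (hf : f ∈ heckeSpace K K)
    (hg : g ∈ heckeSpace K K) (hfg : ∀ α, f (x α) = g (x α)) : f = g := by
  funext y
  obtain ⟨α, k, hk, k', hk', rfl⟩ := hx.exists_eq y
  rw [apply_eq hf hk hk', apply_eq hg hk hk', hfg]

theorem apply_inv (hx : IsCartanSystem K x S) {f : G → ℚ} (hf : f ∈ heckeSpace K K) (g : G) :
    f g⁻¹ = f g := by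
  obtain ⟨α, k, hk, k', hk', rfl⟩ := hx.exists_eq g
  obtain ⟨l, hl, l', hl', he⟩ := hx.inv_eq α
  rw [apply_eq hf hk hk', mul_inv_rev, mul_inv_rev, ← mul_assoc,
    apply_eq hf (K.inv_mem hk') (K.inv_mem hk), he, apply_eq hf hl hl']

/-- Gelfand's trick: inversion is an anti-automorphism that preserves every double coset. -/
theorem conv_comm (hx : IsCartanSystem K x S) {f g : G → ℚ} (hf : f ∈ heckeSpace K K)
    (hg : g ∈ heckeSpace K K) : conv K f g = conv K g f := by
  funext y
  rw [← hx.apply_inv (conv_mem hf hg) y]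
  have h1 := conv_translate hg.2.1 hf.1 y⁻¹ 1
  rw [inv_inv, mul_one] at h1
  rw [← h1]
  refine finsum_congr fun z => ?_
  rw [mul_one, hx.apply_inv hf, ← hx.apply_inv hg (y * z.out), mul_inv_rev, mul_comm]

/-- Different indices belong to different double cosets. -/
theorem eq_of_eq_mul_mul (hx : IsCartanSystem K x S) {α β : ι →₀ ℕ} {k k' : G} (hk : k ∈ K)
    (hk' : k' ∈ K) (he : x α = k * x β * k') : α = β := by
  have key : ∀ {α β : ι →₀ ℕ} {k k' : G}, k ∈ K → k' ∈ K → x α = k * x β * k' → S α ≤ S β := by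
    intro α β k k' hk hk' he
    have := hx.size_le β 0 α k hk k' hk' 1 K.one_mem (by simp [he, hx.map_zero, mul_assoc])
    rwa [hx.size_zero, add_zero] at this
  refine hx.size_injective (le_antisymm (key hk hk' he) (key (K.inv_mem hk) (K.inv_mem hk') ?_))
  simp [he, mul_assoc]

theorem finite_setOf_ne_zero (hx : IsCartanSystem K x S) {f : G → ℚ} (hf : f ∈ heckeSpace K K) :
    {α | f (x α) ≠ 0}.Finite := by
  refine Set.Finite.of_finite_image (f := fun α => (x α : G ⧸ K)) (hf.2.2.subset ?_) ?_
  · rintro _ ⟨α, hα, rfl⟩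
    exact ⟨x α, hα, rfl⟩
  · intro α _ β _ he
    refine (hx.eq_of_eq_mul_mul K.one_mem (QuotientGroup.eq.1 he) ?_).symm
    simp

theorem hasLead_one (hx : IsCartanSystem K x S) : HasLead x S (charFun (K : Set G)) 0 where
  nonneg _ := Set.indicator_nonneg (fun _ _ => zero_le_one) _
  ne_zero := by simp [charFun, hx.map_zero, K.one_mem]
  size_le β hβ := by
    have h1 : x β ∈ K := by
      by_contra hn
      exact hβ (Set.indicator_of_notMem hn _)
    rw [hx.eq_of_eq_mul_mul (α := β) (β := 0) h1 K.one_mem (by simp [hx.map_zero])]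

/-- Leading terms add up: by nonnegativity the product of the values at `x α` and `x β` is not
cancelled in the value of the convolution at `x (α + β)`. -/
theorem hasLead_conv (hx : IsCartanSystem K x S) {f g : G → ℚ} (hf : f ∈ heckeSpace K K)
    (hg : g ∈ heckeSpace K K) {α β : ι →₀ ℕ} (hfα : HasLead x S f α) (hgβ : HasLead x S g β) :
    HasLead x S (conv K f g) (α + β) where
  nonneg y := finsum_nonneg fun z => mul_nonneg (hfα.nonneg _) (hgβ.nonneg _)
  ne_zero := by
    have h1 : f (x α) * g (x β) ≤ conv K f g (x (α + β)) := by
      have h2 := single_le_finsum (x α : G ⧸ K) (finite_support_mul hf fun y =>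
        g (y.out⁻¹ * x (α + β))) fun z => mul_nonneg (hfα.nonneg _) (hgβ.nonneg _)
      rw [out_eq hf.2.1 hg.1, hx.map_add, inv_mul_cancel_left] at h2
      rw [hx.map_add]
      exact h2
    have h3 : 0 < f (x α) * g (x β) :=
      mul_pos ((hfα.nonneg _).lt_of_ne' hfα.ne_zero) ((hgβ.nonneg _).lt_of_ne' hgβ.ne_zero)
    exact (h3.trans_le h1).ne'
  size_le γ hγ := by
    obtain ⟨y, hy⟩ : ∃ y : G ⧸ K, f y.out * g (y.out⁻¹ * x γ) ≠ 0 := by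
      by_contra! hc
      exact hγ ((finsum_congr hc).trans finsum_zero)
    obtain ⟨α', k₁, hk₁, k₂, hk₂, h1⟩ := hx.exists_eq y.out
    obtain ⟨β', k₃, hk₃, k₄, hk₄, h2⟩ := hx.exists_eq (y.out⁻¹ * x γ)
    have hα' := left_ne_zero_of_mul hy
    have hβ' := right_ne_zero_of_mul hy
    rw [h1, apply_eq hf hk₁ hk₂] at hα'
    rw [h2, apply_eq hg hk₃ hk₄] at hβ'
    rw [hx.size_add]
    refine (hx.size_le α' β' γ k₁ hk₁ (k₂ * k₃) (K.mul_mem hk₂ hk₃) k₄ hk₄ ?_).trans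
      (add_le_add (hfα.size_le _ hα') (hgβ.size_le _ hβ'))
    rw [inv_mul_eq_iff_eq_mul, h1] at h2
    rw [h2]
    simp only [mul_assoc]

variable [Fintype J]

theorem eq_of_sum_size_le (hx : IsCartanSystem K x S) {α β : ι →₀ ℕ} (h1 : S α ≤ S β)
    (h2 : ∑ j, S β j ≤ ∑ j, S α j) : α = β := by
  have h3 := (Finset.sum_eq_sum_iff_of_le (s := Finset.univ) fun j _ => h1 j).1
    (le_antisymm (Finset.sum_le_sum fun j _ => h1 j) h2)
  exact hx.size_injective (funext fun j => h3 j (Finset.mem_univ j))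

/-- A Hecke algebra with a Cartan system is a polynomial algebra in any family of functions whose
leading double cosets are those of the generators of the index monoid: the monomials in this
family are unitriangular, up to nonzero factors, with respect to the double cosets. -/
theorem exists_algEquiv (hx : IsCartanSystem K x S) (φ : ι → HeckeAlgebra K)
    (hφ : ∀ i, HasLead x S (φ i) (Finsupp.single i 1)) :
    ∃ e : MvPolynomial ι ℚ ≃ₐ[ℚ] HeckeAlgebra K, ∀ i, e (MvPolynomial.X i) = φ i := by
  classical
  let _ : CommRing (HeckeAlgebra K) :=
    { (inferInstance : Ring (HeckeAlgebra K)) with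
      mul_comm := fun f g => Subtype.ext (hx.conv_comm f.2 g.2) }
  let E : MvPolynomial ι ℚ →ₐ[ℚ] HeckeAlgebra K := MvPolynomial.aeval φ
  have hE : ∀ i, E (MvPolynomial.X i) = φ i := fun i => MvPolynomial.aeval_X φ i
  -- the monomial in the functions `φ i` with exponents `α`
  let m : (ι →₀ ℕ) → HeckeAlgebra K := fun α => E (MvPolynomial.monomial α 1)
  have hmul : ∀ {f g : HeckeAlgebra K} {α β : ι →₀ ℕ}, HasLead x S f α → HasLead x S g β →
      HasLead x S ((f * g : HeckeAlgebra K) : HeckeAlgebra K) (α + β) := fun {f g} _ _ hf hg =>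
    hx.hasLead_conv f.2 g.2 hf hg
  have hone : HasLead x S (1 : HeckeAlgebra K) 0 := hx.hasLead_one
  have hm : ∀ α, HasLead x S (m α) α := by
    intro α
    induction α using Finsupp.induction_linear with
    | zero =>
      have : m 0 = 1 := map_one E
      rwa [this]
    | add α β hα hβ =>
      have : m (α + β) = m α * m β := by
        simp only [m]
        rw [← map_mul, MvPolynomial.monomial_mul, mul_one]
      rw [this]
      exact hmul hα hβ
    | single i k =>
      have : m (Finsupp.single i k) = φ i ^ k := by
        simp only [m]
        rw [← MvPolynomial.X_pow_eq_monomial, map_pow, hE]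
      rw [this]
      induction k with
      | zero => rwa [pow_zero, Finsupp.single_zero]
      | succ k ih =>
        rw [pow_succ, Finsupp.single_add]
        exact hmul (ih (by simp only [m]; rw [← MvPolynomial.X_pow_eq_monomial, map_pow, hE]))
          (hφ i)
  have happ : ∀ (s : Finset (ι →₀ ℕ)) (c : (ι →₀ ℕ) → ℚ) (g : G),
      (∑ α ∈ s, c α • m α : HeckeAlgebra K) g = ∑ α ∈ s, c α * m α g := by
    intro s c g
    induction s using Finset.induction_on with
    | empty => simp; rfl
    | insert α s hα ih =>
      rw [Finset.sum_insert hα, Finset.sum_insert hα, ← ih]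
      rfl
  -- a grading that refines the order by size, so that maxima and inductions are available
  let T : (ι →₀ ℕ) → ℕ := fun α => ∑ j, S α j
  have hT : ∀ {α β}, m β (x α) ≠ 0 → T α ≤ T β := fun {α β} hne =>
    Finset.sum_le_sum fun j _ => (hm β).size_le α hne j
  have hT' : ∀ {α β}, m β (x α) ≠ 0 → T β ≤ T α → α = β := fun {α β} hne hle =>
    hx.eq_of_sum_size_le ((hm β).size_le α hne) hle
  have hinj : Function.Injective E := by
    rw [injective_iff_map_eq_zero]
    intro P hP
    by_contra hne
    -- at the double coset of a maximal exponent only one monomial is nonzero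
    obtain ⟨α, hα, hmax⟩ := P.support.exists_max_image T (MvPolynomial.support_nonempty.2 hne)
    have h1 : E P = ∑ β ∈ P.support, P.coeff β • m β := by
      conv_lhs => rw [P.as_sum]
      rw [map_sum]
      refine Finset.sum_congr rfl fun β _ => ?_
      rw [← map_smul, MvPolynomial.smul_monomial, smul_eq_mul, mul_one]
    have h2 : (E P) (x α) = P.coeff α * m α (x α) := by
      rw [h1, happ, Finset.sum_eq_single α]
      · intro β hβ hβα
        by_contra hne'
        exact hβα (hT' (right_ne_zero_of_mul hne') (hmax β hβ)).symm
      · exact fun hn => absurd hα hn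
    rw [hP] at h2
    exact mul_ne_zero (MvPolynomial.mem_support_iff.1 hα) (hm α).ne_zero h2.symm
  have hsurj : Function.Surjective E := by
    have key : ∀ (N : ℕ) (f : HeckeAlgebra K), (∀ α, f (x α) ≠ 0 → T α < N) → f ∈ E.range := by
      intro N
      induction N with
      | zero =>
        intro f hf
        have : f = 0 := Subtype.ext (hx.ext_apply f.2 (0 : HeckeAlgebra K).2 fun α => by
          by_contra hne
          exact absurd (hf α hne) (Nat.not_lt_zero _))
        rw [this]
        exact zero_mem _
      | succ N ih =>
        intro f hf
        -- subtract multiples of monomials to remove the terms of maximal degree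
        let B := (hx.finite_setOf_ne_zero f.2).toFinset.filter fun α => T α = N
        let c : (ι →₀ ℕ) → ℚ := fun α => f (x α) / m α (x α)
        have h1 : f - ∑ α ∈ B, c α • m α ∈ E.range := by
          refine ih _ fun γ hγ => ?_
          have h2 : (f - ∑ α ∈ B, c α • m α : HeckeAlgebra K) (x γ) =
              f (x γ) - ∑ α ∈ B, c α * m α (x γ) := by
            rw [← happ]
            rfl
          rw [h2] at hγ
          by_contra! hle
          refine hγ ?_
          have h3 : ∀ α ∈ B, α ≠ γ → c α * m α (x γ) = 0 := by
            intro α hα hne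
            have hαN := (Finset.mem_filter.1 hα).2
            by_contra hne'
            exact hne (hT' (right_ne_zero_of_mul hne') (by omega)).symm
          rw [Finset.sum_eq_single γ h3, div_mul_cancel₀ _ (hm γ).ne_zero, sub_self]
          intro hγB
          rw [div_mul_cancel₀ _ (hm γ).ne_zero]
          by_contra hne
          have := hf γ hne
          exact hγB (Finset.mem_filter.2 ⟨by simpa using hne, by omega⟩)
        have h2 : ∑ α ∈ B, c α • m α ∈ E.range :=
          sum_mem fun α _ => E.range.smul_mem ⟨_, rfl⟩ _
        have := add_mem h1 h2
        rwa [sub_add_cancel] at this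
    intro f
    obtain ⟨N, hN⟩ := ((hx.finite_setOf_ne_zero f.2).image T).bddAbove
    exact key (N + 1) f fun α hα => Nat.lt_succ_of_le (hN ⟨α, hα, rfl⟩)
  exact ⟨AlgEquiv.ofBijective E ⟨hinj, hsurj⟩, hE⟩

end IsCartanSystem

end CartanSystem

/-! ### Fundamental cocharacters -/

section Fundamental

variable {n : ℕ}

/-- The index of the fundamental cocharacter `(1 ^ r, 0, (-1) ^ r)`, which is zero for `r = 0`. -/
def fundIndex (n r : ℕ) : Fin (n / 2) →₀ ℕ :=
  Finsupp.equivFunOnFinite.symm fun t => if (t : ℕ) + 1 = r then 1 else 0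

theorem fundIndex_apply (r : ℕ) (t : Fin (n / 2)) :
    fundIndex n r t = if (t : ℕ) + 1 = r then 1 else 0 := rfl

theorem fundIndex_succ (t : Fin (n / 2)) : fundIndex n (t + 1) = Finsupp.single t 1 := by
  ext u
  rw [fundIndex_apply, Finsupp.single_apply]
  simp [Fin.ext_iff, eq_comm]

theorem fundIndex_zero : fundIndex n 0 = 0 := by
  ext u
  rw [fundIndex_apply, if_neg (Nat.succ_ne_zero _), Finsupp.zero_apply]

theorem domCochar_fundIndex {r : ℕ} (hr : r ≤ n / 2) :
    domCochar n (fundIndex n r) = cochar n r := by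
  rcases r with _ | r
  · funext i
    have := i.2
    rw [fundIndex_zero, domCochar_zero, cochar, if_neg (by omega), if_neg (by omega)]
  · exact (congrArg (domCochar n) (fundIndex_succ ⟨r, hr⟩)).trans (domCochar_single ⟨r, hr⟩)

theorem partialSum_fundIndex {r : ℕ} (hr : r ≤ n / 2) (j : ℕ) :
    partialSum (fundIndex n r) j = min r j := by
  rcases r with _ | r
  · rw [fundIndex_zero, partialSum_zero, Nat.zero_min]
  · have h1 : fundIndex n (r + 1) = Finsupp.single ⟨r, hr⟩ 1 := fundIndex_succ ⟨r, hr⟩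
    rw [h1, partialSum, Finset.sum_eq_single ⟨r, hr⟩]
    · simp
    · intro t _ ht
      simp [ht.symm]
    · simp

/-- The fundamental cocharacters and zero are the dominant cocharacters with entries at most one. -/
theorem exists_fundIndex_eq {α : Fin (n / 2) →₀ ℕ} (hα : ∀ i, domCochar n α i ≤ 1) :
    ∃ r ≤ n / 2, α = fundIndex n r := by
  rcases eq_or_ne α 0 with rfl | hne
  · exact ⟨0, Nat.zero_le _, fundIndex_zero.symm⟩
  obtain ⟨t, ht⟩ := Finsupp.ne_iff.1 hne
  rw [Finsupp.zero_apply] at ht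
  have htn := t.2
  have h1 : ∑ s, α s ≤ 1 := by
    have h2 := hα ⟨0, by omega⟩
    rw [domCochar] at h2
    simp only [cochar, Nat.zero_lt_succ, if_true, mul_one] at h2
    exact_mod_cast h2
  refine ⟨t + 1, htn, ?_⟩
  rw [fundIndex_succ]
  ext u
  rcases eq_or_ne t u with rfl | htu
  · have := Finset.single_le_sum (f := fun s => α s) (fun s _ => Nat.zero_le _) (Finset.mem_univ t)
    rw [Finsupp.single_eq_same]
    omega
  · have := Finset.add_le_sum (f := fun s => α s) (fun s _ => Nat.zero_le _) (Finset.mem_univ t)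
      (Finset.mem_univ u) htu
    rw [Finsupp.single_eq_of_ne' htu]
    omega

end Fundamental

/-! ### The support of an atomic function -/

section Atomic

variable {F₀ F R W : Type*} [Field F₀] [Field F] [Algebra F₀ F] [CommRing R] [Algebra R F]
  {σ : F ≃ₐ[F₀] F} {ϖ : F₀} [AddCommGroup W] [Module F W] [Module R W]
  {h : W →ₛₗ[(σ : F →+* F)] W →ₗ[F] F}

local notation "𝓆" => algebraMap F₀ F ϖ

variable {n : ℕ} {b c : Module.Basis (Fin n) F W}
  [IsScalarTower R F W] [IsFractionRing R F] [IsDomain R] [IsDiscreteValuationRing R]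

theorem transport_mul_domElt (hq : 𝓆 ≠ 0) (hb : IsAntidiagonal h b) (hc : IsAntidiagonal h c)
    (α : Fin (n / 2) →₀ ℕ) :
    transport hb hc * domElt hq hb α = domElt hq hc α * transport hb hc :=
  unitaryGroup_ext b fun i => by
    change (transport hb hc : W ≃ₗ[F] W) ((domElt hq hb α : W ≃ₗ[F] W) (b i)) =
      (domElt hq hc α : W ≃ₗ[F] W) ((transport hb hc : W ≃ₗ[F] W) (b i))
    rw [domElt, domElt, diagElt_apply, map_smul, transport_apply, diagElt_apply]

/-- The inverse of a diagonal element is its conjugate by the longest Weyl group element. -/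
theorem domElt_inv_eq (hq : 𝓆 ≠ 0) (hb : IsAntidiagonal h b) (α : Fin (n / 2) →₀ ℕ) :
    ∃ k ∈ latticeStabilizer h (Submodule.span R (Set.range b)),
      ∃ k' ∈ latticeStabilizer h (Submodule.span R (Set.range b)),
        (domElt hq hb α)⁻¹ = k * domElt hq hb α * k' := by
  have hc : IsAntidiagonal h (b.reindex (Fin.revPerm (n := n)).symm) :=
    isAntidiagonal_reindex hb fun i => by simp
  have hmem := transport_mem (R := R) hb hc (by rw [Module.Basis.range_reindex])
  have hw : ∀ i, (transport hb hc : W ≃ₗ[F] W) (b i) = b (Fin.rev i) := fun i => by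
    rw [transport_apply, Module.Basis.reindex_apply]
    simp
  refine ⟨_, hmem, _, hmem, inv_eq_of_mul_eq_one_right (unitaryGroup_ext b fun i => ?_)⟩
  change (domElt hq hb α : W ≃ₗ[F] W) ((transport hb hc : W ≃ₗ[F] W)
    ((domElt hq hb α : W ≃ₗ[F] W) ((transport hb hc : W ≃ₗ[F] W) (b i)))) = b i
  rw [hw, domElt, diagElt_apply, map_smul, hw, Fin.rev_rev, map_smul, diagElt_apply, smul_smul,
    domCochar_rev, ← zpow_add₀ hq, neg_add_cancel, zpow_zero, one_smul]

theorem isCartanSystem_domElt (H : IsUnramifiedIntegers R σ ϖ) (hherm : h.IsSymm)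
    (hb : IsAntidiagonal h b) :
    IsCartanSystem (latticeStabilizer h (Submodule.span R (Set.range b)))
      (domElt H.q_ne_zero hb) (fun α (j : Fin (n / 2 + 1)) => partialSum α j) where
  exists_eq g := by
    obtain ⟨ν, hν, hanti, k, hk, k', hk', rfl⟩ := exists_cartan (R := R) H hherm hb g
    obtain ⟨α, rfl⟩ := exists_domCochar_eq hν hanti
    exact ⟨α, k, hk, k', hk', rfl⟩
  map_add α β := (domElt_add _ _ α β).symm
  inv_eq α := domElt_inv_eq _ hb α
  size_add α β := funext fun j => partialSum_add α β j
  size_injective α β he := eq_of_partialSum_eq fun j hj =>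
    congrFun he ⟨j, Nat.lt_succ_of_le hj⟩
  size_le α β γ k₁ h₁ k₂ h₂ k₃ h₃ he j :=
    partialSum_le_of_eq H hb h₁ h₂ h₃ he (Nat.le_of_lt_succ j.2)

/-- The lattices that contribute to an atomic function: the summand of `y` is nonzero only if the
lattice `y Λ` lies in the intersection of `L` and `g L`. -/
theorem latticeMap_le_of_mem_mul {L Λ : Submodule R W} (hLL : dualLattice h L = L)
    (hΛL : Λ ≤ L) (hΛ : ∀ x ∈ dualLattice h Λ, 𝓆 • x ∈ Λ) {g y : unitaryGroup h}
    (hy : y ∈ (latticeStabilizer h L : Set (unitaryGroup h)) * (latticeStabilizer h Λ : Set _))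
    (hyg : y⁻¹ * g ∈
      (latticeStabilizer h Λ : Set (unitaryGroup h)) * (latticeStabilizer h L : Set _)) :
    (∃ a ∈ latticeStabilizer h L, latticeMap y Λ = latticeMap a Λ) ∧
      latticeMap y Λ ≤ L ⊓ latticeMap g L ∧ ∀ z ∈ L, 𝓆 • z ∈ latticeMap g L := by
  obtain ⟨a, ha, u, hu, rfl⟩ := Set.mem_mul.1 hy
  obtain ⟨u', hu', a', ha', he⟩ := Set.mem_mul.1 hyg
  rw [SetLike.mem_coe] at ha hu hu' ha'
  have h1 : latticeMap (a * u) Λ = latticeMap a Λ := by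
    rw [latticeMap_mul, mem_latticeStabilizer_iff.1 hu]
  have h2 : latticeMap g L = latticeMap (a * u) (latticeMap u' L) := by
    rw [eq_inv_mul_iff_mul_eq] at he
    rw [← he, latticeMap_mul, latticeMap_mul u', mem_latticeStabilizer_iff.1 ha']
  have h3 : latticeMap (a * u) Λ ≤ latticeMap g L := by
    rw [h2, latticeMap_le_latticeMap, ← mem_latticeStabilizer_iff.1 hu', latticeMap_le_latticeMap]
    exact hΛL
  refine ⟨⟨a, ha, h1⟩, le_inf ?_ h3, fun z hz => h3 ?_⟩
  · rw [h1]
    conv_rhs => rw [← mem_latticeStabilizer_iff.1 ha]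
    rw [latticeMap_le_latticeMap]
    exact hΛL
  · rw [h1, mem_latticeMap_iff, map_smul]
    refine hΛ _ ?_
    have h4 : ((a⁻¹ : unitaryGroup h) : W ≃ₗ[F] W) z ∈ L :=
      ((latticeStabilizer h L).inv_mem ha z).2 hz
    rw [← hLL] at h4
    exact fun x hx => h4 x (hΛL hx)

theorem exists_of_atomic_ne_zero {G : Type*} [Group G] {K K' : Subgroup G} {g : G}
    (hg : atomic K K' g ≠ 0) :
    ∃ y, y ∈ (K : Set G) * (K' : Set G) ∧ y⁻¹ * g ∈ (K' : Set G) * (K : Set G) := by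
  obtain ⟨y, hy⟩ : ∃ y : G ⧸ K', intertwining K K' y.out * intertwining K' K (y.out⁻¹ * g) ≠ 0 := by
    by_contra! hc
    exact hg ((finsum_congr hc).trans finsum_zero)
  exact ⟨y.out, Set.mem_of_indicator_ne_zero (left_ne_zero_of_mul hy),
    Set.mem_of_indicator_ne_zero (right_ne_zero_of_mul hy)⟩

variable {s : ℕ}

/-- The colength of a translate of the standard vertex lattice of type `2 * s`. -/
theorem length_latticeMap (H : IsUnramifiedIntegers R σ ϖ) (hs : s ≤ n) {a : unitaryGroup h}
    (ha : a ∈ latticeStabilizer h (diagLattice ϖ R b 0)) :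
    Module.length R (diagLattice ϖ R b 0 ⧸
      (latticeMap a (diagLattice ϖ R b fun i => if (i : ℕ) < s then 1 else 0)).submoduleOf
        (diagLattice ϖ R b 0)) = s := by
  have h1 : ∀ i, (a : W ≃ₗ[F] W) (b i) = b.map (a : W ≃ₗ[F] W) i := fun i => by simp
  rw [latticeMap_diagLattice h1]
  have h2 : diagLattice ϖ R b 0 = diagLattice ϖ R (b.map (a : W ≃ₗ[F] W)) 0 := by
    rw [← latticeMap_diagLattice h1, mem_latticeStabilizer_iff.1 ha]
  rw [h2, length_diagLattice H fun i => by simp only [Pi.zero_apply]; split_ifs <;> simp]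
  have h3 : (Finset.univ.filter fun i : Fin n =>
      (if (i : ℕ) < s then 1 else 0 : ℤ) = (0 : Fin n → ℤ) i + 1) =
      Finset.univ.filter fun i : Fin n => (i : ℕ) < s := by
    ext i
    simp
  rw [h3, Fin.card_filter_val_lt, min_eq_right hs]

theorem sup_cochar_zero :
    (0 : Fin n → ℤ) ⊔ cochar n s = fun i : Fin n => if (i : ℕ) < s then 1 else 0 := by
  funext i
  simp only [Pi.sup_apply, Pi.zero_apply, cochar]
  split_ifs <;> simp

theorem submoduleOf_le_submoduleOf {X : Type*} [AddCommGroup X] [Module R X]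
    {P P' : Submodule R X} (Q : Submodule R X) (hle : P ≤ P') :
    P.submoduleOf Q ≤ P'.submoduleOf Q :=
  fun _ hx => hle hx

theorem length_quotient_le {X : Type*} [AddCommGroup X] [Module R X] {P P' : Submodule R X}
    (hle : P ≤ P') : Module.length R (X ⧸ P') ≤ Module.length R (X ⧸ P) :=
  Module.length_le_of_surjective (Submodule.factor hle) (Submodule.factor_surjective hle)

/-- The lattices that contribute to the value of an atomic function at a dominant cocharacter. -/
theorem exists_latticeMap_le (H : IsUnramifiedIntegers R σ ϖ) (hb : IsAntidiagonal h b)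
    (hs : 2 * s ≤ n) {Λ : Submodule R W}
    (hΛ : Λ = diagLattice ϖ R b fun i => if (i : ℕ) < s then 1 else 0) {α : Fin (n / 2) →₀ ℕ}
    {y : unitaryGroup h}
    (hy : y ∈ (latticeStabilizer h (diagLattice ϖ R b 0) : Set (unitaryGroup h)) *
      (latticeStabilizer h Λ : Set _))
    (hyg : y⁻¹ * domElt H.q_ne_zero hb α ∈ (latticeStabilizer h Λ : Set (unitaryGroup h)) *
      (latticeStabilizer h (diagLattice ϖ R b 0) : Set _)) :
    ∃ r ≤ n / 2, α = fundIndex n r ∧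
      (∃ a ∈ latticeStabilizer h (diagLattice ϖ R b 0), latticeMap y Λ = latticeMap a Λ) ∧
      latticeMap y Λ ≤ diagLattice ϖ R b fun i => if (i : ℕ) < r then 1 else 0 := by
  subst hΛ
  obtain ⟨hya, hle, hsm⟩ := latticeMap_le_of_mem_mul
    (by rw [dualLattice_diagLattice H hb]; congr 1)
    ((diagLattice_le_iff H).2 fun i => by simp only [Pi.zero_apply]; split_ifs <;> simp)
    (fun x hx => by
      rw [dualLattice_diagLattice H hb, mem_diagLattice H.q_ne_zero] at hx
      rw [mem_diagLattice H.q_ne_zero]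
      intro i
      rw [map_smul, Finsupp.smul_apply, smul_eq_mul, ← mul_assoc, ← zpow_add_one₀ H.q_ne_zero]
      have h1 := hx i
      rw [neg_neg] at h1
      split_ifs at h1 ⊢ with h2 h3
      · rw [Fin.val_rev] at h3; omega
      · simpa using h1
      · rw [zpow_one] at h1
        simpa using h1
      · rw [zpow_zero, one_mul] at h1
        simpa using mul_mem H.q_mem h1) hy hyg
  have hg : latticeMap (domElt H.q_ne_zero hb α) (diagLattice ϖ R b 0) =
      diagLattice ϖ R b (domCochar n α) := by
    rw [domElt, latticeMap_diagElt]
    congr 1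
    funext i
    simp
  rw [hg] at hle hsm
  obtain ⟨r, hr, rfl⟩ := exists_fundIndex_eq (α := α) fun i => by
    rw [← zpow_smul_mem_diagLattice_iff (b := b) (R := R) H, zpow_one]
    refine hsm _ ?_
    have := zpow_smul_mem_diagLattice (ϖ := ϖ) (R := R) (b := b) (μ := 0) i
    simpa using this
  rw [domCochar_fundIndex hr, diagLattice_inf H, sup_cochar_zero] at hle
  exact ⟨r, hr, rfl, hya, hle⟩

/-- The dominant cocharacters in the support of an atomic function. -/
theorem exists_fundIndex_of_atomic_ne_zero (H : IsUnramifiedIntegers R σ ϖ)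
    (hb : IsAntidiagonal h b) (hs : 2 * s ≤ n) {Λ : Submodule R W}
    (hΛ : Λ = diagLattice ϖ R b fun i => if (i : ℕ) < s then 1 else 0) {α : Fin (n / 2) →₀ ℕ}
    (hα : atomic (latticeStabilizer h (diagLattice ϖ R b 0)) (latticeStabilizer h Λ)
      (domElt H.q_ne_zero hb α) ≠ 0) : ∃ r ≤ s, α = fundIndex n r := by
  obtain ⟨y, hy, hyg⟩ := exists_of_atomic_ne_zero hα
  obtain ⟨r, hr, rfl, ⟨a, ha, hya⟩, hle⟩ := exists_latticeMap_le H hb hs hΛ hy hyg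
  refine ⟨r, ?_, rfl⟩
  have h1 := length_latticeMap H (by omega : s ≤ n) ha
  have h2 := length_latticeMap (b := b) (s := r) H (by omega) (one_mem (latticeStabilizer h _))
  rw [latticeMap_one] at h2
  rw [hya, hΛ] at hle
  have h3 := length_quotient_le (submoduleOf_le_submoduleOf (diagLattice ϖ R b 0) hle)
  rw [h1, h2] at h3
  exact_mod_cast h3

/-- The double coset of the fundamental cocharacter splits: `ϖ ^ (1 ^ s, 0, (-1) ^ s)` is the
product of an element stabilizing the standard vertex lattice of type `2 * s`, which exchanges the
first and the last `s` basis vectors up to scaling, and an element of the other stabilizer. -/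
theorem domElt_mem_mul (H : IsUnramifiedIntegers R σ ϖ) (hb : IsAntidiagonal h b)
    (hs : 2 * s ≤ n) :
    domElt H.q_ne_zero hb (fundIndex n s) ∈
      (latticeStabilizer h (diagLattice ϖ R b fun i => if (i : ℕ) < s then 1 else 0) :
        Set (unitaryGroup h)) * (latticeStabilizer h (diagLattice ϖ R b 0) : Set _) := by
  have hq := H.q_ne_zero
  have hsn : s ≤ n / 2 := by omega
  -- the permutation exchanging `i` and `rev i` for `i < s`
  let f : Fin n → Fin n := fun i =>
    if (i : ℕ) < s ∨ ((Fin.rev i : Fin n) : ℕ) < s then Fin.rev i else i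
  have hf : Function.Involutive f := by
    intro i
    simp only [f]
    by_cases hi : (i : ℕ) < s ∨ ((Fin.rev i : Fin n) : ℕ) < s
    · rw [if_pos hi, Fin.rev_rev, if_pos hi.symm]
    · rw [if_neg hi, if_neg hi]
  let τ : Equiv.Perm (Fin n) := hf.toPerm
  have hτ : ∀ i, τ (Fin.rev i) = Fin.rev (τ i) := by
    intro i
    change f _ = Fin.rev (f i)
    simp only [f, Fin.rev_rev]
    by_cases hi : (i : ℕ) < s ∨ ((Fin.rev i : Fin n) : ℕ) < s
    · rw [if_pos hi, if_pos hi.symm, Fin.rev_rev]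
    · rw [if_neg hi, if_neg fun hn => hi hn.symm]
  have hc := isAntidiagonal_reindex (isAntidiagonal_scaleBasis hq hb (cochar_rev hs)) hτ
  set c := (scaleBasis hq b (cochar n s)).reindex τ.symm with hcdef
  have hcapp : ∀ i, c i = 𝓆 ^ cochar n s (f i) • b (f i) := fun i => by
    rw [hcdef, Module.Basis.reindex_apply, Equiv.symm_symm, scaleBasis_apply]
    rfl
  have hexp : ∀ i : Fin n, (if (i : ℕ) < s then 1 else 0 : ℤ) + cochar n s (f i) =
      if ((f i : Fin n) : ℕ) < s then 1 else 0 := by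
    intro i
    have := i.2
    have hval : ((f i : Fin n) : ℕ) =
        if (i : ℕ) < s ∨ n - (i + 1) < s then n - (i + 1) else (i : ℕ) := by
      simp only [f, Fin.val_rev, apply_ite Fin.val]
    rw [cochar, hval]
    split_ifs <;> omega
  have hspan : ∀ (μ μ' : Fin n → ℤ), (∀ i, μ i + cochar n s (f i) = μ' (f i)) →
      diagLattice ϖ R c μ = diagLattice ϖ R b μ' := by
    intro μ μ' hμ
    have h1 : (fun i => 𝓆 ^ μ i • c i) = (fun i => 𝓆 ^ μ' i • b i) ∘ f := by
      funext i
      rw [hcapp, smul_smul, ← zpow_add₀ hq, hμ]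
      rfl
    rw [diagLattice, diagLattice, h1, hf.surjective.range_comp]
  refine Set.mem_mul.2 ⟨transport hb hc, ?_, (transport hb hc)⁻¹ * domElt hq hb (fundIndex n s),
    ?_, mul_inv_cancel_left _ _⟩
  · rw [SetLike.mem_coe, mem_latticeStabilizer_iff, latticeMap_diagLattice (transport_apply hb hc)]
    exact hspan _ _ hexp
  · rw [SetLike.mem_coe, ← latticeMap_eq_iff, latticeMap_diagLattice (transport_apply hb hc),
      domElt, latticeMap_diagElt, domCochar_fundIndex hsn]
    exact hspan _ _ fun i => rfl

/-- The leading coefficient of an atomic function is one: exactly one lattice contributes. -/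
theorem atomic_domElt_fundIndex (H : IsUnramifiedIntegers R σ ϖ) (hb : IsAntidiagonal h b)
    (hs : 2 * s ≤ n) {Λ : Submodule R W}
    (hΛ : Λ = diagLattice ϖ R b fun i => if (i : ℕ) < s then 1 else 0)
    (h₁ : intertwining (latticeStabilizer h (diagLattice ϖ R b 0)) (latticeStabilizer h Λ) ∈
      heckeSpace (latticeStabilizer h (diagLattice ϖ R b 0)) (latticeStabilizer h Λ))
    (h₂ : intertwining (latticeStabilizer h Λ) (latticeStabilizer h (diagLattice ϖ R b 0)) ∈
      heckeSpace (latticeStabilizer h Λ) (latticeStabilizer h (diagLattice ϖ R b 0))) :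
    atomic (latticeStabilizer h (diagLattice ϖ R b 0)) (latticeStabilizer h Λ)
      (domElt H.q_ne_zero hb (fundIndex n s)) = 1 := by
  have hsn : s ≤ n / 2 := by omega
  rw [atomic, conv, finsum_eq_single _ ((1 : unitaryGroup h) : unitaryGroup h ⧸ _),
    out_eq h₁.2.1 h₂.1, inv_one, one_mul, intertwining, intertwining, charFun, charFun,
    Set.indicator_of_mem, Set.indicator_of_mem, Pi.one_apply, Pi.one_apply, mul_one]
  · rw [hΛ]
    exact domElt_mem_mul H hb hs
  · exact Set.mem_mul.2 ⟨1, one_mem _, 1, one_mem _, mul_one 1⟩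
  · intro y hy
    by_contra hne
    obtain ⟨r, hr, hrs, ⟨a, ha, hya⟩, hle⟩ := exists_latticeMap_le H hb hs hΛ
      (Set.mem_of_indicator_ne_zero (left_ne_zero_of_mul hne))
      (Set.mem_of_indicator_ne_zero (right_ne_zero_of_mul hne))
    obtain rfl : s = r := by
      have := congrArg (fun γ => partialSum γ (n / 2)) hrs
      simp only [partialSum_fundIndex hsn, partialSum_fundIndex hr] at this
      omega
    have h1 := length_latticeMap H (by omega : s ≤ n) ha
    have h2 := length_latticeMap (b := b) (s := s) H (by omega) (one_mem (latticeStabilizer h _))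
    rw [latticeMap_one] at h2
    have h3 : latticeMap y.out Λ = Λ := by
      refine le_antisymm (hΛ ▸ hle) fun x hx => ?_
      have hxL : x ∈ diagLattice ϖ R b 0 := by
        rw [hΛ] at hx
        exact (diagLattice_le_iff H).2
          (fun i => by simp only [Pi.zero_apply]; split_ifs <;> simp) hx
      rw [← hΛ] at hle h1 h2
      have h4 := eq_of_length_quotient_eq
        (submoduleOf_le_submoduleOf (diagLattice ϖ R b 0) hle)
        (by rw [hya, h1]; exact ENat.natCast_ne_top s) (by rw [hya, h1, h2])
      have h5 : (⟨x, hxL⟩ : diagLattice ϖ R b 0) ∈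
          Λ.submoduleOf (diagLattice ϖ R b 0) := hx
      rw [← h4] at h5
      exact h5
    refine hy ?_
    rw [← QuotientGroup.out_eq' y, QuotientGroup.eq, mul_one]
    exact (latticeStabilizer h Λ).inv_mem (mem_latticeStabilizer_iff.2 h3)

end Atomic

/-! ### The spherical Hecke algebra of a split hermitian space -/

section Spherical

variable {F₀ F R W : Type*} [Field F₀] [Field F] [Algebra F₀ F] [CommRing R] [Algebra R F]
  {σ : F ≃ₐ[F₀] F} {ϖ : F₀} [AddCommGroup W] [Module F W] [Module R W]
  {h : W →ₛₗ[(σ : F →+* F)] W →ₗ[F] F}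

local notation "𝓆" => algebraMap F₀ F ϖ

variable {n : ℕ} {b c : Module.Basis (Fin n) F W}
  [IsScalarTower R F W] [IsFractionRing R F] [IsDomain R] [IsDiscreteValuationRing R]

/-- The values of a bi-invariant function on the diagonal elements do not depend on the choice of
the antidiagonal basis of the self-dual lattice. -/
theorem apply_domElt_eq (hq : 𝓆 ≠ 0) (hb : IsAntidiagonal h b) (hc : IsAntidiagonal h c)
    (hbc : Submodule.span R (Set.range b) = Submodule.span R (Set.range c))
    {f : unitaryGroup h → ℚ}
    (hf : f ∈ heckeSpace (latticeStabilizer h (Submodule.span R (Set.range b)))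
      (latticeStabilizer h (Submodule.span R (Set.range b)))) (α : Fin (n / 2) →₀ ℕ) :
    f (domElt hq hb α) = f (domElt hq hc α) := by
  have ht := transport_mem hb hc hbc
  rw [← hf.1 _ ht, transport_mul_domElt, hf.2.1 _ ht]

/-- Vertex lattices of type zero are self-dual. -/
theorem IsVertexLattice.dualLattice_eq {Λ : Submodule R W} (hΛ : IsVertexLattice h ϖ 0 Λ) :
    dualLattice h Λ = Λ := by
  refine le_antisymm ?_ hΛ.le_dual
  have h1 := hΛ.type_eq
  rw [Nat.cast_zero, Module.length_eq_zero_iff, Submodule.Quotient.subsingleton_iff] at h1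
  exact Submodule.comap_subtype_eq_top.1 h1

theorem cocharElt_eq_domElt (hq : 𝓆 ≠ 0) (hb : IsAntidiagonal h b) {s : ℕ} (hs : 2 * s ≤ n)
    (hϖ : ϖ ≠ 0) : cocharElt hb hs hϖ = domElt hq hb (fundIndex n s) :=
  unitaryGroup_ext b fun i => by
    rw [cocharElt_apply, domElt, diagElt_apply, domCochar_fundIndex (by omega)]

variable {L : Submodule R W}

theorem basicFun_domElt (H : IsUnramifiedIntegers R σ ϖ) (hherm : h.IsSymm)
    (hb : IsAntidiagonal h b) (hbL : Submodule.span R (Set.range b) = L) {s : ℕ} (hs : 2 * s ≤ n)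
    (hϖ : ϖ ≠ 0) (α : Fin (n / 2) →₀ ℕ) :
    basicFun (latticeStabilizer h L) hb hs hϖ (domElt H.q_ne_zero hb α) =
      if α = fundIndex n s then 1 else 0 := by
  subst hbL
  rw [basicFun, cocharElt_eq_domElt H.q_ne_zero hb hs hϖ, charFun]
  split_ifs with hα
  · rw [Set.indicator_of_mem, Pi.one_apply]
    rw [hα]
    exact DoubleCoset.mem_doubleCoset_self _ _ _
  · refine Set.indicator_of_notMem (fun hmem => hα ?_) _
    obtain ⟨k, hk, k', hk', he⟩ := DoubleCoset.mem_doubleCoset.1 hmem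
    exact (isCartanSystem_domElt H hherm hb).eq_of_eq_mul_mul hk hk' he

variable [Finite (IsLocalRing.ResidueField R)] {Λ : Submodule R W} {s : ℕ}

theorem atomic_mem (H : IsUnramifiedIntegers R σ ϖ) (hL : L.IsLattice F) (hΛ : Λ.IsLattice F) :
    atomic (latticeStabilizer h L) (latticeStabilizer h Λ) ∈
      heckeSpace (latticeStabilizer h L) (latticeStabilizer h L) :=
  conv_mem (intertwining_mem H hL hΛ) (intertwining_mem H hΛ hL)

/-- The atomic function of a vertex lattice of type `2 * s` in terms of double cosets: it has
value one at the fundamental cocharacter with index `s`, and its support contains no dominant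
cocharacters other than the fundamental ones with index at most `s`. -/
theorem atomic_domElt (H : IsUnramifiedIntegers R σ ϖ) (hherm : h.IsSymm)
    (hb : IsAntidiagonal h b) (hbL : Submodule.span R (Set.range b) = L) (hs : 2 * s ≤ n)
    (hL : L.IsLattice F) (hLL : dualLattice h L = L) (hΛ : IsVertexLattice h ϖ (2 * s) Λ)
    (hΛL : Λ ≤ L) :
    atomic (latticeStabilizer h L) (latticeStabilizer h Λ)
        (domElt H.q_ne_zero hb (fundIndex n s)) = 1 ∧
      ∀ α, atomic (latticeStabilizer h L) (latticeStabilizer h Λ) (domElt H.q_ne_zero hb α) ≠ 0 →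
        ∃ r ≤ s, α = fundIndex n r := by
  obtain ⟨c, hc, hcL, hcΛ⟩ := hΛ.exists_basis H hherm hb hL hLL hΛL
  have hmem := atomic_mem (h := h) H hL hΛ.isLattice
  have htr := apply_domElt_eq (R := R) H.q_ne_zero hb hc (hbL.trans hcL.symm)
    (f := atomic (latticeStabilizer h L) (latticeStabilizer h Λ)) (by rwa [hbL])
  have h₁ := intertwining_mem (h := h) H hL hΛ.isLattice
  have h₂ := intertwining_mem (h := h) H hΛ.isLattice hL
  simp only [htr]
  rw [← hcL, span_eq_diagLattice (ϖ := ϖ)] at h₁ h₂ ⊢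
  exact ⟨atomic_domElt_fundIndex H hc hs hcΛ h₁ h₂,
    fun α hα => exists_fundIndex_of_atomic_ne_zero H hc hs hcΛ hα⟩

theorem hasLead_atomic (H : IsUnramifiedIntegers R σ ϖ) (hherm : h.IsSymm)
    (hb : IsAntidiagonal h b) (hbL : Submodule.span R (Set.range b) = L) (hs : 2 * s ≤ n)
    (hL : L.IsLattice F) (hLL : dualLattice h L = L) (hΛ : IsVertexLattice h ϖ (2 * s) Λ)
    (hΛL : Λ ≤ L) :
    HasLead (domElt H.q_ne_zero hb) (fun α (j : Fin (n / 2 + 1)) => partialSum α j)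
      (atomic (latticeStabilizer h L) (latticeStabilizer h Λ)) (fundIndex n s) where
  nonneg g := finsum_nonneg fun y => mul_nonneg
    (Set.indicator_nonneg (fun _ _ => zero_le_one) _)
    (Set.indicator_nonneg (fun _ _ => zero_le_one) _)
  ne_zero := by
    rw [(atomic_domElt H hherm hb hbL hs hL hLL hΛ hΛL).1]
    exact one_ne_zero
  size_le α hα j := by
    obtain ⟨r, hr, rfl⟩ := (atomic_domElt H hherm hb hbL hs hL hLL hΛ hΛL).2 α hα
    simp only [partialSum_fundIndex (show r ≤ n / 2 by omega),
      partialSum_fundIndex (show s ≤ n / 2 by omega)]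
    exact min_le_min_right _ hr

end Spherical

end UnitaryHecke

end

theorem mainTheorem3 (p : ℕ) [Fact p.Prime] (hp : p ≠ 2)
    {F₀ F W : Type*}
    [Field F₀] [Algebra ℚ_[p] F₀] [FiniteDimensional ℚ_[p] F₀]
    [Algebra ℤ_[p] F₀] [IsScalarTower ℤ_[p] ℚ_[p] F₀]
    [Field F] [Algebra F₀ F] (hquad : Module.finrank F₀ F = 2)
    [Algebra.FormallyUnramified (UnitaryHecke.baseIntegers p F₀) (UnitaryHecke.extIntegers p F₀ F)]
    (σ : F ≃ₐ[F₀] F) (hσ : σ ≠ 1)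
    (ϖ : F₀) (hϖ : UnitaryHecke.IsUniformizer p ϖ)
    [AddCommGroup W] [Module F W] (n : ℕ)
    (h : W →ₛₗ[(σ : F →+* F)] W →ₗ[F] F) (hherm : h.IsSymm) (hsplit : UnitaryHecke.IsSplit h n)
    (Ξ : Fin (n / 2 + 1) → Submodule (UnitaryHecke.extIntegers p F₀ F) W)
    (hΞ : ∀ s : Fin (n / 2 + 1), UnitaryHecke.IsVertexLattice h ϖ (2 * (s : ℕ)) (Ξ s)) (hchain : Antitone Ξ)
    (K : Fin (n / 2 + 1) → Subgroup (UnitaryHecke.unitaryGroup h))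
    (hK : ∀ s, K s = UnitaryHecke.latticeStabilizer h (Ξ s)) :
    -- the intertwining functions belong to the respective Hecke spaces
    (∀ s, UnitaryHecke.intertwining (K 0) (K s) ∈ UnitaryHecke.heckeSpace (K 0) (K s) ∧
      UnitaryHecke.intertwining (K s) (K 0) ∈ UnitaryHecke.heckeSpace (K s) (K 0)) ∧
    -- the Hecke algebra is the polynomial algebra in the atomic functions
    (∃ e : MvPolynomial (Fin (n / 2)) ℚ ≃ₐ[ℚ] UnitaryHecke.HeckeAlgebra (K 0),
      ∀ i : Fin (n / 2), (e (MvPolynomial.X i) : UnitaryHecke.unitaryGroup h → ℚ) =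
        UnitaryHecke.atomic (K 0) (K i.succ)) ∧
    -- there is a basis adapted to the self-dual lattice, and for each such basis
    -- the atomic functions are a unitriangular transform of the `f^{[t]}`
    (∃ b : Module.Basis (Fin n) F W, UnitaryHecke.IsAntidiagonal h b ∧
      Submodule.span (UnitaryHecke.extIntegers p F₀ F) (Set.range b) = Ξ 0) ∧
    ∀ (b : Module.Basis (Fin n) F W) (hb : UnitaryHecke.IsAntidiagonal h b),
      Submodule.span (UnitaryHecke.extIntegers p F₀ F) (Set.range b) = Ξ 0 →
      (∀ s : Fin (n / 2 + 1), UnitaryHecke.basicFun (K 0) hb (s := s) (by omega) hϖ.ne_zero ∈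
        UnitaryHecke.heckeSpace (K 0) (K 0)) ∧
      ∃ M : Matrix (Fin (n / 2 + 1)) (Fin (n / 2 + 1)) ℚ,
        M.BlockTriangular id ∧ (∀ s, M s s = 1) ∧
        ∀ s, UnitaryHecke.atomic (K 0) (K s) =
          ∑ r : Fin (n / 2 + 1), M r s •
            UnitaryHecke.basicFun (K 0) hb (s := r) (by omega) hϖ.ne_zero := by

  classical
  have hfd : FiniteDimensional F₀ F := Module.finite_of_finrank_pos (by omega)
  obtain ⟨_, _, _, H⟩ := UnitaryHecke.extIntegers_properties p hp σ hϖ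
  obtain rfl : K = fun s => UnitaryHecke.latticeStabilizer h (Ξ s) := funext hK
  obtain ⟨b₀, hb₀⟩ := hsplit
  have hL := (hΞ 0).isLattice
  have hLL : UnitaryHecke.dualLattice h (Ξ 0) = Ξ 0 := (hΞ 0).dualLattice_eq
  have hle : ∀ s, Ξ s ≤ Ξ 0 := fun s => hchain (Fin.zero_le s)
  obtain ⟨b, hb, hbL, -⟩ := (hΞ 0).exists_basis H hherm hb₀ hL hLL le_rfl
  refine ⟨fun s => ⟨UnitaryHecke.intertwining_mem H hL (hΞ s).isLattice,
    UnitaryHecke.intertwining_mem H (hΞ s).isLattice hL⟩, ?_, ⟨b, hb, hbL⟩, ?_⟩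
  · have hx := UnitaryHecke.isCartanSystem_domElt (R := UnitaryHecke.extIntegers p F₀ F) H hherm hb
    rw [hbL] at hx
    obtain ⟨e, he⟩ := hx.exists_algEquiv (fun i => ⟨_, UnitaryHecke.atomic_mem H hL
      (hΞ i.succ).isLattice⟩) fun i => by
        rw [← UnitaryHecke.fundIndex_succ]
        exact UnitaryHecke.hasLead_atomic H hherm hb hbL (by omega) hL hLL (hΞ i.succ) (hle _)
    exact ⟨e, fun i => by rw [he]⟩
  · clear b hb hbL
    intro b hb hbL
    have hmem : ∀ s : Fin (n / 2 + 1), UnitaryHecke.basicFun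
        (UnitaryHecke.latticeStabilizer h (Ξ 0)) hb (s := s) (by omega) hϖ.ne_zero ∈
        UnitaryHecke.heckeSpace (UnitaryHecke.latticeStabilizer h (Ξ 0))
          (UnitaryHecke.latticeStabilizer h (Ξ 0)) := fun s =>
      UnitaryHecke.charFun_doubleCoset_mem H hL hL _
    have hx := UnitaryHecke.isCartanSystem_domElt (R := UnitaryHecke.extIntegers p F₀ F) H hherm hb
    rw [hbL] at hx
    have hat := fun s : Fin (n / 2 + 1) =>
      UnitaryHecke.atomic_domElt H hherm hb hbL (by omega) hL hLL (hΞ s) (hle s)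
    have hinj : ∀ r r' : Fin (n / 2 + 1),
        UnitaryHecke.fundIndex n r = UnitaryHecke.fundIndex n r' → r = r' := by
      intro r r' hr
      have := congrArg (fun γ => UnitaryHecke.partialSum γ (n / 2)) hr
      simp only [UnitaryHecke.partialSum_fundIndex (Nat.le_of_lt_succ r.2),
        UnitaryHecke.partialSum_fundIndex (Nat.le_of_lt_succ r'.2)] at this
      exact Fin.ext (by omega)
    -- the coefficients are the values of the atomic functions at the fundamental cocharacters
    refine ⟨hmem, fun r s => UnitaryHecke.atomic (UnitaryHecke.latticeStabilizer h (Ξ 0))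
      (UnitaryHecke.latticeStabilizer h (Ξ s))
      (UnitaryHecke.domElt H.q_ne_zero hb (UnitaryHecke.fundIndex n r)), ?_,
      fun s => (hat s).1, fun s => ?_⟩
    · intro r s hrs
      by_contra hne
      obtain ⟨r', hr', he⟩ := (hat s).2 _ hne
      have h1 : r = ⟨r', by omega⟩ := hinj _ _ he
      rw [h1] at hrs
      exact absurd hr' (not_le.2 hrs)
    · refine hx.ext_apply (UnitaryHecke.atomic_mem H hL (hΞ s).isLattice)
        (sum_mem fun r _ => Submodule.smul_mem _ _ (hmem r)) fun α => ?_
      simp only [Finset.sum_apply, Pi.smul_apply, smul_eq_mul,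
        UnitaryHecke.basicFun_domElt H hherm hb hbL, mul_ite, mul_one, mul_zero]
      by_cases hα : ∃ r : Fin (n / 2 + 1), α = UnitaryHecke.fundIndex n r
      · obtain ⟨r, rfl⟩ := hα
        rw [Finset.sum_eq_single r, if_pos rfl]
        · exact fun r' _ hr' => if_neg fun he => hr' (hinj _ _ he).symm
        · exact fun hn => absurd (Finset.mem_univ r) hn
      · rw [Finset.sum_eq_zero fun r _ => if_neg fun he => hα ⟨r, he⟩]
        by_contra hne
        obtain ⟨r', hr', he⟩ := (hat s).2 _ hne
        exact hα ⟨⟨r', by omega⟩, he⟩
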